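/- Let $\mathbb B=\{0,1\}$. A weighted language is a function $\tilde p:\mathbb B^*\to\mathbb R_{\ge 0}$. For $\hat x\in\mathbb B^*$ let $Z(\hat x)=\sum_{x\in\mathbb B^*,\ \hat x\preceq x}\tilde p(x)$ be the total weight of the strings with prefix $\hat x$; $\tilde p$ is normalizable if $0<Z(\varepsilon)<\infty$. If moreover $Z(\hat x)>0$, put $p(b\mid\hat x)=Z(\hat x b)/Z(\hat x)$ for $b\in\mathbb B$ and $p(\$\mid\hat x)=\tilde p(\hat x)/Z(\hat x)$, where $\$$ stands for the end of the string. $\tilde p$ is efficiently computable if a Turing machine maps every $x$ to $\tilde p(x)$, written as a fraction of natural numbers in binary, in time polynomial in $|x|$. A Turing machine $M$ efficiently locally normalizes $\tilde p$ with compact parameters $(\theta_n)_{n\in\mathbb N}$, $\theta_n\in\mathbb B^*$, if $\tilde p$ is normalizable and there is a polynomial $P$ such that for every $n$: $|\theta_n|\le P(n)$; on input $\theta_n$ the machine $M$ outputs within $P(n)$ steps the description of a Turing machine $q_n$; and, for all $\hat x\in\mathbb B^*$ with $|\hat x|\le n$ and all $x\in\{0,1,\$\}$, the machine $q_n$ halts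 on input $\hat x x$ within $P(n)$ steps and, if $Z(\hat x)>0$ and $p(x\mid\hat x)$ is rational, outputs exactly $p(x\mid\hat x)$ as a fraction. (Nothing is required of the output where $p(x\mid\hat x)$ is irrational.) Consider Boolean formulas built from variables $A_1,A_2,\dots$ with $\neg,\wedge,\vee$, and let $\mathrm{enc}$ be the prefix-free encoding of formulas by bit strings in Polish notation: $\mathrm{enc}(A_{i+1})=00\,1^i0$, $\mathrm{enc}(\neg\phi)=01\,\mathrm{enc}(\phi)$, $\mathrm{enc}(\phi\wedge\psi)=10\,\mathrm{enc}(\phi)\,\mathrm{enc}(\psi)$, $\mathrm{enc}(\phi\vee\psi)=11\,\mathrm{enc}(\phi)\,\mathrm{enc}(\psi)$. Say that $a\in\mathbb B^j$ satisfies $\phi$ if the set of variables mentioned in $\phi$ is exactly $\{A_1,\dots,A_j\}$ and $\phi$ is true when $A_i=a_i$ for all $i$. Define $\tilde p(x)=(1/3)^{|x|+1}$ if $x=\mathrm{enc}(\phi)\,a$ for a formula $\phi$ and a string $a$ that satisfies $\phi$, and $\tilde p(x)=0$ otherwise. **Theorem.** The weighted language $\tilde p$ is efficiently computable and normalizable.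 If $\mathrm{NP}\not\subseteq\mathrm{P/poly}$, then there are no Turing machine $M$ and parameters $(\theta_n)_{n\in\mathbb N}$ such that $M$ efficiently locally normalizes $\tilde p$ with compact parameters $(\theta_n)_{n\in\mathbb N}$. Here a language $L\subseteq\mathbb B^*$ is in P/poly if there are a Turing machine $M$, strings $\theta_n\in\mathbb B^*$ and a polynomial $P$ such that for every $n$, $|\theta_n|\le P(n)$ and $M$ on input $\theta_n$ outputs within $P(n)$ steps the description of a Turing machine that decides membership in $L$ of every string of length $n$ within $P(n)$ steps. -/

import Mathlib

open scoped NNReal ENNReal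

namespace SeqModel

/-! ### Turing machines with a finite description

A single-tape Turing machine is a finite list of quadruples, run with Mathlib's `Turing.TM0`
semantics (two-way infinite tape; each step moves the head or writes a symbol).  States and tape
symbols are numbered; `0` is the start state and `0` is the blank.  A machine only knows the
finitely many states and symbols occurring in its list. -/

/-- In state `state`, reading `read`: perform `act` and go to state `next`. -/
structure Quadruple where
  state : ℕ
  read : ℕ
  act : Turing.TM0.Stmt ℕ
  next : ℕ

/-- A Turing machine, given by its (finite) table of instructions. -/
abbrev TM : Type := List Quadruple

/-- The transition function of a machine: the first applicable quadruple is used, and the machine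
halts when there is none. -/
def TM.toMachine (M : TM) : Turing.TM0.Machine ℕ ℕ := fun q a =>
  (M.find? fun r => r.state == q && r.read == a).map fun r => (r.next, r.act)

/-- `M.Outputs w v t`: started on the tape `w` (head on the first symbol, everything else blank)
the machine `M` halts after at most `t` steps, leaving the tape with exactly `v` (head on the first
symbol of `v`, everything else blank). -/
def TM.Outputs (M : TM) (w v : List ℕ) (t : ℕ) : Prop :=
  ∃ c : Turing.TM0.Cfg ℕ ℕ,
    Nonempty (StateTransition.EvalsToInTime (Turing.TM0.step M.toMachine)
      (Turing.TM0.init w) (some c) t) ∧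
    Turing.TM0.step M.toMachine c = none ∧ c.Tape = Turing.Tape.mk₁ v

/-- `M.HaltsIn w t`: started on the tape `w`, the machine `M` halts after at most `t` steps. -/
def TM.HaltsIn (M : TM) (w : List ℕ) (t : ℕ) : Prop :=
  ∃ c : Turing.TM0.Cfg ℕ ℕ,
    Nonempty (StateTransition.EvalsToInTime (Turing.TM0.step M.toMachine)
      (Turing.TM0.init w) (some c) t) ∧
    Turing.TM0.step M.toMachine c = none

/-- The tape symbol `1` stands for the bit `0`, and the tape symbol `2` for the bit `1`. -/
def bitSym (b : Bool) : ℕ := cond b 2 1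

/-- An additional tape symbol, used as separator and as the end-of-string symbol `$`. -/
def sepSym : ℕ := 3

/-- A bit string as a word on the tape. -/
def word (x : List Bool) : List ℕ := x.map bitSym

/-- A fraction `a / b` as a word on the tape: both numbers in binary, least significant bit first,
with a separator between them. -/
def fracWord (a b : ℕ) : List ℕ := word a.bits ++ sepSym :: word b.bits

/-- On input `w`, within `t` steps, `M` outputs a fraction whose value is the number `r`. -/
def TM.OutputsValue (M : TM) (w : List ℕ) (r : ℝ) (t : ℕ) : Prop :=
  ∃ a b : ℕ, b ≠ 0 ∧ (a : ℝ) / (b : ℝ) = r ∧ M.Outputs w (fracWord a b) t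

/-! ### Describing machines by bit strings -/

/-- Unary code of a number: `n` ones followed by a zero. -/
def unary (n : ℕ) : List Bool := List.replicate n true ++ [false]

/-- Code of an elementary action. -/
def actCode : Turing.TM0.Stmt ℕ → List Bool
  | .move .left => [false, false]
  | .move .right => [false, true]
  | .write a => true :: unary a

/-- Code of an instruction. -/
def Quadruple.code (r : Quadruple) : List Bool :=
  unary r.state ++ unary r.read ++ actCode r.act ++ unary r.next

/-- The description of a machine as a bit string: each instruction is preceded by a one, and the
list is terminated by a zero. -/
def TM.code : TM → List Bool
  | [] => [false]
  | r :: M => true :: (r.code ++ TM.code M)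

theorem unary_append_inj {m n : ℕ} {u v : List Bool} (h : unary m ++ u = unary n ++ v) :
    m = n ∧ u = v := by
  induction m generalizing n with
  | zero => cases n <;> simp_all [unary, List.replicate_succ]
  | succ m ih =>
    cases n with
    | zero => simp [unary, List.replicate_succ] at h
    | succ n =>
      have := @ih n (by simpa [unary, List.replicate_succ] using h)
      exact ⟨by rw [this.1], this.2⟩

theorem actCode_append_inj {s t : Turing.TM0.Stmt ℕ} {u v : List Bool}
    (h : actCode s ++ u = actCode t ++ v) : s = t ∧ u = v := by
  rcases s with (_ | _) | a <;> rcases t with (_ | _) | b <;> simp_all [actCode]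
  exact unary_append_inj h

/-- A description determines the machine. -/
theorem TM.code_injective : Function.Injective TM.code := by
  intro M
  induction M with
  | nil => intro N h; cases N <;> simp_all [TM.code]
  | cons r M ih =>
    intro N h
    cases N with
    | nil => simp [TM.code] at h
    | cons s N =>
      simp only [TM.code, Quadruple.code, List.cons.injEq, true_and, List.append_assoc] at h
      obtain ⟨h1, h⟩ := unary_append_inj h
      obtain ⟨h2, h⟩ := unary_append_inj h
      obtain ⟨h3, h⟩ := actCode_append_inj h
      obtain ⟨h4, h⟩ := unary_append_inj h
      rw [ih h]
      cases r; cases s; simp_all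

/-- `M.Builds θ M' t`: on input `θ`, the machine `M` outputs, within `t` steps, the description of
the machine `M'`. -/
def TM.Builds (M : TM) (θ : List Bool) (M' : TM) (t : ℕ) : Prop :=
  M.Outputs (word θ) (word M'.code) t

/-! ### The classes NP and P/poly -/

/-- `M` answers the question `P` on input `w` within `t` steps. -/
def TM.Answers (M : TM) (w : List ℕ) (P : Prop) (t : ℕ) : Prop :=
  (P → M.Outputs w (word [true]) t) ∧ (¬ P → M.Outputs w (word [false]) t)

/-- The class NP: `x ∈ L` iff there is a polynomially long certificate `c` for which the relation
`R x c` holds, where `R` is decidable in time polynomial in the lengths of `x` and `c`. -/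
def NP : Set (Language Bool) :=
  {L | ∃ (R : List Bool → List Bool → Prop) (M : TM) (T P : Polynomial ℕ),
    (∀ x c, M.Answers (word x ++ sepSym :: word c) (R x c) (T.eval (x.length + c.length))) ∧
    ∀ x, x ∈ L ↔ ∃ c : List Bool, c.length ≤ P.eval x.length ∧ R x c}

/-- The class P/poly: from advice strings `θ n` of polynomial length, one machine `M` builds in
polynomial time machines `M'` that decide in polynomial time the inputs of length `n`. -/
def PPoly : Set (Language Bool) :=
  {L | ∃ (M : TM) (θ : ℕ → List Bool) (P : Polynomial ℕ), ∀ n : ℕ,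
    (θ n).length ≤ P.eval n ∧
    ∃ M' : TM, M.Builds (θ n) M' (P.eval n) ∧
      ∀ x : List Bool, x.length = n → M'.Answers (word x) (x ∈ L) (P.eval n)}

/-! ### Weighted languages over the alphabet `{0,1}` -/

/-- A weighted language assigns a nonnegative real weight to every bit string. -/
abbrev WeightedLanguage : Type := List Bool → ℝ≥0

namespace WeightedLanguage

/-- `Z u`: the total weight of all strings that have `u` as a prefix. -/
noncomputable def prefixWeight (p : WeightedLanguage) (u : List Bool) : ℝ≥0∞ :=
  ∑' x : {x : List Bool // u <+: x}, (p x.1 : ℝ≥0∞)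

/-- The global normalizing constant is positive and finite. -/
def Normalizable (p : WeightedLanguage) : Prop :=
  0 < ∑' x : List Bool, (p x : ℝ≥0∞) ∧ ∑' x : List Bool, (p x : ℝ≥0∞) < ∞

/-- The local conditional probability that the prefix `u` is followed by the bit `b` (`some b`), or
that the string ends after `u` (`none`).  It is meaningful if `p` is normalizable and
`p.prefixWeight u` is positive. -/
noncomputable def localProb (p : WeightedLanguage) (u : List Bool) : Option Bool → ℝ
  | some b => (p.prefixWeight (u ++ [b]) / p.prefixWeight u).toReal
  | none => ((p u : ℝ≥0∞) / p.prefixWeight u).toReal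

/-- A Turing machine computes the weight of every string in time polynomial in its length. -/
def EfficientlyComputable (p : WeightedLanguage) : Prop :=
  ∃ (M : TM) (T : Polynomial ℕ), ∀ x : List Bool,
    M.OutputsValue (word x) (p x) (T.eval x.length)

/-- The input of a local model: a prefix followed by a bit or by the end-of-string symbol. -/
def queryWord (u : List Bool) : Option Bool → List ℕ
  | some b => word (u ++ [b])
  | none => word u ++ [sepSym]

/-- `M` efficiently locally normalizes `p` with compact parameters `θ`: the parameters `θ n` have
polynomial length, `M` builds from them in polynomial time a machine `q`, and `q` runs in polynomial
time on all inputs made of a prefix `u` of length at most `n` and a next symbol, mapping them to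
the conditional probability of this symbol given `u`, whenever `u` has positive prefix weight.
As `q` outputs fractions, its output is prescribed only if this probability is rational. -/
def EfficientlyLocallyNormalizedBy (p : WeightedLanguage) (M : TM) (θ : ℕ → List Bool) : Prop :=
  p.Normalizable ∧
  ∃ P : Polynomial ℕ, ∀ n : ℕ,
    (θ n).length ≤ P.eval n ∧
    ∃ q : TM, M.Builds (θ n) q (P.eval n) ∧
      ∀ (u : List Bool) (s : Option Bool), u.length ≤ n →
        q.HaltsIn (queryWord u s) (P.eval n) ∧
        (0 < p.prefixWeight u → p.localProb u s ∈ Set.range ((↑) : ℚ → ℝ) →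
          q.OutputsValue (queryWord u s) (p.localProb u s) (P.eval n))

end WeightedLanguage

/-! ### Boolean formulas and the weighted language of satisfied formulas -/

/-- Boolean formulas; `var i` is the variable `A_{i+1}`. -/
inductive Formula : Type
  | var (i : ℕ)
  | neg (φ : Formula)
  | and (φ ψ : Formula)
  | or (φ ψ : Formula)

namespace Formula

/-- The variables mentioned in a formula. -/
def vars : Formula → Finset ℕ
  | var i => {i}
  | neg φ => φ.vars
  | and φ ψ => φ.vars ∪ ψ.vars
  | or φ ψ => φ.vars ∪ ψ.vars

/-- The truth value of a formula. -/
def eval (a : ℕ → Bool) : Formula → Bool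
  | var i => a i
  | neg φ => !(φ.eval a)
  | and φ ψ => φ.eval a && ψ.eval a
  | or φ ψ => φ.eval a || ψ.eval a

/-- The encoding of formulas: Polish notation, the index of a variable being written in unary. -/
def enc : Formula → List Bool
  | var i => [false, false] ++ unary i
  | neg φ => [false, true] ++ φ.enc
  | and φ ψ => [true, false] ++ (φ.enc ++ ψ.enc)
  | or φ ψ => [true, true] ++ (φ.enc ++ ψ.enc)

/-- The encoding is injective and prefix-free. -/
theorem enc_append_inj (φ ψ : Formula) (u v : List Bool) (h : φ.enc ++ u = ψ.enc ++ v) :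
    φ = ψ ∧ u = v := by
  induction φ generalizing ψ u v with
  | var i =>
    cases ψ <;> simp [enc] at h
    simpa using unary_append_inj h
  | neg φ ih =>
    cases ψ <;> simp [enc] at h
    simpa using ih _ _ _ h
  | and φ₁ φ₂ ih₁ ih₂ =>
    cases ψ <;> simp [enc] at h
    obtain ⟨rfl, h2⟩ := ih₁ _ _ _ h
    simpa using ih₂ _ _ _ h2
  | or φ₁ φ₂ ih₁ ih₂ =>
    cases ψ <;> simp [enc] at h
    obtain ⟨rfl, h2⟩ := ih₁ _ _ _ h
    simpa using ih₂ _ _ _ h2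

/-- `a` satisfies `φ`: the variables mentioned in `φ` are exactly `A_1, …, A_j`, the string `a` has
length `j`, and `φ` is true under the assignment `A_1 = a_1, …, A_j = a_j`. -/
def SatisfiedBy (φ : Formula) (a : List Bool) : Prop :=
  φ.vars = Finset.range a.length ∧ φ.eval (fun i => a.getD i false) = true

end Formula

/-- The strings `enc(φ) a` where `a` satisfies `φ`. -/
def satStrings : Language Bool :=
  {x | ∃ (φ : Formula) (a : List Bool), φ.SatisfiedBy a ∧ x = φ.enc ++ a}

open Classical in
/-- The weighted language that gives weight `(1/3)^(|x|+1)` to every string `x = enc(φ) a` where `a`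
satisfies `φ`, and weight `0` to all other strings. -/
noncomputable def satWeight : WeightedLanguage := fun x =>
  if x ∈ satStrings then (1 / 3 : ℝ≥0) ^ (x.length + 1) else 0

end SeqModel

/-!
At most `2 ^ n` strings have length `n`, so the weights are summable. A prefix `enc φ` is continued
exactly by the assignments satisfying `φ`, which have the same length; hence the local conditional
probabilities after `enc φ` are rational, and `p(0 ∣ enc φ)` is nonzero iff `φ` has a satisfying
assignment that starts with `0`.

Let `L` be in NP. A word `x` is in `L` iff some assignment `a` describes an accepting tableau `ρ(a)`
of the verifier on `x` and some certificate. The query `A₁ ∨ (ι = x ∧ ρ)`, where `ι` are the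
variables that describe the input and `A₁` is not used by the tableau, is always satisfiable, so
that the probabilities after its code are defined, and it has a satisfying assignment that starts
with `0` iff `x ∈ L`. Its size is bounded by a polynomial in the length of `x`. From the machine `q`
provided for queries of that size one thus obtains a decider for all `x` of the given length:
compute the code of the query followed by `0`, run `q`, and compare the result with zero. Its
description is polynomially long, hence serves as the advice string.
-/

namespace SeqModel

open Turing

/-! ### Executions of machines -/

namespace TM

/-- `M.Steps c n c'`: the machine `M` goes from the configuration `c` to `c'` in exactly `n`
steps. -/
def Steps (M : TM) (c : TM0.Cfg ℕ ℕ) (n : ℕ) (c' : TM0.Cfg ℕ ℕ) : Prop :=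
  (flip bind (TM0.step M.toMachine))^[n] (some c) = some c'

section Steps

variable {M : TM} {c c' c'' : TM0.Cfg ℕ ℕ} {n n' : ℕ}

theorem steps_zero : M.Steps c 0 c' ↔ c = c' := by simp [Steps]

theorem steps_succ : M.Steps c (n + 1) c' ↔
    ∃ d, TM0.step M.toMachine c = some d ∧ M.Steps d n c' := by
  have halted : (flip Option.bind (TM0.step M.toMachine))^[n] none = none :=
    Function.iterate_fixed rfl n
  cases h : TM0.step M.toMachine c with
  | none => simp [Steps, flip, h, halted]
  | some d => simp [Steps, flip, h]

theorem Steps.trans (h : M.Steps c n c') (h' : M.Steps c' n' c'') : M.Steps c (n + n') c'' := by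
  unfold Steps at *
  rw [Nat.add_comm, Function.iterate_add_apply, h, h']

theorem steps_one : M.Steps c 1 c' ↔ TM0.step M.toMachine c = some c' := by
  simp [steps_succ, steps_zero]

end Steps

theorem outputs_iff {M : TM} {w v : List ℕ} {t : ℕ} :
    M.Outputs w v t ↔ ∃ n ≤ t, ∃ s, M.Steps (TM0.init w) n ⟨s, Tape.mk₁ v⟩ ∧
      M.toMachine s (Tape.mk₁ v).head = none := by
  constructor
  · rintro ⟨⟨s, T⟩, ⟨⟨⟨n, hn⟩, hle⟩⟩, halted, rfl⟩
    exact ⟨n, hle, s, hn, by simpa [TM0.step] using halted⟩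
  · rintro ⟨n, hle, s, hn, halted⟩
    exact ⟨⟨s, _⟩, ⟨⟨⟨n, hn⟩, hle⟩⟩, by simp [TM0.step, halted], rfl⟩

theorem Outputs.mono {M : TM} {w v : List ℕ} {t t' : ℕ} (h : M.Outputs w v t) (ht : t ≤ t') :
    M.Outputs w v t' := by
  rw [outputs_iff] at *
  exact h.imp fun n hn => ⟨hn.1.trans ht, hn.2⟩

/-! ### Instruction tables -/

variable {M A B : TM} {s a : ℕ}

theorem toMachine_append :
    (A ++ B : TM).toMachine s a = (A.toMachine s a).or (B.toMachine s a) := by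
  simp [toMachine, List.find?_append, Option.map_or]

theorem toMachine_eq_none (h : ∀ r ∈ A, r.state ≠ s) : A.toMachine s a = none := by
  simp only [toMachine, Option.map_eq_none_iff, List.find?_eq_none, Bool.and_eq_true, beq_iff_eq]
  exact fun r hr hs => h r hr hs.1

theorem exists_mem_of_toMachine {x : ℕ × TM0.Stmt ℕ} (h : M.toMachine s a = some x) :
    ∃ r ∈ M, r.state = s ∧ r.read = a ∧ r.next = x.1 ∧ r.act = x.2 := by
  obtain ⟨r, hr, rfl⟩ := Option.map_eq_some_iff.1 h
  have hsa : r.state = s ∧ r.read = a := by simpa using List.find?_some hr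
  exact ⟨r, List.mem_of_find?_eq_some hr, hsa.1, hsa.2, rfl, rfl⟩

/-- The instructions of the states in `states`, all acting alike: on reading `a < m`, the machine
goes to the state `(g a).1` and does `(g a).2`. -/
def table (m : ℕ) (states : List ℕ) (g : ℕ → ℕ × TM0.Stmt ℕ) : TM :=
  states.flatMap fun s => (List.range m).map fun a => ⟨s, a, (g a).2, (g a).1⟩

section table

variable {m : ℕ} {states : List ℕ} {g : ℕ → ℕ × TM0.Stmt ℕ}

theorem mem_table {r : Quadruple} :
    r ∈ table m states g ↔ r.state ∈ states ∧ r.read < m ∧ g r.read = (r.next, r.act) := by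
  rcases r with ⟨s, a, act, next⟩
  simp only [table, List.mem_flatMap, List.mem_map, List.mem_range, Quadruple.mk.injEq]
  constructor
  · rintro ⟨_, hs, _, ha, rfl, rfl, rfl, rfl⟩
    exact ⟨hs, ha, rfl⟩
  · rintro ⟨hs, ha, hg⟩
    exact ⟨s, hs, a, ha, rfl, rfl, by simp [hg], by simp [hg]⟩

theorem toMachine_table (hs : s ∈ states) (ha : a < m) :
    (table m states g).toMachine s a = some (g a) := by
  have hmem : ⟨s, a, (g a).2, (g a).1⟩ ∈ table m states g := mem_table.2 ⟨hs, ha, rfl⟩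
  have hsome : ((table m states g).toMachine s a).isSome := by
    simp only [toMachine, Option.isSome_map, List.find?_isSome]
    exact ⟨_, hmem, by simp⟩
  obtain ⟨x, hx⟩ := Option.isSome_iff_exists.1 hsome
  obtain ⟨r, hr, -, rfl, hnext, hact⟩ := exists_mem_of_toMachine hx
  rw [hx, (mem_table.1 hr).2.2, hnext, hact]

end table

/-- A number exceeding all states of a machine. -/
def stateBound (M : TM) : ℕ := (M.map fun r => r.state + r.next).sum + 1

theorem lt_stateBound {r : Quadruple} (h : r ∈ M) :
    r.state < M.stateBound ∧ r.next < M.stateBound := by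
  have := List.single_le_sum (l := M.map fun r => r.state + r.next) (by simp) (r.state + r.next)
    (List.mem_map_of_mem h)
  unfold stateBound
  omega

/-- The machine with all states shifted by `e`. -/
def shift (e : ℕ) (M : TM) : TM := M.map fun r => ⟨e + r.state, r.read, r.act, e + r.next⟩

theorem toMachine_shift (e : ℕ) (M : TM) (s a : ℕ) :
    (shift e M).toMachine (e + s) a = (M.toMachine s a).map fun x => (e + x.1, x.2) := by
  have hstate : ∀ s', (e + s' == e + s) = (s' == s) := by grind
  simp [toMachine, shift, List.find?_map, Function.comp_def, hstate]

/-- `M.AgreesOn A e k`: in the states `e, …, e + k - 1` the machine `M` acts like `A`. -/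
def AgreesOn (M A : TM) (e k : ℕ) : Prop :=
  ∀ s, e ≤ s → s < e + k → ∀ a, M.toMachine s a = A.toMachine s a

section AgreesOn

variable {e k e' k' : ℕ}

theorem AgreesOn.left (h : M.AgreesOn (A ++ B) e k) (hk : k' ≤ k)
    (hB : ∀ r ∈ B, e + k' ≤ r.state) : M.AgreesOn A e k' := by
  intro s hes hsk a
  have hBs : B.toMachine s a = none := toMachine_eq_none fun r hr => by have := hB r hr; omega
  rw [h s hes (by omega), toMachine_append, hBs, Option.or_none]

theorem AgreesOn.right (h : M.AgreesOn (A ++ B) e k) (he : e ≤ e') (hk : e' + k' ≤ e + k)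
    (hA : ∀ r ∈ A, r.state < e') : M.AgreesOn B e' k' := by
  intro s hes hsk a
  have hAs : A.toMachine s a = none := toMachine_eq_none fun r hr => by have := hA r hr; omega
  rw [h s (by omega) (by omega), toMachine_append, hAs, Option.none_or]

end AgreesOn

end TM

/-! ### Tapes indexed by the integers -/

/-- A tape with a head position.  In contrast to `Turing.Tape`, cells have absolute positions. -/
abbrev HeadTape (Γ : Type*) : Type _ := (ℤ → Γ) × ℤ

/-- The effect of an elementary action on Mathlib's tapes. -/
def tapeApply {Γ : Type*} [Inhabited Γ] (T : Tape Γ) : TM0.Stmt Γ → Tape Γ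
  | .move d => T.move d
  | .write b => T.write b

namespace HeadTape

variable {Γ : Type*}

/-- The effect of an elementary action. -/
def apply (c : HeadTape Γ) : TM0.Stmt Γ → HeadTape Γ
  | .move .left => (c.1, c.2 - 1)
  | .move .right => (c.1, c.2 + 1)
  | .write a => (Function.update c.1 c.2 a, c.2)

/-- The scanned symbol. -/
def head (c : HeadTape Γ) : Γ := c.1 c.2

variable [Inhabited Γ]

/-- `c` represents Mathlib's tape `T`, whose cells are indexed relative to the head. -/
def Rep (c : HeadTape Γ) (T : Tape Γ) : Prop := ∀ j, T.nth j = c.1 (c.2 + j)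

variable {c : HeadTape Γ} {T T' : Tape Γ}

theorem Rep.head_eq (h : c.Rep T) : T.head = c.head := by simpa [head] using h 0

theorem Rep.apply (h : c.Rep T) (a : TM0.Stmt Γ) : (c.apply a).Rep (tapeApply T a) := by
  intro j
  rcases a with (_ | _) | a
  · exact (Tape.move_left_nth T j).trans
      ((h _).trans (congrArg c.1 (show c.2 + (j - 1) = c.2 - 1 + j by ring)))
  · exact (Tape.move_right_nth T j).trans
      ((h _).trans (congrArg c.1 (show c.2 + (j + 1) = c.2 + 1 + j by ring)))
  · refine (Tape.write_nth a T).trans ?_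
    by_cases hj : j = 0 <;> simp [HeadTape.apply, hj, h j]

theorem Rep.unique (h : c.Rep T) (h' : c.Rep T') : T = T' := by
  have hnth : ∀ j, T.nth j = T'.nth j := fun j => (h j).trans (h' j).symm
  obtain ⟨a, L, R⟩ := T
  obtain ⟨a', L', R'⟩ := T'
  have ha : a = a' := hnth 0
  have hR : R = R' := ListBlank.ext fun i => hnth (i + 1 : ℕ)
  have hL : L = L' := ListBlank.ext fun i => hnth (-(i + 1 : ℕ))
  rw [ha, hR, hL]

/-- The word `w` on an otherwise blank tape, head on the first symbol. -/
def ofWord (w : List Γ) : HeadTape Γ := (fun j => if 0 ≤ j then w.getI j.toNat else default, 0)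

theorem rep_ofWord (w : List Γ) : (ofWord w).Rep (Tape.mk₁ w) := by
  rintro (n | n)
  · simp [Tape.mk₁, Tape.mk₂, ofWord]
  · cases w <;> simp [ofWord] <;> rfl

end HeadTape

namespace TM

variable {M : TM} {s s' : ℕ} {T : Tape ℕ}

theorem step_eq {a : TM0.Stmt ℕ} (h : M.toMachine s T.head = some (s', a)) :
    TM0.step M.toMachine ⟨s, T⟩ = some ⟨s', tapeApply T a⟩ := by
  simp only [TM0.step, h]
  cases a <;> rfl

theorem exists_of_step_eq_some {d : TM0.Cfg ℕ ℕ} (h : TM0.step M.toMachine ⟨s, T⟩ = some d) :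
    ∃ a, M.toMachine s T.head = some (d.q, a) ∧ d.Tape = tapeApply T a := by
  obtain ⟨⟨s', a⟩, hM, rfl⟩ := Option.map_eq_some_iff.1 h
  exact ⟨a, hM, by cases a <;> rfl⟩

/-- `M.Reaches e c x d t`: started in the state `e` on the tape `c`, the machine `M` arrives within
`t` steps in the state `x` on the tape `d`. -/
def Reaches (M : TM) (e : ℕ) (c : HeadTape ℕ) (x : ℕ) (d : HeadTape ℕ) (t : ℕ) : Prop :=
  ∀ T, c.Rep T → ∃ T', d.Rep T' ∧ ∃ n ≤ t, M.Steps ⟨e, T⟩ n ⟨x, T'⟩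

namespace Reaches

variable {e f x t t' : ℕ} {b c d : HeadTape ℕ}

theorem trans (h : M.Reaches e b f c t) (h' : M.Reaches f c x d t') :
    M.Reaches e b x d (t + t') := by
  intro T hT
  obtain ⟨T₁, hT₁, n, hn, hs⟩ := h T hT
  obtain ⟨T₂, hT₂, n', hn', hs'⟩ := h' T₁ hT₁
  exact ⟨T₂, hT₂, n + n', add_le_add hn hn', hs.trans hs'⟩

theorem mono (h : M.Reaches e c x d t) (ht : t ≤ t') : M.Reaches e c x d t' := by
  intro T hT
  obtain ⟨T₁, hT₁, n, hn, hs⟩ := h T hT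
  exact ⟨T₁, hT₁, n, hn.trans ht, hs⟩

theorem of_instruction {a : TM0.Stmt ℕ} (h : M.toMachine e c.head = some (x, a)) :
    M.Reaches e c x (c.apply a) 1 := fun T hT =>
  ⟨tapeApply T a, hT.apply a, 1, le_rfl, steps_one.2 (step_eq (by rwa [hT.head_eq]))⟩

theorem of_rewrite (h : M.toMachine e c.head = some (x, .write c.head)) :
    M.Reaches e c x c 1 := by
  simpa [HeadTape.apply, HeadTape.head] using of_instruction h

end Reaches

end TM

/-! ### Tape programs -/

/-- Structured programs acting on a tape. `act` performs the action determined by the scanned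
symbol, and `call` runs a Turing machine until it halts. -/
inductive Prog : Type
  | act (g : ℕ → TM0.Stmt ℕ)
  | seq (p q : Prog)
  | ite (S : ℕ → Bool) (p q : Prog)
  | loop (S : ℕ → Bool) (p : Prog)
  | call (M : TM)

namespace Prog

/-- Big-step semantics of tape programs over the alphabet `{0, …, m - 1}`; the last argument bounds
the number of steps. -/
inductive Run (m : ℕ) : Prog → HeadTape ℕ → HeadTape ℕ → ℕ → Prop
  | act {g : ℕ → TM0.Stmt ℕ} {c : HeadTape ℕ} :
      c.head < m → Run m (.act g) c (c.apply (g c.head)) 1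
  | seq {p q : Prog} {b c d : HeadTape ℕ} {t t' : ℕ} :
      Run m p b c t → Run m q c d t' → Run m (.seq p q) b d (t + t')
  | ite_true {S : ℕ → Bool} {p q : Prog} {c d : HeadTape ℕ} {t : ℕ} :
      c.head < m → S c.head = true → Run m p c d t → Run m (.ite S p q) c d (1 + t)
  | ite_false {S : ℕ → Bool} {p q : Prog} {c d : HeadTape ℕ} {t : ℕ} :
      c.head < m → S c.head = false → Run m q c d t → Run m (.ite S p q) c d (1 + t)
  | loop_false {S : ℕ → Bool} {p : Prog} {c : HeadTape ℕ} :
      c.head < m → S c.head = false → Run m (.loop S p) c c 1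
  | loop_true {S : ℕ → Bool} {p : Prog} {b c d : HeadTape ℕ} {t t' : ℕ} :
      b.head < m → S b.head = true → Run m p b c t → Run m (.loop S p) c d t' →
      Run m (.loop S p) b d (1 + t + t')
  | call {M : TM} {w v : List ℕ} {t : ℕ} :
      M.Outputs w v t → (HeadTape.ofWord v).head < m →
      Run m (.call M) (.ofWord w) (.ofWord v) (t + 1)
  | mono {p : Prog} {c d : HeadTape ℕ} {t t' : ℕ} : Run m p c d t → t ≤ t' → Run m p c d t'

/-- The number of states used by the compiled program. -/
def size : Prog → ℕ
  | act _ => 1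
  | seq p q => p.size + q.size
  | ite _ p q => 1 + (p.size + q.size)
  | loop _ p => 1 + p.size
  | call M => M.stateBound

/-- Compilation: the entry state is `e`, the states `e, …, e + size - 1` are used, and the state on
termination is `x`.  A called machine is followed by a table that covers every pair of a state and
a symbol: it takes over as soon as the machine has no applicable instruction. -/
def compile (m : ℕ) : Prog → ℕ → ℕ → TM
  | act g, e, x => TM.table m [e] fun a => (x, g a)
  | seq p q, e, x => p.compile m e (e + p.size) ++ q.compile m (e + p.size) x
  | ite S p q, e, x =>
      TM.table m [e] (fun a => (bif S a then e + 1 else e + 1 + p.size, .write a)) ++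
        (p.compile m (e + 1) x ++ q.compile m (e + 1 + p.size) x)
  | loop S p, e, x =>
      TM.table m [e] (fun a => (bif S a then e + 1 else x, .write a)) ++ p.compile m (e + 1) e
  | call M, e, x => M.shift e ++ TM.table m (List.range' e M.stateBound) fun a => (x, .write a)

variable {m : ℕ}

theorem state_of_mem_compile {p : Prog} {e x : ℕ} {r : Quadruple} (h : r ∈ p.compile m e x) :
    e ≤ r.state ∧ r.state < e + p.size := by
  induction p generalizing e x with simp only [compile, size, List.mem_append, TM.mem_table,
    List.mem_singleton, List.mem_range'_1, TM.shift, List.mem_map] at h ⊢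
  | act g => omega
  | seq p q ihp ihq =>
    rcases h with h | h
    · have := ihp h; omega
    · have := ihq h; omega
  | ite S p q ihp ihq =>
    rcases h with h | h | h
    · omega
    · have := ihp h; omega
    · have := ihq h; omega
  | loop S p ihp =>
    rcases h with h | h
    · omega
    · have := ihp h; omega
  | call M =>
    rcases h with ⟨r, hr, rfl⟩ | h
    · have := TM.lt_stateBound hr
      dsimp only
      omega
    · exact h.1

end Prog

namespace TM

variable {M A : TM} {e k : ℕ}

theorem AgreesOn.toMachine_table {m : ℕ} {g : ℕ → ℕ × TM0.Stmt ℕ}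
    (h : M.AgreesOn (table m [e] g ++ A) e k) (hk : 0 < k) {a : ℕ} (ha : a < m) :
    M.toMachine e a = some (g a) := by
  rw [h e le_rfl (by omega), toMachine_append, TM.toMachine_table (by simp) ha, Option.some_or]

theorem AgreesOn.after_table {m k' : ℕ} {g : ℕ → ℕ × TM0.Stmt ℕ}
    (h : M.AgreesOn (table m [e] g ++ A) e (1 + k')) : M.AgreesOn A (e + 1) k' :=
  h.right (by omega) (by omega) fun r hr => by
    rw [List.mem_singleton.1 (mem_table.1 hr).1]
    omega

theorem AgreesOn.steps_shift {N : TM} {n s s' : ℕ} {T T' : Tape ℕ}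
    (h : M.AgreesOn (N.shift e ++ A) e N.stateBound) (hs : s < N.stateBound)
    (hN : N.Steps ⟨s, T⟩ n ⟨s', T'⟩) :
    s' < N.stateBound ∧ M.Steps ⟨e + s, T⟩ n ⟨e + s', T'⟩ := by
  induction n generalizing s T with
  | zero =>
    obtain ⟨rfl, rfl⟩ := TM0.Cfg.mk.inj (steps_zero.1 hN)
    exact ⟨hs, steps_zero.2 rfl⟩
  | succ n ih =>
    obtain ⟨⟨s₁, T₁⟩, hstep, hrest⟩ := steps_succ.1 hN
    obtain ⟨a, ha, rfl⟩ := exists_of_step_eq_some hstep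
    have hs₁ : s₁ < N.stateBound := by
      obtain ⟨r, hr, -, -, rfl, -⟩ := exists_mem_of_toMachine ha
      exact (lt_stateBound hr).2
    have hM : M.toMachine (e + s) T.head = some (e + s₁, a) := by
      rw [h _ (by omega) (by omega), toMachine_append, toMachine_shift, ha]
      rfl
    obtain ⟨hs', hsteps⟩ := ih hs₁ hrest
    exact ⟨hs', steps_succ.2 ⟨_, step_eq hM, hsteps⟩⟩

theorem AgreesOn.reaches_call {N : TM} {m x t : ℕ} {w v : List ℕ}
    (h : M.AgreesOn ((Prog.call N).compile m e x) e N.stateBound) (hN : N.Outputs w v t)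
    (hv : (HeadTape.ofWord v).head < m) :
    M.Reaches e (.ofWord w) x (.ofWord v) (t + 1) := by
  obtain ⟨n, hn, s, hsteps, halted⟩ := outputs_iff.1 hN
  obtain ⟨hs, hsteps'⟩ := h.steps_shift (by simp [stateBound]) hsteps
  have hrep := HeadTape.rep_ofWord v
  have hexit : M.toMachine (e + s) (HeadTape.ofWord v).head
      = some (x, .write (HeadTape.ofWord v).head) := by
    rw [h _ (by omega) (by omega), Prog.compile, toMachine_append, toMachine_shift, ← hrep.head_eq,
      halted, Option.map_none, Option.none_or,
      TM.toMachine_table (List.mem_range'_1.2 ⟨by omega, by omega⟩) (hrep.head_eq ▸ hv)]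
  have hcall : M.Reaches e (.ofWord w) (e + s) (.ofWord v) t := fun T hT =>
    ⟨_, hrep, n, hn, hT.unique (HeadTape.rep_ofWord w) ▸ hsteps'⟩
  exact hcall.trans (.of_rewrite hexit)

end TM

namespace Prog

variable {m : ℕ} {p : Prog}

theorem Run.reaches {c d : HeadTape ℕ} {t : ℕ} (h : p.Run m c d t) {M : TM} {e x : ℕ}
    (hM : M.AgreesOn (p.compile m e x) e p.size) : M.Reaches e c x d t := by
  induction h generalizing e x with
  | act hc =>
    refine .of_instruction ?_
    rw [hM e le_rfl (by simp [size]), compile, TM.toMachine_table (by simp) hc]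
  | seq _ _ ih₁ ih₂ =>
    exact (ih₁ (hM.left (by simp [size]) fun r hr => (state_of_mem_compile hr).1)).trans
      (ih₂ (hM.right (by omega) (by simp only [size]; omega)
        fun r hr => (state_of_mem_compile hr).2))
  | ite_true hc hS _ ih =>
    have branch := hM.toMachine_table (by simp only [size]; omega) hc
    simp only [hS, cond_true] at branch
    exact (TM.Reaches.of_rewrite branch).trans
      (ih (hM.after_table.left (by omega) fun r hr => (state_of_mem_compile hr).1))
  | ite_false hc hS _ ih =>
    have branch := hM.toMachine_table (by simp only [size]; omega) hc
    simp only [hS, cond_false] at branch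
    exact (TM.Reaches.of_rewrite branch).trans
      (ih (hM.after_table.right (by omega) (by omega) fun r hr => (state_of_mem_compile hr).2))
  | loop_false hc hS =>
    have branch := hM.toMachine_table (by simp only [size]; omega) hc
    rw [hS] at branch
    exact .of_rewrite branch
  | loop_true hc hS _ _ ih₁ ih₂ =>
    have branch := hM.toMachine_table (by simp only [size]; omega) hc
    rw [hS] at branch
    exact ((TM.Reaches.of_rewrite branch).trans (ih₁ hM.after_table)).trans (ih₂ hM)
  | call hN hv => exact hM.reaches_call hN hv
  | mono _ ht ih => exact (ih hM).mono ht

/-- The machine obtained from a program. -/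
def toTM (m : ℕ) (p : Prog) : TM := p.compile m 0 p.size

theorem Run.outputs {w v : List ℕ} {t : ℕ} (h : p.Run m (.ofWord w) (.ofWord v) t) :
    (p.toTM m).Outputs w v t := by
  obtain ⟨T, hT, n, hn, hsteps⟩ :=
    h.reaches (M := p.toTM m) (fun _ _ _ _ => rfl) _ (HeadTape.rep_ofWord w)
  obtain rfl := hT.unique (HeadTape.rep_ofWord v)
  refine TM.outputs_iff.2 ⟨n, hn, p.size, hsteps, TM.toMachine_eq_none fun r hr => ?_⟩
  have := (state_of_mem_compile hr).2
  omega

end Prog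

/-! ### Stack programs -/

/-- Structured programs acting on `K` stacks over the alphabet `Fin s`. The command `pop k f`
removes the top symbol of stack `k`, if there is one, and continues with the value of `f` at it;
`loop k c` repeats `c` as long as stack `k` is nonempty. -/
inductive Cmd (K s : ℕ) : Type
  | skip
  | push (k : Fin K) (a : Fin s)
  | pop (k : Fin K) (f : Option (Fin s) → Cmd K s)
  | seq (c d : Cmd K s)
  | loop (k : Fin K) (c : Cmd K s)

/-- The contents of the stacks, top first. -/
abbrev Stacks (K s : ℕ) : Type := Fin K → List (Fin s)

/-- Big-step semantics of stack programs; the last argument bounds the number of operations. -/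
inductive Cmd.Run {K s : ℕ} : Cmd K s → Stacks K s → Stacks K s → ℕ → Prop
  | skip {S : Stacks K s} : Run .skip S S 1
  | push {k : Fin K} {a : Fin s} {S : Stacks K s} :
      Run (.push k a) S (Function.update S k (a :: S k)) 1
  | pop_nil {k : Fin K} {f : Option (Fin s) → Cmd K s} {S S' : Stacks K s} {t : ℕ} :
      S k = [] → Run (f none) S S' t → Run (.pop k f) S S' (t + 1)
  | pop_cons {k : Fin K} {f : Option (Fin s) → Cmd K s} {S S' : Stacks K s} {t : ℕ} {a : Fin s}
      {l : List (Fin s)} : S k = a :: l → Run (f (some a)) (Function.update S k l) S' t →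
      Run (.pop k f) S S' (t + 1)
  | seq {c d : Cmd K s} {S S' S'' : Stacks K s} {t t' : ℕ} :
      Run c S S' t → Run d S' S'' t' → Run (.seq c d) S S'' (t + t')
  | loop_nil {k : Fin K} {c : Cmd K s} {S : Stacks K s} : S k = [] → Run (.loop k c) S S 1
  | loop_cons {k : Fin K} {c : Cmd K s} {S S' S'' : Stacks K s} {t t' : ℕ} :
      S k ≠ [] → Run c S S' t → Run (.loop k c) S' S'' t' → Run (.loop k c) S S'' (t + t' + 1)
  | mono {c : Cmd K s} {S S' : Stacks K s} {t t' : ℕ} : Run c S S' t → t ≤ t' → Run c S S' t'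

theorem Cmd.Run.length_le {K s : ℕ} {c : Cmd K s} {S S' : Stacks K s} {t : ℕ} (h : c.Run S S' t)
    (k : Fin K) : (S' k).length ≤ (S k).length + t := by
  induction h with
  | skip => omega
  | @push k' a S => rcases eq_or_ne k k' with rfl | hk <;> simp [*]
  | pop_nil _ _ ih => omega
  | @pop_cons k' f S S' t a l hS _ ih =>
    rcases eq_or_ne k k' with rfl | hk
    · rw [Function.update_self] at ih
      simp only [hS, List.length_cons]
      omega
    · rw [Function.update_of_ne hk] at ih
      omega
  | seq _ _ ih₁ ih₂ => omega
  | loop_nil => omega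
  | loop_cons _ _ _ ih₁ ih₂ => omega
  | mono _ _ ih => omega

/-! ### Simulating stacks on tracks of the tape -/

section Tracks

variable {K s : ℕ}

/-- The tape symbol that carries an optional stack symbol on each of `K` tracks; the symbol with
all tracks empty is the blank. -/
def columnSym (d : Fin K → Option (Fin s)) : ℕ :=
  finFunctionFinEquiv fun k => (finSuccEquiv s).symm (d k)

/-- The stack symbol on track `k` of a tape symbol; numbers that are not the symbol of a column
count as empty. -/
def track (s : ℕ) (k : Fin K) (c : ℕ) : Option (Fin s) :=
  if h : c < (s + 1) ^ K then finSuccEquiv s (finFunctionFinEquiv.symm ⟨c, h⟩ k) else none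

/-- Replacement of the stack symbol on track `k` of a tape symbol. -/
def setTrack (k : Fin K) (o : Option (Fin s)) (c : ℕ) : ℕ :=
  columnSym (Function.update (fun k' => track s k' c) k o)

theorem columnSym_lt (d : Fin K → Option (Fin s)) : columnSym d < (s + 1) ^ K :=
  (finFunctionFinEquiv fun k => (finSuccEquiv s).symm (d k)).2

theorem track_columnSym (d : Fin K → Option (Fin s)) (k : Fin K) :
    track s k (columnSym d) = d k := by
  have h : (⟨columnSym d, columnSym_lt d⟩ : Fin ((s + 1) ^ K)) =
      finFunctionFinEquiv fun k => (finSuccEquiv s).symm (d k) := rfl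
  rw [track, dif_pos (columnSym_lt d), h, Equiv.symm_apply_apply, Equiv.apply_symm_apply]

theorem columnSym_single (o : Option (Fin s)) :
    columnSym (fun k : Fin (K + 1) => if k = 0 then o else none) = (finSuccEquiv s).symm o := by
  have h : (fun k : Fin (K + 1) => (finSuccEquiv s).symm (if k = 0 then o else none)) =
      Pi.single 0 ((finSuccEquiv s).symm o) := by
    funext k
    by_cases hk : k = 0 <;> simp [hk]
  rw [columnSym, h, finFunctionFinEquiv_single]
  simp

theorem columnSym_none : columnSym (fun _ : Fin K => (none : Option (Fin s))) = 0 := by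
  simp [columnSym]

namespace Stacks

/-- The tape holding given stacks; the bottom of every stack is at position `0`. -/
def tape (S : Stacks K s) : ℤ → ℕ := fun j =>
  if 0 ≤ j then columnSym fun k => (S k).reverse[j.toNat]? else 0

theorem tape_natCast (S : Stacks K s) (n : ℕ) :
    S.tape n = columnSym fun k => (S k).reverse[n]? := by
  simp [tape]

theorem tape_of_neg (S : Stacks K s) {j : ℤ} (hj : j < 0) : S.tape j = 0 :=
  if_neg (not_le.2 hj)

theorem tape_lt (S : Stacks K s) (j : ℤ) : S.tape j < (s + 1) ^ K := by
  unfold tape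
  split_ifs
  · exact columnSym_lt _
  · positivity

theorem head_lt (S : Stacks K s) (j : ℤ) : HeadTape.head (S.tape, j) < (s + 1) ^ K := S.tape_lt j

theorem track_tape (S : Stacks K s) (k : Fin K) (n : ℕ) :
    track s k (S.tape n) = (S k).reverse[n]? := by
  rw [tape_natCast, track_columnSym]

theorem isSome_track_tape (S : Stacks K s) (k : Fin K) (n : ℕ) :
    (track s k (S.tape n)).isSome = decide (n < (S k).length) := by
  rw [track_tape, Bool.eq_iff_iff]
  simp

theorem tape_ne_zero {S : Stacks K s} {k : Fin K} {n : ℕ} (h : n < (S k).length) :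
    S.tape n ≠ 0 := by
  intro h0
  have hsome := S.isSome_track_tape k n
  rw [h0, ← columnSym_none (K := K) (s := s), track_columnSym, decide_eq_true h] at hsome
  exact Bool.noConfusion hsome

theorem tape_update (S : Stacks K s) (k : Fin K) {l : List (Fin s)} {n : ℕ}
    (h : ∀ j ≠ n, l.reverse[j]? = (S k).reverse[j]?) :
    tape (Function.update S k l) =
      Function.update S.tape (n : ℤ) (setTrack k l.reverse[n]? (S.tape n)) := by
  funext j
  rcases lt_or_ge j 0 with hj | hj
  · rw [Function.update_of_ne (by omega), tape_of_neg _ hj, tape_of_neg _ hj]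
  lift j to ℕ using hj
  rcases eq_or_ne j n with rfl | hjn
  · rw [Function.update_self, setTrack, tape_natCast]
    congr 1
    funext k'
    rcases eq_or_ne k' k with rfl | hk <;> simp [*, track_tape]
  · rw [Function.update_of_ne (by exact_mod_cast hjn), tape_natCast, tape_natCast]
    congr 1
    funext k'
    rcases eq_or_ne k' k with rfl | hk <;> simp only [Function.update_self, h j hjn,
      Function.update_of_ne, ne_eq, not_false_eq_true, *]

theorem getElem?_reverse_cons {α : Type*} (a : α) (l : List α) {j : ℕ} (h : j ≠ l.length) :
    (a :: l).reverse[j]? = l.reverse[j]? := by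
  rw [List.reverse_cons]
  rcases lt_or_gt_of_ne h with h | h
  · exact List.getElem?_append_left (by simpa using h)
  · rw [List.getElem?_eq_none (by simpa using h), List.getElem?_eq_none (by simpa using h.le)]

theorem tape_push (S : Stacks K s) (k : Fin K) (a : Fin s) :
    tape (Function.update S k (a :: S k)) =
      Function.update S.tape ((S k).length : ℤ) (setTrack k (some a) (S.tape (S k).length)) := by
  rw [tape_update S k fun j hj => getElem?_reverse_cons a (S k) hj]
  simp

theorem tape_pop {S : Stacks K s} {k : Fin K} {a : Fin s} {l : List (Fin s)} (h : S k = a :: l) :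
    tape (Function.update S k l) =
      Function.update S.tape (l.length : ℤ) (setTrack k (none : Option (Fin s))
        (S.tape l.length)) := by
  rw [tape_update S k fun j hj => by rw [h, getElem?_reverse_cons a l hj]]
  simp

/-- The stacks with a single nonempty stack `0`. -/
def single (w : List (Fin s)) : Stacks (K + 1) s := fun k => if k = 0 then w else []

theorem tape_single (w : List (Fin s)) :
    ((single w.reverse : Stacks (K + 1) s).tape, (0 : ℤ)) =
      HeadTape.ofWord (w.map fun a : Fin s => (a : ℕ) + 1) := by
  unfold HeadTape.ofWord
  congr 1
  funext j
  unfold tape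
  split_ifs with hj
  · have hcolumn : (fun k : Fin (K + 1) => (single w.reverse k).reverse[j.toNat]?) =
        fun k => if k = 0 then w[j.toNat]? else none := by
      funext k
      by_cases hk : k = 0 <;> simp [single, hk]
    rw [hcolumn, columnSym_single]
    rcases h : w[j.toNat]? with _ | a <;> simp [List.getI_eq_getElem?_getD, h]
  · rfl

end Stacks

end Tracks

namespace Prog

variable {K s m : ℕ}

/-- The program without effect. -/
def skip : Prog := .act .write

/-- Move right to the first empty cell of track `k`. -/
def walk (s : ℕ) (k : Fin K) : Prog :=
  .loop (fun c => (track s k c).isSome) (.act fun _ => .move .right)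

/-- From a position to the right of the blank at `-1`, with no blank in between, move to `0`. -/
def home : Prog :=
  .seq (.act fun _ => .move .left)
    (.seq (.loop (fun c => c != 0) (.act fun _ => .move .left)) (.act fun _ => .move .right))

/-- Branching over the possible values `l` of a symbol `key` determined by the scanned symbol. -/
def switch {α : Type*} [DecidableEq α] (key : ℕ → Option α) (f : α → Prog) : List α → Prog
  | [] => skip
  | a :: l => .ite (fun c => key c == some a) (f a) (switch key f l)

/-- Push `a` on the stack on track `k`. -/
def push (k : Fin K) (a : Fin s) : Prog :=
  .seq (walk s k) (.seq (.act fun c => .write (setTrack k (some a) c)) home)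

/-- Pop the stack on track `k` and branch on the symbol that has been removed. -/
def pop (s : ℕ) (k : Fin K) (f : Option (Fin s) → Prog) : Prog :=
  .ite (fun c => (track s k c).isSome)
    (.seq (walk s k) (.seq (.act fun _ => .move .left)
      (switch (track s k)
        (fun a => .seq (.act fun c => .write (setTrack k (none : Option (Fin s)) c))
          (.seq home (f (some a))))
        (List.finRange s))))
    (f none)

theorem run_skip {c : HeadTape ℕ} (h : c.head < m) : Run m skip c c 1 := by
  have hrun := Run.act (g := .write) h
  rwa [show c.apply (.write c.head) = c by simp [HeadTape.apply, HeadTape.head]] at hrun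

theorem run_switch {α : Type*} [DecidableEq α] {c d : HeadTape ℕ} {t : ℕ} {key : ℕ → Option α}
    {f : α → Prog} {a : α} {l : List α} (ha : a ∈ l) (h : c.head < m) (hk : key c.head = some a)
    (hf : Run m (f a) c d t) : Run m (switch key f l) c d (t + l.length) := by
  induction l with
  | nil => simp at ha
  | cons b l ih =>
    rw [List.length_cons]
    rcases eq_or_ne a b with rfl | hab
    · exact (Run.ite_true h (by simp [hk]) hf).mono (by omega)
    · exact (Run.ite_false h (by simp [hk, hab])
        (ih ((List.mem_cons.1 ha).resolve_left hab))).mono (by omega)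

section

variable {S : Stacks K s} {k : Fin K}

theorem run_act (g : ℕ → TM0.Stmt ℕ) (j : ℤ) :
    Run ((s + 1) ^ K) (.act g) (S.tape, j) (HeadTape.apply (S.tape, j) (g (S.tape j))) 1 :=
  Run.act (c := (S.tape, j)) (S.tape_lt j)

theorem run_walk (S : Stacks K s) (k : Fin K) :
    Run ((s + 1) ^ K) (walk s k) (S.tape, 0) (S.tape, (S k).length) (2 * (S k).length + 1) := by
  suffices H : ∀ i n : ℕ, i + n = (S k).length →
      Run ((s + 1) ^ K) (walk s k) (S.tape, i) (S.tape, (S k).length) (2 * n + 1) by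
    exact_mod_cast H 0 (S k).length (by omega)
  intro i n
  induction n generalizing i with
  | zero =>
    intro h
    rw [← h, add_zero]
    exact Run.loop_false (S.head_lt _) (by simp [HeadTape.head, S.isSome_track_tape, ← h])
  | succ n ih =>
    intro h
    have hnonempty : (track s k (S.tape i)).isSome := by
      simp only [S.isSome_track_tape, decide_eq_true_eq]
      omega
    exact (Run.loop_true (S.head_lt _) hnonempty (run_act (fun _ => .move .right) i)
      (by exact_mod_cast ih (i + 1) (by omega))).mono (by omega)

theorem run_home (S : Stacks K s) (i : ℕ) (h : ∀ j < i, S.tape j ≠ 0) :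
    Run ((s + 1) ^ K) home (S.tape, i) (S.tape, 0) (2 * i + 3) := by
  have loop : Run ((s + 1) ^ K) (.loop (fun c => c != 0) (.act fun _ => .move .left))
      (S.tape, (i : ℤ) - 1) (S.tape, -1) (2 * i + 1) := by
    induction i with
    | zero => exact Run.loop_false (S.head_lt _) (by simp [HeadTape.head, S.tape_of_neg])
    | succ i ih =>
      rw [Nat.cast_succ, add_sub_cancel_right]
      exact (Run.loop_true (S.head_lt _) (by simpa [HeadTape.head] using h i (by omega))
        (run_act _ i) (ih fun j hj => h j (by omega))).mono (by omega)
  exact ((run_act _ i).seq (loop.seq (run_act (fun _ => .move .right) (-1)))).mono (by omega)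

theorem run_push (S : Stacks K s) (k : Fin K) (a : Fin s) :
    Run ((s + 1) ^ K) (push k a) (S.tape, 0) (Stacks.tape (Function.update S k (a :: S k)), 0)
      (4 * (S k).length + 5) := by
  have write := run_act (S := S) (fun c => .write (setTrack k (some a) c)) (S k).length
  simp only [HeadTape.apply, ← Stacks.tape_push] at write
  have back := run_home (Function.update S k (a :: S k)) (S k).length fun j hj =>
    Stacks.tape_ne_zero (k := k) (by simp only [Function.update_self, List.length_cons]; omega)
  exact ((run_walk S k).seq (write.seq back)).mono (by omega)

theorem run_pop_nil {f : Option (Fin s) → Prog} {d : HeadTape ℕ} {t : ℕ} (h : S k = [])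
    (hf : Run ((s + 1) ^ K) (f none) (S.tape, 0) d t) :
    Run ((s + 1) ^ K) (pop s k f) (S.tape, 0) d (1 + t) :=
  Run.ite_false (S.head_lt _) (by simpa [HeadTape.head, h] using S.isSome_track_tape k 0) hf

theorem run_pop_cons {f : Option (Fin s) → Prog} {a : Fin s} {l : List (Fin s)} {d : HeadTape ℕ}
    {t : ℕ} (h : S k = a :: l)
    (hf : Run ((s + 1) ^ K) (f (some a)) (Stacks.tape (Function.update S k l), 0) d t) :
    Run ((s + 1) ^ K) (pop s k f) (S.tape, 0) d (t + 4 * l.length + s + 9) := by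
  have walk := run_walk S k
  rw [h, List.length_cons] at walk
  have left := run_act (S := S) (fun _ => .move .left) (l.length + 1 : ℕ)
  simp only [HeadTape.apply, Nat.cast_succ, add_sub_cancel_right] at left
  have write := run_act (S := S) (fun c => .write (setTrack k (none : Option (Fin s)) c)) l.length
  simp only [HeadTape.apply, ← Stacks.tape_pop h] at write
  have back := run_home (Function.update S k l) l.length fun j hj =>
    Stacks.tape_ne_zero (k := k) (by rwa [Function.update_self])
  have branch := run_switch (key := track s k) (List.mem_finRange a) (S.head_lt l.length)
    (by simp [HeadTape.head, Stacks.track_tape, h])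
    (f := fun a => .seq _ (.seq home (f (some a)))) (write.seq (back.seq hf))
  rw [List.length_finRange] at branch
  exact (Run.ite_true (S.head_lt _) (by simpa [HeadTape.head, h] using S.isSome_track_tape k 0)
    (walk.seq (left.seq branch))).mono (by omega)

end

end Prog

namespace Cmd

variable {K s : ℕ}

/-- Compilation of stack programs to tape programs. -/
def toProg : Cmd K s → Prog
  | skip => .skip
  | push k a => .push k a
  | pop k f => .pop s k fun o => (f o).toProg
  | seq c d => .seq c.toProg d.toProg
  | loop k c => .loop (fun c => (track s k c).isSome) c.toProg

theorem Run.toProg {c : Cmd K s} {S S' : Stacks K s} {t H : ℕ} (h : c.Run S S' t)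
    (hH : ∀ k, (S k).length + t ≤ H) :
    c.toProg.Run ((s + 1) ^ K) (S.tape, 0) (S'.tape, 0) (t * (4 * H + s + 10)) := by
  induction h with
  | @skip S => exact (Prog.run_skip (S.head_lt _)).mono (by omega)
  | @push k a S =>
    have := hH k
    exact (Prog.run_push S k a).mono (by omega)
  | pop_nil hk _ ih =>
    refine (Prog.run_pop_nil hk (ih fun k => ?_)).mono (by rw [Nat.add_mul]; omega)
    have := hH k
    omega
  | @pop_cons k f S S' t a l hk _ ih =>
    have hl : l.length + 1 + (t + 1) ≤ H := by simpa [hk] using hH k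
    refine (Prog.run_pop_cons (f := fun o => (f o).toProg) hk (ih fun k' => ?_)).mono
      (by rw [Nat.add_mul]; omega)
    have := hH k'
    rcases eq_or_ne k' k with rfl | hne
    · rw [Function.update_self]
      omega
    · rw [Function.update_of_ne hne]
      omega
  | seq h₁ _ ih₁ ih₂ =>
    refine ((ih₁ fun k => ?_).seq (ih₂ fun k => ?_)).mono (by rw [Nat.add_mul])
    · have := hH k; omega
    · have := hH k; have := h₁.length_le k; omega
  | @loop_nil k c S hk =>
    have empty : (track s k (S.tape 0)).isSome = false := by
      simpa [hk] using S.isSome_track_tape k 0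
    exact (Prog.Run.loop_false (S.head_lt _) empty).mono (by omega)
  | @loop_cons k c S S' S'' t t' hk h₁ _ ih₁ ih₂ =>
    have nonempty : (track s k (S.tape 0)).isSome = true := by
      simpa [List.length_pos_iff.2 hk] using S.isSome_track_tape k 0
    refine (Prog.Run.loop_true (S.head_lt _) nonempty (ih₁ fun k => ?_) (ih₂ fun k => ?_)).mono
      (by rw [Nat.add_mul, Nat.add_mul]; omega)
    · have := hH k; omega
    · have := hH k; have := h₁.length_le k; omega
  | mono _ hle ih =>
    refine (ih fun k => ?_).mono (Nat.mul_le_mul_right _ hle)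
    have := hH k
    omega

theorem Run.toProg_single {c : Cmd (K + 1) s} {l l' : List (Fin s)} {t : ℕ}
    (h : c.Run (Stacks.single l.reverse) (Stacks.single l'.reverse) t) :
    c.toProg.Run ((s + 1) ^ (K + 1)) (.ofWord (l.map fun a : Fin s => (a : ℕ) + 1))
      (.ofWord (l'.map fun a : Fin s => (a : ℕ) + 1)) (t * (4 * (l.length + t) + s + 10)) := by
  rw [← Stacks.tape_single, ← Stacks.tape_single]
  exact h.toProg fun k => by by_cases hk : k = 0 <;> simp [Stacks.single, hk]

end Cmd

/-! ### Symbolic execution of stack programs -/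

namespace Cmd

variable {K s : ℕ} {k : Fin K} {a : Fin s} {c d : Cmd K s} {f : Option (Fin s) → Cmd K s}
  {S S' S'' : Stacks K s} {t t' : ℕ}

theorem Run.inv (h : Run c S S' t) :
    match c with
    | .skip => S' = S ∧ 1 ≤ t
    | .push k a => S' = Function.update S k (a :: S k) ∧ 1 ≤ t
    | .pop k f => ∃ t', t' + 1 ≤ t ∧ match S k with
      | [] => Run (f none) S S' t'
      | a :: l => Run (f (some a)) (Function.update S k l) S' t'
    | .seq c d => ∃ S₁ t₁ t₂, t₁ + t₂ ≤ t ∧ Run c S S₁ t₁ ∧ Run d S₁ S' t₂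
    | .loop _ _ => True := by
  induction h with
  | skip => exact ⟨rfl, le_rfl⟩
  | push => exact ⟨rfl, le_rfl⟩
  | @pop_nil k f S S' t hk h _ => exact ⟨t, le_rfl, by rw [hk]; exact h⟩
  | @pop_cons k f S S' t a l hk h _ => exact ⟨t, le_rfl, by rw [hk]; exact h⟩
  | seq h₁ h₂ => exact ⟨_, _, _, le_rfl, h₁, h₂⟩
  | loop_nil => trivial
  | loop_cons => trivial
  | @mono c S S' t t' _ hle ih =>
    cases c with
    | skip => exact ⟨ih.1, ih.2.trans hle⟩
    | push => exact ⟨ih.1, ih.2.trans hle⟩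
    | pop => exact ih.imp fun _ h => ⟨h.1.trans hle, h.2⟩
    | seq =>
      obtain ⟨S₁, t₁, t₂, ht, h⟩ := ih
      exact ⟨S₁, t₁, t₂, ht.trans hle, h⟩
    | loop => trivial

@[simp]
theorem run_skip : Run skip S S' (t + 1) ↔ S' = S :=
  ⟨fun h => h.inv.1, fun h => h ▸ Run.skip.mono (by omega)⟩

@[simp]
theorem run_push : Run (push k a) S S' (t + 1) ↔ S' = Function.update S k (a :: S k) :=
  ⟨fun h => h.inv.1, fun h => h ▸ Run.push.mono (by omega)⟩

@[simp]
theorem run_pop : Run (pop k f) S S' (t + 1) ↔ match S k with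
    | [] => Run (f none) S S' t
    | a :: l => Run (f (some a)) (Function.update S k l) S' t := by
  constructor
  · intro h
    obtain ⟨t', ht, h⟩ := h.inv
    rcases hk : S k with _ | ⟨a, l⟩ <;> rw [hk] at h <;> exact h.mono (by omega)
  · intro h
    rcases hk : S k with _ | ⟨a, l⟩ <;> rw [hk] at h
    · exact Run.pop_nil hk h
    · exact Run.pop_cons hk h

@[simp]
theorem run_push_seq : Run (seq (push k a) d) S S' (t + 1) ↔
    Run d (Function.update S k (a :: S k)) S' t := by
  refine ⟨fun h => ?_, fun h => (Run.push.seq h).mono (by omega)⟩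
  obtain ⟨S₁, t₁, t₂, ht, h₁, h₂⟩ := h.inv
  obtain ⟨rfl, ht₁⟩ := h₁.inv
  exact h₂.mono (by omega)

theorem Run.loop_seq (hk : S k ≠ []) (h : c.Run S S' t)
    (h' : (Cmd.seq (.loop k c) d).Run S' S'' t') :
    (Cmd.seq (.loop k c) d).Run S S'' (t + t' + 1) := by
  obtain ⟨S₁, t₁, t₂, ht, h₁, h₂⟩ := h'.inv
  exact ((Run.loop_cons hk h h₁).seq h₂).mono (by omega)

/-- Empty a stack. -/
def clear (k : Fin K) : Cmd K s := .loop k (.pop k fun _ => .skip)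

theorem run_clear (k : Fin K) (S : Stacks K s) :
    Run (clear k) S (Function.update S k []) (3 * (S k).length + 1) := by
  generalize h : S k = l
  induction l generalizing S with
  | nil =>
    have unchanged : Function.update S k [] = S := h ▸ Function.update_eq_self k S
    rw [unchanged]
    exact Run.loop_nil h
  | cons a l ih =>
    have rest := ih (Function.update S k l) (Function.update_self ..)
    rw [Function.update_idem] at rest
    rw [List.length_cons]
    exact (Run.loop_cons (h ▸ List.cons_ne_nil a l) (Run.pop_cons h Run.skip) rest).mono (by omega)

/-- Transfer the contents of the stack `j` to the stack `k`, reversing their order. -/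
def transfer (j k : Fin K) : Cmd K s :=
  .loop j (.pop j fun o => match o with
    | some a => .push k a
    | none => .skip)

theorem run_transfer {j k : Fin K} (hjk : j ≠ k) (S : Stacks K s) :
    Run (transfer j k) S (Function.update (Function.update S k ((S j).reverse ++ S k)) j [])
      (3 * (S j).length + 1) := by
  generalize h : S j = l
  induction l generalizing S with
  | nil =>
    have unchanged : Function.update S j [] = S := h ▸ Function.update_eq_self j S
    rw [List.reverse_nil, List.nil_append, Function.update_eq_self, unchanged]
    exact Run.loop_nil h
  | cons a l ih =>
    have rest := ih (Function.update (Function.update S j l) k (a :: S k)) (by simp [hjk])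
    have final : Function.update (Function.update (Function.update (Function.update S j l) k
        (a :: S k)) k (l.reverse ++ a :: S k)) j [] =
        Function.update (Function.update S k ((a :: l).reverse ++ S k)) j [] := by
      rw [Function.update_idem, Function.update_comm hjk, Function.update_idem]
      simp
    rw [Function.update_self, final] at rest
    refine (Run.loop_cons (h ▸ List.cons_ne_nil a l) (Run.pop_cons h ?_) rest).mono (t := 2 + _ + 1)
      (by rw [List.length_cons]; omega)
    simp [hjk.symm]

end Cmd

/-! ### Parsing formulas -/

namespace SatProg

open Cmd

infixr:60 " ;; " => Cmd.seq

/-- The stack for the input and the output. -/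
abbrev io : Fin 8 := 0

/-- The stack holding the string under inspection. -/
abbrev text : Fin 8 := 1

/-- A counter: the number of formulas still to be read, the index of a variable, or a carry. -/
abbrev counter : Fin 8 := 2

/-- The stack holding the tokens of the formula. -/
abbrev formula : Fin 8 := 3

/-- An auxiliary stack. -/
abbrev aux : Fin 8 := 4

/-- The stack holding the values of subformulas, and later the digits of a number. -/
abbrev values : Fin 8 := 5

/-- A stack that is nonempty after a failure. -/
abbrev failed : Fin 8 := 6

/-- The stack whose height is the length of the input. -/
abbrev size : Fin 8 := 7

/-- The stacks with given contents, in the order `io`, `text`, `counter`, `formula`, `aux`,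
`values`, `failed`, `size`. -/
def layout (a b c d e f g h : List (Fin 5)) : Stacks 8 5 := ![a, b, c, d, e, f, g, h]

section layout

variable (a b c d e f g h l : List (Fin 5))

@[simp] theorem layout_io : layout a b c d e f g h io = a := rfl
@[simp] theorem layout_text : layout a b c d e f g h text = b := rfl
@[simp] theorem layout_counter : layout a b c d e f g h counter = c := rfl
@[simp] theorem layout_formula : layout a b c d e f g h formula = d := rfl
@[simp] theorem layout_aux : layout a b c d e f g h aux = e := rfl
@[simp] theorem layout_values : layout a b c d e f g h values = f := rfl
@[simp] theorem layout_failed : layout a b c d e f g h failed = g := rfl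
@[simp] theorem layout_size : layout a b c d e f g h size = h := rfl

@[simp] theorem update_io : Function.update (layout a b c d e f g h) io l =
    layout l b c d e f g h := by funext i; fin_cases i <;> rfl
@[simp] theorem update_text : Function.update (layout a b c d e f g h) text l =
    layout a l c d e f g h := by funext i; fin_cases i <;> rfl
@[simp] theorem update_counter : Function.update (layout a b c d e f g h) counter l =
    layout a b l d e f g h := by funext i; fin_cases i <;> rfl
@[simp] theorem update_formula : Function.update (layout a b c d e f g h) formula l =
    layout a b c l e f g h := by funext i; fin_cases i <;> rfl
@[simp] theorem update_aux : Function.update (layout a b c d e f g h) aux l =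
    layout a b c d l f g h := by funext i; fin_cases i <;> rfl
@[simp] theorem update_values : Function.update (layout a b c d e f g h) values l =
    layout a b c d e l g h := by funext i; fin_cases i <;> rfl
@[simp] theorem update_failed : Function.update (layout a b c d e f g h) failed l =
    layout a b c d e f l h := by funext i; fin_cases i <;> rfl
@[simp] theorem update_size : Function.update (layout a b c d e f g h) size l =
    layout a b c d e f g l := by funext i; fin_cases i <;> rfl

theorem single_eq_layout :
    (Stacks.single l : Stacks (7 + 1) 5) = layout l [] [] [] [] [] [] [] := by
  funext i; fin_cases i <;> rfl

end layout

/-- The stack symbol of a bit. -/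
def bsym (b : Bool) : Fin 5 := cond b 1 0

/-- Record a failure and end the parsing. -/
def fail : Cmd 8 5 := push failed 0 ;; clear counter

/-- Read the unary index of a variable. -/
def unaryBody : Cmd 8 5 := pop aux fun _ => pop text fun o => match o with
  | some 0 => push formula 0
  | some 1 => push formula 1 ;; push aux 0
  | _ => fail

/-- Read a token, the counter holding the number of formulas still to be read. -/
def parseBody : Cmd 8 5 := pop counter fun _ => pop text fun o => match o with
  | some 0 => pop text fun o => match o with
    | some 0 => push formula 2 ;; push aux 0 ;; loop aux unaryBody
    | some 1 => push formula 1 ;; push counter 0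
    | _ => fail
  | some 1 => pop text fun o => match o with
    | some 0 => push formula 3 ;; push counter 0 ;; push counter 0
    | some 1 => push formula 4 ;; push counter 0 ;; push counter 0
    | _ => fail
  | _ => fail

/-- The tokens of a formula, last token first. The index of a variable is written in unary between
the symbols `2` and `0`. -/
def tokens : Formula → List (Fin 5)
  | .var i => 0 :: (List.replicate i 1 ++ [2])
  | .neg φ => tokens φ ++ [1]
  | .and φ ψ => tokens ψ ++ (tokens φ ++ [3])
  | .or φ ψ => tokens ψ ++ (tokens φ ++ [4])

/-- The tokens of several formulas, on top of `R`. -/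
def tokensOn : List Formula → List (Fin 5) → List (Fin 5)
  | [], R => R
  | φ :: φs, R => tokensOn φs (tokens φ ++ R)

/-- The concatenation of the codes of several formulas. -/
def encs (φs : List Formula) : List Bool := φs.flatMap Formula.enc

theorem encs_cons (φ : Formula) (φs : List Formula) : encs (φ :: φs) = φ.enc ++ encs φs := rfl

/-- The property that a string begins with the codes of `c` formulas. -/
def Parses (c : ℕ) (x : List Bool) : Prop :=
  ∃ (φs : List Formula) (u : List Bool), φs.length = c ∧ x = encs φs ++ u

theorem Parses.cases {c : ℕ} {x : List Bool} (h : Parses (c + 1) x) :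
    (∃ i u, x = false :: false :: (unary i ++ u) ∧ Parses c u) ∨
    (∃ y, x = false :: true :: y ∧ Parses (c + 1) y) ∨
    (∃ b y, x = true :: b :: y ∧ Parses (c + 2) y) := by
  obtain ⟨_ | ⟨φ, φs⟩, u, hc, rfl⟩ := h
  · cases hc
  obtain rfl := Nat.succ.inj hc
  cases φ with
  | var i => exact .inl ⟨i, encs φs ++ u, by simp only [encs_cons, Formula.enc, List.cons_append,
      List.nil_append, List.append_assoc], φs, u, rfl, rfl⟩
  | neg φ => exact .inr (.inl ⟨_, rfl, φ :: φs, u, rfl, by simp [encs, List.flatMap]⟩)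
  | and φ ψ => exact .inr (.inr ⟨_, _, rfl, φ :: ψ :: φs, u, rfl, by simp [encs, List.flatMap]⟩)
  | or φ ψ => exact .inr (.inr ⟨_, _, rfl, φ :: ψ :: φs, u, rfl, by simp [encs, List.flatMap]⟩)

theorem exists_unary_append_or_eq_replicate (x : List Bool) :
    (∃ i u, x = unary i ++ u) ∨ ∃ k, x = List.replicate k true := by
  induction x with
  | nil => exact .inr ⟨0, rfl⟩
  | cons b x ih =>
    cases b with
    | false => exact .inl ⟨0, x, rfl⟩
    | true =>
      rcases ih with ⟨i, u, rfl⟩ | ⟨k, rfl⟩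
      · exact .inl ⟨i + 1, u, rfl⟩
      · exact .inr ⟨k + 1, rfl⟩

variable {N C R : List (Fin 5)} {c : ℕ} {x : List Bool} {S : Stacks 8 5}

/-- The stacks after an attempt to read `c` formulas from `x`, with the tokens put on top of `R`. -/
def ParseResult (N R : List (Fin 5)) (c : ℕ) (x : List Bool) (S : Stacks 8 5) : Prop :=
  (∃ (φs : List Formula) (u : List Bool), φs.length = c ∧ x = encs φs ++ u ∧
    S = layout [] (u.map bsym) [] (tokensOn φs R) [] [] [] N) ∨
  (¬ Parses c x ∧ ∃ X R' : List (Fin 5), S = layout [] X [] R' [] [] [0] N)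

theorem ParseResult.var {i : ℕ} {u : List Bool}
    (h : ParseResult N (tokens (.var i) ++ R) c u S) :
    ParseResult N R (c + 1) (false :: false :: (unary i ++ u)) S := by
  rcases h with ⟨φs, v, rfl, rfl, rfl⟩ | ⟨hu, hS⟩
  · exact .inl ⟨.var i :: φs, v, rfl, by simp [encs_cons, Formula.enc], rfl⟩
  · refine .inr ⟨fun h => ?_, hS⟩
    rcases h.cases with ⟨j, w, h, hw⟩ | ⟨y, h, -⟩ | ⟨b, y, h, -⟩
    · obtain ⟨rfl, rfl⟩ := unary_append_inj (List.cons.inj (List.cons.inj h).2).2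
      exact hu hw
    · cases h
    · cases h

theorem ParseResult.neg (h : ParseResult N (1 :: R) (c + 1) x S) :
    ParseResult N R (c + 1) (false :: true :: x) S := by
  rcases h with ⟨_ | ⟨φ, φs⟩, v, hc, rfl, rfl⟩ | ⟨hx, hS⟩
  · cases hc
  · exact .inl ⟨.neg φ :: φs, v, hc, by simp [encs_cons, Formula.enc], by simp [tokensOn, tokens]⟩
  · refine .inr ⟨fun h => ?_, hS⟩
    rcases h.cases with ⟨i, u, h, -⟩ | ⟨y, h, hy⟩ | ⟨b, y, h, -⟩ <;> cases h
    exact hx hy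

theorem ParseResult.binary {b : Bool} (h : ParseResult N (cond b 4 3 :: R) (c + 2) x S) :
    ParseResult N R (c + 1) (true :: b :: x) S := by
  rcases h with ⟨_ | ⟨φ, _ | ⟨ψ, φs⟩⟩, v, hc, rfl, rfl⟩ | ⟨hx, hS⟩
  · cases hc
  · cases hc
  · refine .inl ⟨cond b (.or φ ψ) (.and φ ψ) :: φs, v, Nat.succ.inj hc, ?_, ?_⟩ <;> cases b <;>
      simp [encs_cons, Formula.enc, tokensOn, tokens]
  · refine .inr ⟨fun h => ?_, hS⟩
    rcases h.cases with ⟨i, u, h, -⟩ | ⟨y, h, -⟩ | ⟨b, y, h, hy⟩ <;> cases h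
    exact hx hy

theorem run_fail (X R : List (Fin 5)) :
    Run fail (layout [] X C R [] [] [] N) (layout [] X [] R [] [] [0] N)
      (3 * C.length + 2) := by
  simpa [fail] using run_clear counter (layout [] X C R [] [] [0] N)

theorem run_unary (i : ℕ) (u : List Bool) (R : List (Fin 5)) :
    Run (loop aux unaryBody) (layout [] ((unary i ++ u).map bsym) C R [0] [] [] N)
      (layout [] (u.map bsym) C (0 :: (List.replicate i 1 ++ R)) [] [] [] N) (5 * i + 5) := by
  induction i generalizing R with
  | zero =>
    refine (Run.loop_cons (t := 3) (by simp) ?_ (Run.loop_nil (by simp))).mono (by omega)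
    simp [unaryBody, unary, bsym]
  | succ i ih =>
    rw [List.replicate_succ', List.append_assoc]
    refine (Run.loop_cons (t := 4) (by simp) ?_ (ih (1 :: R))).mono (by omega)
    simp [unaryBody, unary, bsym, List.replicate_succ]

theorem run_unary_fail (i : ℕ) (R : List (Fin 5)) :
    Run (loop aux unaryBody) (layout [] ((List.replicate i true).map bsym) C R [0] [] [] N)
      (layout [] [] [] (List.replicate i 1 ++ R) [] [] [0] N) (5 * i + 3 * C.length + 6) := by
  induction i generalizing R with
  | zero =>
    refine (Run.loop_cons (t := 3 * C.length + 4) (by simp) ?_ (Run.loop_nil (by simp))).mono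
      (by omega)
    simpa [unaryBody] using run_fail (N := N) (C := C) [] R
  | succ i ih =>
    rw [List.replicate_succ' (a := (1 : Fin 5)), List.append_assoc]
    refine (Run.loop_cons (t := 4) (by simp) ?_ (ih (1 :: R))).mono (by omega)
    simp [unaryBody, bsym, List.replicate_succ]

/-- The stacks while `c` formulas are still to be read from `x`. -/
def parseStacks (N R : List (Fin 5)) (c : ℕ) (x : List Bool) : Stacks 8 5 :=
  layout [] (x.map bsym) (List.replicate c 0) R [] [] [] N

theorem run_parseBody_var (i : ℕ) (u : List Bool) :
    Run parseBody (parseStacks N R (c + 1) (false :: false :: (unary i ++ u)))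
      (parseStacks N (tokens (.var i) ++ R) c u) (5 * i + 10) := by
  simpa [parseBody, parseStacks, List.replicate_succ, bsym, tokens] using
    run_unary (N := N) (C := List.replicate c 0) i u (2 :: R)

theorem run_parseBody_neg :
    Run parseBody (parseStacks N R (c + 1) (false :: true :: x))
      (parseStacks N (1 :: R) (c + 1) x) 6 := by
  simp [parseBody, parseStacks, List.replicate_succ, bsym]

theorem run_parseBody_binary (b : Bool) :
    Run parseBody (parseStacks N R (c + 1) (true :: b :: x))
      (parseStacks N (cond b 4 3 :: R) (c + 2) x) 6 := by
  cases b <;> simp [parseBody, parseStacks, List.replicate_succ, bsym]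

theorem run_parse_of_fail {t : ℕ} {X R' : List (Fin 5)} (hx : ¬ Parses (c + 1) x)
    (h : Run parseBody (parseStacks N R (c + 1) x) (layout [] X [] R' [] [] [0] N) t)
    (ht : t + 1 ≤ 20 * (x.length + (c + 1))) :
    ∃ S, ParseResult N R (c + 1) x S ∧ Run (loop counter parseBody) (parseStacks N R (c + 1) x) S
      (20 * (x.length + (c + 1)) + 1) :=
  ⟨_, .inr ⟨hx, X, R', rfl⟩, (Run.loop_cons (by simp [parseStacks]) h
    (Run.loop_nil (by simp))).mono (by omega)⟩

theorem run_parse_short (hx : x.length ≤ 1) :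
    ∃ S, ParseResult N R (c + 1) x S ∧ Run (loop counter parseBody) (parseStacks N R (c + 1) x) S
      (20 * (x.length + (c + 1)) + 1) := by
  have fail := run_fail (N := N) (C := List.replicate c 0) [] R
  rw [List.length_replicate] at fail
  refine run_parse_of_fail (t := 3 * c + 5) (X := []) (R' := R) (fun h => ?_) ?_ (by omega)
  · rcases h.cases with ⟨i, u, rfl, -⟩ | ⟨y, rfl, -⟩ | ⟨b, y, rfl, -⟩ <;> simp at hx
  · rcases x with _ | ⟨_ | _, _ | ⟨b, x⟩⟩
    · exact Run.mono (t := 3 * c + 4)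
        (by simpa [parseBody, parseStacks, List.replicate_succ] using fail) (by omega)
    all_goals first
      | simpa [parseBody, parseStacks, List.replicate_succ, bsym] using fail
      | simp at hx

theorem run_parse_unterminated (k : ℕ) :
    ∃ S, ParseResult N R (c + 1) (false :: false :: List.replicate k true) S ∧
      Run (loop counter parseBody)
        (parseStacks N R (c + 1) (false :: false :: List.replicate k true)) S
        (20 * ((false :: false :: List.replicate k true).length + (c + 1)) + 1) := by
  refine run_parse_of_fail (t := 5 * k + 3 * c + 6 + 2 + 2 + 1) (X := [])
    (R' := List.replicate k 1 ++ 2 :: R) (fun h => ?_) ?_ (by simp; omega)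
  · rcases h.cases with ⟨i, u, h, -⟩ | ⟨y, h, -⟩ | ⟨b, y, h, -⟩
    · have hmem : false ∈ List.replicate k true := by
        rw [(List.cons.inj (List.cons.inj h).2).2]
        simp [unary]
      cases (List.mem_replicate.1 hmem).2
    · cases h
    · cases h
  · simpa [parseBody, parseStacks, List.replicate_succ, bsym] using
      run_unary_fail (N := N) (C := List.replicate c 0) k (2 :: R)

theorem run_parse (N : List (Fin 5)) (c : ℕ) (x : List Bool) (R : List (Fin 5)) :
    ∃ S, ParseResult N R c x S ∧ Run (loop counter parseBody) (parseStacks N R c x) S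
      (20 * (x.length + c) + 1) := by
  induction hn : x.length using Nat.strong_induction_on generalizing c x R with
  | _ n ih =>
  subst hn
  rcases c with _ | c
  · exact ⟨_, .inl ⟨[], x, rfl, rfl, rfl⟩,
      (Run.loop_nil (by simp [parseStacks])).mono (by omega)⟩
  have nonempty (x R) : parseStacks N R (c + 1) x counter ≠ [] := by simp [parseStacks]
  rcases x with _ | ⟨b, _ | ⟨b', x⟩⟩
  · exact run_parse_short (by simp)
  · exact run_parse_short (by simp)
  simp only [List.length_cons] at ih ⊢
  rcases b with _ | _
  · rcases b' with _ | _
    · rcases exists_unary_append_or_eq_replicate x with ⟨i, u, rfl⟩ | ⟨k, rfl⟩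
      · have hlen : (unary i ++ u).length = i + 1 + u.length := by simp [unary]; omega
        obtain ⟨S, hS, hrun⟩ := ih u.length (by omega) c u (tokens (.var i) ++ R) rfl
        exact ⟨S, hS.var, (Run.loop_cons (nonempty _ _) (run_parseBody_var i u) hrun).mono
          (by omega)⟩
      · exact run_parse_unterminated k
    · obtain ⟨S, hS, hrun⟩ := ih x.length (by omega) (c + 1) x (1 :: R) rfl
      exact ⟨S, hS.neg, (Run.loop_cons (nonempty _ _) run_parseBody_neg hrun).mono (by omega)⟩
  · obtain ⟨S, hS, hrun⟩ := ih x.length (by omega) (c + 2) x (cond b' 4 3 :: R) rfl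
    exact ⟨S, hS.binary, (Run.loop_cons (nonempty _ _) (run_parseBody_binary b') hrun).mono
      (by omega)⟩

/-! ### Evaluating formulas -/

/-- Mark a bit of the assignment as used: the symbols `3` and `4` are the used bits. -/
def mark (b : Fin 5) : Fin 5 := if b = 0 ∨ b = 3 then 3 else 4

/-- The bit stored in a symbol that may be marked. -/
def value (b : Fin 5) : Fin 5 := if b = 0 ∨ b = 3 then 0 else 1

/-- Walk along the assignment as indicated by the unary index of a variable. -/
def walkBody : Cmd 8 5 := pop counter fun _ => pop formula fun o => match o with
  | some 1 => pop text fun o => match o with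
    | some b => push aux b ;; push counter 0
    | none => push counter 0
  | _ => skip

/-- Read and mark the bit on top of the assignment. -/
def readBit : Cmd 8 5 := pop text fun o => match o with
  | some b => push text (mark b) ;; push values (value b)
  | none => push failed 0 ;; push values 0

/-- Look up the value of a variable. -/
def lookup : Cmd 8 5 := push counter 0 ;; loop counter walkBody ;; readBit ;; transfer aux text

/-- Handle a token, from the last to the first one. -/
def evalBody : Cmd 8 5 := pop formula fun o => match o with
  | some 0 => lookup
  | some 1 => pop values fun v => push values (if v = some 1 then 0 else 1)
  | some 3 => pop values fun v => pop values fun w =>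
      push values (if v = some 1 ∧ w = some 1 then 1 else 0)
  | some 4 => pop values fun v => pop values fun w =>
      push values (if v = some 1 ∨ w = some 1 then 1 else 0)
  | _ => skip

/-- The assignment of truth values given by a string, false beyond its end. -/
def valuation (a : List Bool) (i : ℕ) : Bool := a.getD i false

theorem valuation_of_lt {a : List Bool} {i : ℕ} (hi : i < a.length) : valuation a i = a[i] :=
  List.getD_eq_getElem _ _ hi

theorem valuation_of_le {a : List Bool} {i : ℕ} (hi : a.length ≤ i) : valuation a i = false :=
  List.getD_eq_default _ _ hi

/-- The assignment `a` with the variables in `U` marked as used. -/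
def marked (a : List Bool) (U : Finset ℕ) : List (Fin 5) :=
  a.mapIdx fun i b => if i ∈ U then cond b 4 3 else bsym b

theorem marked_empty (a : List Bool) : marked a ∅ = a.map bsym := by
  apply List.ext_getElem <;> simp [marked]

@[simp]
theorem length_marked (a : List Bool) (U : Finset ℕ) : (marked a U).length = a.length :=
  List.length_mapIdx

theorem getElem_marked {a : List Bool} {U : Finset ℕ} {i : ℕ} (hi : i < (marked a U).length) :
    (marked a U)[i] = if i ∈ U then cond (valuation a i) 4 3 else bsym (valuation a i) := by
  rw [valuation_of_lt (by rwa [length_marked] at hi)]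
  exact List.getElem_mapIdx ..

theorem value_marked {a : List Bool} {U : Finset ℕ} {i : ℕ} (hi : i < (marked a U).length) :
    value (marked a U)[i] = bsym (valuation a i) := by
  rw [getElem_marked]
  cases valuation a i <;> split_ifs <;> rfl

theorem set_mark_marked {a : List Bool} {U : Finset ℕ} {i : ℕ} (hi : i < (marked a U).length) :
    (marked a U).set i (mark (marked a U)[i]) = marked a (insert i U) := by
  apply List.ext_getElem (by simp)
  intro j _ _
  simp only [List.getElem_set, getElem_marked]
  rcases eq_or_ne i j with rfl | hj
  · rw [if_pos rfl, if_pos (Finset.mem_insert_self i U)]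
    cases valuation a i <;> split_ifs <;> rfl
  · simp only [if_neg hj, Finset.mem_insert, hj.symm, false_or]

theorem marked_insert_of_le {a : List Bool} {U : Finset ℕ} {i : ℕ} (hi : a.length ≤ i) :
    marked a (insert i U) = marked a U := by
  apply List.ext_getElem (by simp)
  intro j hj _
  have hj : j ≠ i := by rw [length_marked] at hj; omega
  rw [getElem_marked, getElem_marked]
  simp only [Finset.mem_insert, hj, false_or]

theorem forall_mem_marked_iff {a : List Bool} {U : Finset ℕ} :
    (∀ b ∈ marked a U, b ≠ 0 ∧ b ≠ 1) ↔ Finset.range a.length ⊆ U := by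
  have unused (i : ℕ) (hi : i < (marked a U).length) :
      (marked a U)[i] ≠ 0 ∧ (marked a U)[i] ≠ 1 ↔ i ∈ U := by
    rw [getElem_marked]
    cases valuation a i <;> split_ifs with hU <;> simp [hU, bsym]
  simp only [List.forall_mem_iff_getElem, unused, length_marked, Finset.subset_iff,
    Finset.mem_range]

/-- A list recording the occurrences of variables without a value. -/
def missing (n : ℕ) : Formula → List (Fin 5)
  | .var i => if i < n then [] else [0]
  | .neg φ => missing n φ
  | .and φ ψ => missing n φ ++ missing n ψ
  | .or φ ψ => missing n φ ++ missing n ψ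

theorem missing_eq_nil {n : ℕ} {φ : Formula} : missing n φ = [] ↔ φ.vars ⊆ Finset.range n := by
  induction φ with
  | var i => simp [missing, Formula.vars]
  | neg _ ih => exact ih
  | and φ ψ ih₁ ih₂ => simp [missing, Formula.vars, ih₁, ih₂, Finset.union_subset_iff]
  | or φ ψ ih₁ ih₂ => simp [missing, Formula.vars, ih₁, ih₂, Finset.union_subset_iff]

theorem run_walk (i : ℕ) (l R B V F : List (Fin 5)) :
    Run (loop counter walkBody) (layout [] l [0] (List.replicate i 1 ++ 2 :: R) B V F N)
      (layout [] (l.drop i) [] R ((l.take i).reverse ++ B) V F N) (6 * i + 5) := by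
  induction i generalizing l B with
  | zero =>
    refine (Run.loop_cons (t := 3) (by simp) ?_ (Run.loop_nil (by simp))).mono (by omega)
    simp [walkBody]
  | succ i ih =>
    rcases l with _ | ⟨b, l⟩
    · have rest := ih [] B
      rw [List.drop_nil, List.take_nil] at rest ⊢
      refine (Run.loop_cons (t := 5) (by simp) ?_ rest).mono (by omega)
      simp [walkBody, List.replicate_succ]
    · have rest := ih l (b :: B)
      rw [List.take_succ_cons, List.drop_succ_cons, List.reverse_cons, List.append_assoc,
        List.singleton_append]
      refine (Run.loop_cons (t := 5) (by simp) ?_ rest).mono (by omega)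
      simp [walkBody, List.replicate_succ]

variable (i : ℕ) (a : List Bool) (U : Finset ℕ) (R V F : List (Fin 5))

theorem run_readBit :
    ∃ l : List (Fin 5),
    Run readBit (layout [] ((marked a U).drop i) [] R ((marked a U).take i).reverse V F N)
      (layout [] l [] R ((marked a U).take i).reverse
        (bsym (valuation a i) :: V) (missing a.length (.var i) ++ F) N) 3 ∧
    (marked a U).take i ++ l = marked a (insert i U) := by
  rcases lt_or_ge i a.length with hi | hi
  · have hi' : i < (marked a U).length := by rwa [length_marked]
    refine ⟨mark (marked a U)[i] :: (marked a U).drop (i + 1), ?_, ?_⟩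
    · rw [List.drop_eq_getElem_cons hi', missing, if_pos hi, ← value_marked hi']
      generalize (marked a U)[i] = b, (marked a U).drop (i + 1) = l
      simp [readBit]
    · rw [← set_mark_marked hi', List.set_eq_take_append_cons_drop, if_pos hi']
  · refine ⟨[], ?_, ?_⟩
    · rw [List.drop_eq_nil_of_le (by simpa), missing, if_neg (by omega), valuation_of_le hi]
      simp [readBit, bsym]
    · rw [List.append_nil, List.take_of_length_le (by simpa), marked_insert_of_le hi]

theorem run_lookup :
    Run lookup (layout [] (marked a U) [] (List.replicate i 1 ++ 2 :: R) [] V F N)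
      (layout [] (marked a (insert i U)) [] R [] (bsym (valuation a i) :: V)
        (missing a.length (.var i) ++ F) N) (9 * i + 12) := by
  have walk := run_walk (N := N) i (marked a U) R [] V F
  rw [List.append_nil] at walk
  obtain ⟨l, read, hl⟩ := run_readBit (N := N) i a U R V F
  have restore := run_transfer (j := aux) (k := text) (by decide)
    (layout [] l [] R ((marked a U).take i).reverse
      (bsym (valuation a i) :: V) (missing a.length (.var i) ++ F) N)
  simp only [layout_aux, layout_text, update_text, update_aux, List.reverse_reverse, hl] at restore
  refine (run_push_seq (t := 9 * i + 11)).2 ?_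
  simp only [layout_counter, update_counter]
  refine (walk.seq (read.seq restore)).mono ?_
  rw [List.length_reverse]
  have := List.length_take_le i (marked a U)
  omega

theorem run_eval (φ : Formula) {S' : Stacks 8 5} {t : ℕ}
    (h : Run (loop formula evalBody) (layout [] (marked a (φ.vars ∪ U)) [] R []
      (bsym (φ.eval (valuation a)) :: V) (missing a.length φ ++ F) N) S' t) :
    Run (loop formula evalBody) (layout [] (marked a U) [] (tokens φ ++ R) [] V F N) S'
      (t + 9 * φ.enc.length) := by
  induction φ generalizing U R V F t with
  | var i =>
    refine (Run.loop_cons (t := 9 * i + 13) (by simp [tokens]) ?_ h).mono ?_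
    · simpa [evalBody, tokens, Formula.vars, Formula.eval, ← Finset.insert_eq] using
        run_lookup (N := N) i a U R V F
    · simp [Formula.enc, unary]
      omega
  | neg φ ih =>
    rw [tokens, List.append_assoc]
    refine (ih U (1 :: R) V F (t := t + 4) ?_).mono (by simp [Formula.enc]; omega)
    refine (Run.loop_cons (t := 3) (by simp) ?_ h).mono (by omega)
    cases hv : φ.eval (valuation a) <;>
      simp [evalBody, bsym, Formula.eval, Formula.vars, missing, hv]
  | and φ ψ ih₁ ih₂ =>
    rw [tokens, List.append_assoc, List.append_assoc]
    refine (ih₂ U (tokens φ ++ 3 :: R) V F (t := t + 5 + 9 * φ.enc.length) ?_).mono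
      (by simp [Formula.enc]; omega)
    refine ih₁ _ (3 :: R) _ _ (t := t + 5) ?_
    refine (Run.loop_cons (t := 4) (by simp) ?_ h).mono (by omega)
    cases hv : φ.eval (valuation a) <;> cases hw : ψ.eval (valuation a) <;>
      simp [evalBody, bsym, Formula.eval, Formula.vars, missing, hv, hw, Finset.union_assoc]
  | or φ ψ ih₁ ih₂ =>
    rw [tokens, List.append_assoc, List.append_assoc]
    refine (ih₂ U (tokens φ ++ 4 :: R) V F (t := t + 5 + 9 * φ.enc.length) ?_).mono
      (by simp [Formula.enc]; omega)
    refine ih₁ _ (4 :: R) _ _ (t := t + 5) ?_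
    refine (Run.loop_cons (t := 4) (by simp) ?_ h).mono (by omega)
    cases hv : φ.eval (valuation a) <;> cases hw : ψ.eval (valuation a) <;>
      simp [evalBody, bsym, Formula.eval, Formula.vars, missing, hv, hw, Finset.union_assoc]

/-- Record a failure if there is an unused bit on the stack `text`. -/
def checkUsed : Cmd 8 5 :=
  loop text (pop text fun o => if o = some 0 ∨ o = some 1 then push failed 0 else skip)

/-- Check that the formula is true and that all variables have been used. -/
def check : Cmd 8 5 := (pop values fun o => if o = some 1 then skip else push failed 0) ;; checkUsed

theorem run_checkUsed (l F : List (Fin 5)) :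
    ∃ F' : List (Fin 5), (F' = [] ↔ F = [] ∧ ∀ b ∈ l, b ≠ 0 ∧ b ≠ 1) ∧
      Run checkUsed (layout [] l [] [] [] [] F N) (layout [] [] [] [] [] [] F' N)
        (3 * l.length + 1) := by
  induction l generalizing F with
  | nil => exact ⟨F, by simp, Run.loop_nil (by simp)⟩
  | cons b l ih =>
    by_cases hb : b = 0 ∨ b = 1
    · obtain ⟨F', hF', rest⟩ := ih (0 :: F)
      refine ⟨F', ?_, (Run.loop_cons (t := 2) (by simp) (by simp [hb]) rest).mono
        (by rw [List.length_cons]; omega)⟩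
      rw [hF']
      exact ⟨fun h => absurd h.1 (List.cons_ne_nil _ _),
        fun h => absurd (h.2 b List.mem_cons_self) (by tauto)⟩
    · obtain ⟨F', hF', rest⟩ := ih F
      refine ⟨F', ?_, (Run.loop_cons (t := 2) (by simp) (by simp [hb]) rest).mono
        (by rw [List.length_cons]; omega)⟩
      rw [hF', List.forall_mem_cons]
      tauto

theorem run_eval_check (φ : Formula) :
    ∃ F' : List (Fin 5), (F' = [] ↔ φ.SatisfiedBy a) ∧
      Run (loop formula evalBody ;; check) (layout [] (a.map bsym) [] (tokens φ) [] [] [] N)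
        (layout [] [] [] [] [] [] F' N) (9 * φ.enc.length + 3 * a.length + 4) := by
  obtain ⟨v, hv⟩ : ∃ v, v = φ.eval (valuation a) := ⟨_, rfl⟩
  obtain ⟨F', hF', used⟩ := run_checkUsed (N := N) (marked a φ.vars)
    (cond v [] [0] ++ missing a.length φ)
  rw [length_marked] at used
  refine ⟨F', ?_, ?_⟩
  · rw [hF', forall_mem_marked_iff, List.append_eq_nil_iff, missing_eq_nil, Formula.SatisfiedBy,
      show (φ.eval fun i => a.getD i false) = v from hv.symm, Finset.Subset.antisymm_iff]
    cases v <;> simp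
  · have eval := run_eval (N := N) a ∅ [] [] [] φ
      (Run.loop_nil (k := formula) (c := evalBody) (by simp))
    rw [marked_empty, List.append_nil, Finset.union_empty, List.append_nil, ← hv] at eval
    refine (eval.seq (Run.seq (t := 2) ?_ used)).mono (by omega)
    cases v <;> simp [bsym]

/-! ### Computing powers of three -/

/-- The binary digits of `3 * n + c`, given those of `n`. -/
def mulAdd (c : ℕ) : List Bool → List Bool
  | [] => c.bits
  | b :: l => decide ((3 * b.toNat + c) % 2 = 1) :: mulAdd ((3 * b.toNat + c) / 2) l

theorem mulAdd_bits (n c : ℕ) (hc : c ≤ 2) : mulAdd c n.bits = (3 * n + c).bits := by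
  induction n using Nat.binaryRec' generalizing c with
  | zero => simp [mulAdd]
  | bit b n hn ih =>
    have carry : (3 * b.toNat + c) / 2 ≤ 2 := by cases b <;> simp <;> omega
    have expand : 3 * Nat.bit b n + c =
        Nat.bit (decide ((3 * b.toNat + c) % 2 = 1)) (3 * n + (3 * b.toNat + c) / 2) := by
      rw [Nat.bit_val, Nat.bit_val]
      rcases Nat.mod_two_eq_zero_or_one (3 * b.toNat + c) with h | h <;> simp [h] <;> omega
    rw [Nat.bits_append_bit _ _ hn, mulAdd, ih _ carry, expand, Nat.bits_append_bit]
    intro h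
    obtain rfl : n = 0 := by omega
    rw [hn rfl, decide_eq_true_iff, Bool.toNat_true] at *
    omega

/-- The number denoted by an optional symbol. -/
def num : Option (Fin 5) → ℕ
  | some a => a
  | none => 0

/-- A step of the multiplication by `3`. -/
def mulBody : Cmd 8 5 := pop values fun d => pop counter fun c =>
  push aux (if (3 * num d + num c) % 2 = 1 then 1 else 0) ;;
    push counter (Fin.ofNat 5 ((3 * num d + num c) / 2))

/-- Write the digits of the remaining carry, which is at most `2`. -/
def flushCarry : Cmd 8 5 := pop counter fun c => match c with
  | some 1 => push aux 1
  | some 2 => push aux 0 ;; push aux 1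
  | _ => skip

/-- Multiply the number on the stack `values` by `3`. -/
def mul : Cmd 8 5 := push counter 0 ;; (loop values mulBody ;; flushCarry) ;; transfer aux values

theorem run_flushCarry (c : ℕ) (hc : c ≤ 2) (Q : List (Fin 5)) :
    Run flushCarry (layout [] [] [Fin.ofNat 5 c] [] Q [] [] N)
      (layout [] [] [] [] ((c.bits.map bsym).reverse ++ Q) [] [] N) 3 := by
  interval_cases c
  · simp [flushCarry]
  · exact (run_pop (t := 2)).2 ((run_push (t := 1)).2 (by simp [bsym]))
  · simp [flushCarry, bsym, show Nat.bits 2 = [false, true] by simp [Nat.bits, Nat.binaryRec]]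

theorem run_mul_loop (l : List Bool) (c : ℕ) (hc : c ≤ 2) (Q : List (Fin 5)) :
    Run (loop values mulBody ;; flushCarry)
      (layout [] [] [Fin.ofNat 5 c] [] Q (l.map bsym) [] N)
      (layout [] [] [] [] (((mulAdd c l).map bsym).reverse ++ Q) [] [] N) (5 * l.length + 5) := by
  induction l generalizing c Q with
  | nil =>
    exact ((Run.loop_nil (layout_values ..)).seq (run_flushCarry c hc Q)).mono (by simp)
  | cons b l ih =>
    have carry : (3 * b.toNat + c) / 2 ≤ 2 := by cases b <;> simp <;> omega
    have rest := ih _ carry (bsym (decide ((3 * b.toNat + c) % 2 = 1)) :: Q)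
    rw [mulAdd, List.map_cons (l := mulAdd _ _), List.reverse_cons, List.append_assoc,
      List.singleton_append]
    refine Run.mono (Run.loop_seq (t := 4) (by simp) ?_ rest) (by rw [List.length_cons]; omega)
    interval_cases c <;> cases b <;> simp [mulBody, bsym, num]

theorem run_mul (n : ℕ) :
    Run mul (layout [] [] [] [] [] (n.bits.map bsym) [] N)
      (layout [] [] [] [] [] ((3 * n).bits.map bsym) [] N)
      (5 * n.bits.length + 3 * (3 * n).bits.length + 7) := by
  have digits := run_mul_loop (N := N) n.bits 0 (by omega) []
  rw [mulAdd_bits _ _ (by omega), add_zero, List.append_nil] at digits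
  have restore := run_transfer (j := aux) (k := values) (by decide)
    (layout [] [] [] [] ((3 * n).bits.map bsym).reverse [] [] N)
  simp only [layout_aux, layout_values, update_values, update_aux, List.reverse_reverse,
    List.append_nil, List.length_reverse, List.length_map] at restore
  refine (run_push_seq (t := 5 * n.bits.length + 3 * (3 * n).bits.length + 6)).2 ?_
  simp only [layout_counter, update_counter]
  exact (digits.seq restore).mono (by omega)

theorem length_bits_le {n B : ℕ} (h : n < 2 ^ B) : n.bits.length ≤ B :=
  Nat.size_eq_bits_len n ▸ Nat.size_le.2 h

theorem run_power (k n B : ℕ) (hB : 3 ^ k * n < 2 ^ B) :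
    Run (loop size (pop size fun _ => mul))
      (layout [] [] [] [] [] (n.bits.map bsym) [] (List.replicate k 0))
      (layout [] [] [] [] [] ((3 ^ k * n).bits.map bsym) [] []) (k * (8 * B + 9) + 1) := by
  induction k generalizing n with
  | zero => simpa using Run.loop_nil (k := size) (c := pop size fun _ => mul) (by simp)
  | succ k ih =>
    rw [pow_succ, mul_assoc] at hB ⊢
    have hpos : 0 < 3 ^ k := by positivity
    have hle : 3 * n ≤ 3 ^ k * (3 * n) := Nat.le_mul_of_pos_left _ hpos
    have len₁ := length_bits_le (n := 3 * n) (B := B) (by omega)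
    have len₂ := length_bits_le (n := n) (B := B) (by omega)
    refine (Run.loop_cons (t := 8 * B + 8) (by simp) ?_ (ih _ hB)).mono
      (by ring_nf; omega)
    refine (run_pop (t := 8 * B + 7)).2 ?_
    simp only [layout_size, List.replicate_succ, update_size]
    exact (run_mul n).mono (by omega)

/-! ### The program computing the weights -/

/-- Output the number on the stack `values` as the denominator of a fraction with numerator `1`. -/
def writeInverse : Cmd 8 5 := push io 1 ;; push io 2 ;; transfer values io

/-- Output the weight of a string of positive weight. -/
def accept : Cmd 8 5 :=
  push values 1 ;; push values 1 ;; loop size (pop size fun _ => mul) ;; writeInverse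

/-- Output the weight `0`. -/
def reject : Cmd 8 5 :=
  clear text ;; clear formula ;; clear failed ;; clear size ;; push io 2 ;; push io 1

/-- Continue with `c` unless there has been a failure. -/
def unlessFailed (c : Cmd 8 5) : Cmd 8 5 := pop failed fun o => if o = none then c else reject

/-- Copy the input to the stack `text` and count its length. -/
def copyBody : Cmd 8 5 := pop io fun o => match o with
  | some a => push text a ;; push size 0
  | none => skip

/-- Output the weight of the input after parsing. -/
def judge : Cmd 8 5 := unlessFailed ((loop formula evalBody ;; check) ;; unlessFailed accept)

/-- The program computing `satWeight`. -/
def main : Cmd 8 5 := loop io copyBody ;; push counter 0 ;; loop counter parseBody ;; judge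

open Classical in
/-- The output of `main`: the weight of a string as a fraction, in stack symbols. -/
noncomputable def answer (x : List Bool) : List (Fin 5) :=
  if x ∈ satStrings then 1 :: 2 :: (3 ^ (x.length + 1)).bits.map bsym else [2, 1]

variable {x : List Bool}

theorem answer_of_mem (hx : x ∈ satStrings) :
    answer x = 1 :: 2 :: (3 ^ (x.length + 1)).bits.map bsym := if_pos hx

theorem answer_of_notMem (hx : x ∉ satStrings) : answer x = [2, 1] := if_neg hx

theorem length_bits_three_pow_le (n : ℕ) : (3 ^ n).bits.length ≤ 2 * n + 1 :=
  length_bits_le <| calc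
    3 ^ n ≤ 4 ^ n := Nat.pow_le_pow_left (by omega) n
    _ = 2 ^ (2 * n) := (pow_mul 2 2 n).symm
    _ < 2 ^ (2 * n + 1) := Nat.pow_lt_pow_right one_lt_two (Nat.lt_succ_self _)

theorem run_writeInverse (l : List (Fin 5)) :
    Run writeInverse (layout [] [] [] [] [] l [] []) (Stacks.single (1 :: 2 :: l).reverse)
      (3 * l.length + 3) := by
  have copy := run_transfer (j := values) (k := io) (by decide) (layout [2, 1] [] [] [] [] l [] [])
  simp only [layout_io, layout_values, update_io, update_values] at copy
  refine (run_push_seq (t := 3 * l.length + 2)).2 ((run_push_seq (t := 3 * l.length + 1)).2 ?_)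
  simp only [layout_io, update_io]
  rw [single_eq_layout, List.reverse_cons, List.reverse_cons, List.append_assoc]
  exact copy

theorem run_accept (hx : x ∈ satStrings) :
    Run accept (layout [] [] [] [] [] [] [] (List.replicate x.length 0))
      (Stacks.single (answer x).reverse) (100 * (x.length + 1) ^ 2) := by
  set n := x.length
  have hB : 3 ^ n * 3 < 2 ^ (2 * (n + 1)) := by
    rw [← pow_succ, pow_mul]
    exact Nat.pow_lt_pow_left (by omega) (by omega)
  have power := run_power n 3 _ hB
  have bits_three : (3 : ℕ).bits.map bsym = [1, 1] := by simp [Nat.bits, Nat.binaryRec, bsym]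
  rw [← pow_succ, bits_three] at power
  have write := run_writeInverse ((3 ^ (n + 1)).bits.map bsym)
  have hlen := length_bits_three_pow_le (n + 1)
  rw [List.length_map] at write
  rw [answer_of_mem hx]
  refine Run.mono ((run_push_seq).2 ((run_push_seq).2 ?_)) (t := n * (16 * n + 25) + 6 * n + 16)
    (by nlinarith)
  simp only [layout_values, update_values]
  exact (power.seq write).mono (by nlinarith)

theorem run_reject (hx : x ∉ satStrings) (X R F N : List (Fin 5)) :
    Run reject (layout [] X [] R [] [] F N) (Stacks.single (answer x).reverse)
      (3 * (X.length + R.length + F.length + N.length) + 6) := by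
  have clear_text := run_clear text (layout [] X [] R [] [] F N)
  have clear_formula := run_clear formula (layout [] [] [] R [] [] F N)
  have clear_failed := run_clear failed (layout [] [] [] [] [] [] F N)
  have clear_size := run_clear size (layout [] [] [] [] [] [] [] N)
  simp only [layout_text, layout_formula, layout_failed, layout_size, update_text, update_formula,
    update_failed, update_size] at clear_text clear_formula clear_failed clear_size
  have write : Run (push io 2 ;; push io 1) (layout [] [] [] [] [] [] [] [])
      (Stacks.single (answer x).reverse) 2 := by
    rw [answer_of_notMem hx, single_eq_layout]
    simp
  exact (clear_text.seq (clear_formula.seq (clear_failed.seq (clear_size.seq write)))).mono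
    (by omega)

theorem run_copy (l X : List (Fin 5)) (n : ℕ) :
    Run (loop io copyBody) (layout l X [] [] [] [] [] (List.replicate n 0))
      (layout [] (l.reverse ++ X) [] [] [] [] [] (List.replicate (n + l.length) 0))
      (4 * l.length + 1) := by
  induction l generalizing X n with
  | nil => exact Run.loop_nil (by simp)
  | cons a l ih =>
    have rest := ih (a :: X) (n + 1)
    rw [List.reverse_cons, List.append_assoc, List.singleton_append, List.length_cons,
      Nat.add_comm l.length 1, ← Nat.add_assoc]
    refine Run.mono (Run.loop_cons (t := 3) (by simp) ?_ rest) (by omega)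
    simp [copyBody, List.replicate_succ]

theorem mem_satStrings_iff {φ : Formula} {a : List Bool} :
    φ.enc ++ a ∈ satStrings ↔ φ.SatisfiedBy a := by
  refine ⟨?_, fun h => ⟨φ, a, h, rfl⟩⟩
  rintro ⟨ψ, b, h, heq⟩
  obtain ⟨rfl, rfl⟩ := Formula.enc_append_inj φ ψ a b heq
  exact h

theorem run_judge_of_parsed (φ : Formula) (a : List Bool) {n : ℕ} (hn : n = (φ.enc ++ a).length) :
    Run judge (layout [] (a.map bsym) [] (tokens φ) [] [] [] (List.replicate n 0))
      (Stacks.single (answer (φ.enc ++ a)).reverse) (200 * (n + 1) ^ 2) := by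
  obtain ⟨F', hF', eval⟩ := run_eval_check (N := List.replicate n 0) a φ
  have hlen : n = φ.enc.length + a.length := by rw [hn, List.length_append]
  have hlen' := eval.length_le failed
  simp only [layout_failed, List.length_nil] at hlen'
  refine Run.mono ((run_pop (t := 9 * n + 4 + (100 * (n + 1) ^ 2 + 37 * n + 18 + 1))).2 ?_)
    (by nlinarith)
  simp only [layout_failed, if_true]
  refine Run.seq (eval.mono (by omega)) (run_pop.2 ?_)
  rcases F' with _ | ⟨b, F'⟩
  · simp only [layout_failed, if_true, hn]
    exact (run_accept (mem_satStrings_iff.2 (hF'.1 rfl))).mono (by omega)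
  · have hx : φ.enc ++ a ∉ satStrings := fun h => by cases hF'.2 (mem_satStrings_iff.1 h)
    simp only [layout_failed, update_failed, reduceCtorEq, if_false]
    refine (run_reject hx _ _ _ _).mono ?_
    rw [List.length_cons] at hlen'
    simp only [List.length_nil, List.length_replicate]
    omega

theorem run_judge {S : Stacks 8 5} (hS : ParseResult (List.replicate x.length 0) [] 1 x S)
    (hlen : ∀ k, (S k).length ≤ 22 * (x.length + 1)) :
    Run judge S (Stacks.single (answer x).reverse) (300 * (x.length + 1) ^ 2) := by
  rcases hS with ⟨φs, u, hφs, hx, rfl⟩ | ⟨hx, X, R, rfl⟩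
  · obtain ⟨φ, rfl⟩ := List.length_eq_one_iff.1 hφs
    obtain rfl : x = φ.enc ++ u := by simpa [encs] using hx
    simpa only [tokensOn, List.append_nil] using
      (run_judge_of_parsed φ u rfl).mono (Nat.mul_le_mul_right _ (by norm_num))
  · have hx : x ∉ satStrings := by
      rintro ⟨φ, a, -, h⟩
      exact hx ⟨[φ], a, rfl, by simpa [encs] using h⟩
    have hX := hlen text
    have hR := hlen formula
    simp only [layout_text, layout_formula] at hX hR
    refine Run.mono ((run_pop (t := 3 * (X.length + R.length + 0 + x.length) + 6)).2 ?_)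
      (by nlinarith)
    simp only [layout_failed, update_failed, reduceCtorEq, if_false]
    simpa using run_reject hx X R [] (List.replicate x.length 0)

theorem run_main (x : List Bool) :
    Run main (Stacks.single (x.map bsym).reverse) (Stacks.single (answer x).reverse)
      (400 * (x.length + 1) ^ 2) := by
  rw [single_eq_layout (x.map bsym).reverse]
  have copy := run_copy (x.map bsym).reverse [] 0
  simp only [List.reverse_reverse, List.append_nil, List.replicate_zero, zero_add,
    List.length_reverse, List.length_map] at copy
  obtain ⟨S, hS, parse⟩ := run_parse (List.replicate x.length 0) 1 x []
  have initial (k : Fin 8) :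
      (parseStacks (List.replicate x.length 0) [] 1 x k).length ≤ x.length + 1 := by
    fin_cases k <;> simp [parseStacks, layout]
  have judge := run_judge hS fun k => by
    have := parse.length_le k
    have := initial k
    omega
  refine Run.mono (copy.seq ((run_push_seq (t := 350 * (x.length + 1) ^ 2)).2 ?_)) (by nlinarith)
  simp only [layout_counter, update_counter]
  exact (parse.seq judge).mono (by nlinarith)

theorem bitSym_eq (b : Bool) : bitSym b = (bsym b : ℕ) + 1 := by cases b <;> rfl

theorem word_eq (x : List Bool) : word x = (x.map bsym).map fun a : Fin 5 => (a : ℕ) + 1 := by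
  simp [word, bitSym_eq]

theorem exists_fraction_answer (x : List Bool) :
    ∃ a b : ℕ, b ≠ 0 ∧ (a : ℝ) / b = satWeight x ∧
      fracWord a b = (answer x).map fun a : Fin 5 => (a : ℕ) + 1 := by
  by_cases hx : x ∈ satStrings
  · refine ⟨1, 3 ^ (x.length + 1), by positivity, by simp [satWeight, hx], ?_⟩
    rw [answer_of_mem hx, fracWord, word_eq, word_eq]
    simp [bsym, sepSym]
  · refine ⟨0, 1, one_ne_zero, by simp [satWeight, hx], ?_⟩
    simp [answer_of_notMem hx, fracWord, word, bitSym, sepSym]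

end SatProg

theorem satWeight_efficientlyComputable : satWeight.EfficientlyComputable := by
  let p : Polynomial ℕ := 400 * (.X + 1) ^ 2
  refine ⟨SatProg.main.toProg.toTM (6 ^ 8), p * (4 * (.X + p) + 15), fun x => ?_⟩
  obtain ⟨a, b, hb, hab, hout⟩ := SatProg.exists_fraction_answer x
  refine ⟨a, b, hb, hab, hout ▸ ?_⟩
  have run := (SatProg.run_main x).toProg_single
  rw [← SatProg.word_eq] at run
  convert run.outputs using 1
  simp [p]

/-! ### The weights of prefixes -/

theorem tsum_list_length {α : Type*} [Fintype α] (f : ℕ → ℝ≥0∞) :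
    ∑' x : List α, f x.length = ∑' n, (Fintype.card α : ℝ≥0∞) ^ n * f n := by
  rw [← (Equiv.sigmaFiberEquiv (List.length (α := α))).tsum_eq, ENNReal.tsum_sigma']
  refine tsum_congr fun n => ?_
  have fiber (x : {x : List α // x.length = n}) :
      f (Equiv.sigmaFiberEquiv (List.length (α := α)) ⟨n, x⟩).length = f n := congrArg f x.2
  let _ : Fintype {x : List α // x.length = n} := inferInstanceAs (Fintype (List.Vector α n))
  have card : Fintype.card {x : List α // x.length = n} = Fintype.card α ^ n := card_vector n
  simp only [fiber, tsum_fintype, Finset.sum_const, Finset.card_univ, card, nsmul_eq_mul,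
    Nat.cast_pow]

theorem tsum_third_pow_lt_top : ∑' x : List Bool, (1 / 3 : ℝ≥0∞) ^ (x.length + 1) < ∞ := by
  have geometric (n : ℕ) : ((2 : ℕ) : ℝ≥0∞) ^ n * (1 / 3) ^ (n + 1) = 1 / 3 * (2 / 3) ^ n := by
    rw [pow_succ, div_eq_mul_inv 2, mul_pow, div_eq_mul_inv 1, one_mul]
    push_cast
    ring
  rw [tsum_list_length fun n => (1 / 3 : ℝ≥0∞) ^ (n + 1), Fintype.card_bool]
  simp only [geometric]
  rw [ENNReal.tsum_mul_left, ENNReal.tsum_geometric]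
  refine ENNReal.mul_lt_top (ENNReal.div_lt_top (by simp) (by simp)) ?_
  rw [ENNReal.inv_lt_top, tsub_pos_iff_lt, ENNReal.div_lt_iff (by simp) (by simp)]
  norm_num

theorem satWeight_of_mem {x : List Bool} (h : x ∈ satStrings) :
    satWeight x = (1 / 3 : ℝ≥0) ^ (x.length + 1) := if_pos h

theorem satWeight_of_notMem {x : List Bool} (h : x ∉ satStrings) : satWeight x = 0 := if_neg h

theorem satWeight_normalizable : satWeight.Normalizable := by
  constructor
  · have h : Formula.enc (.var 0) ++ [true] ∈ satStrings :=
      ⟨.var 0, [true], ⟨by simp [Formula.vars], by simp [Formula.eval]⟩, rfl⟩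
    refine lt_of_lt_of_le ?_ (ENNReal.le_tsum (Formula.enc (.var 0) ++ [true]))
    rw [satWeight_of_mem h]
    positivity
  · refine lt_of_le_of_lt (ENNReal.tsum_le_tsum fun x => ?_) tsum_third_pow_lt_top
    by_cases h : x ∈ satStrings
    · rw [satWeight_of_mem h, ENNReal.coe_pow, ENNReal.coe_div (by simp), ENNReal.coe_one,
        ENNReal.coe_ofNat]
    · rw [satWeight_of_notMem h]
      exact zero_le

namespace Formula

/-- The satisfying assignments that begin with `v`. -/
def satsFrom (φ : Formula) (v : List Bool) : Set (List Bool) := {a | φ.SatisfiedBy a ∧ v <+: a}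

theorem SatisfiedBy.length_eq {φ : Formula} {a : List Bool} (h : φ.SatisfiedBy a) :
    a.length = φ.vars.card := by
  rw [h.1, Finset.card_range]

theorem finite_satsFrom (φ : Formula) (v : List Bool) : (φ.satsFrom v).Finite :=
  (List.finite_length_eq Bool φ.vars.card).subset fun _ h => h.1.length_eq

/-- The strings `enc(φ) a` with `a` a satisfying assignment that begins with `v`. -/
def encSatsFrom (φ : Formula) (v : List Bool) (a : φ.satsFrom v) :
    {x : List Bool // φ.enc ++ v <+: x} :=
  ⟨φ.enc ++ a.1, (List.prefix_append_right_inj _).2 a.2.2⟩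

theorem encSatsFrom_injective (φ : Formula) (v : List Bool) :
    Function.Injective (φ.encSatsFrom v) := fun _ _ h =>
  Subtype.ext (List.append_cancel_left (congrArg Subtype.val h))

theorem satWeight_encSatsFrom {φ : Formula} {v : List Bool} (a : φ.satsFrom v) :
    satWeight (φ.encSatsFrom v a) = (1 / 3 : ℝ≥0) ^ (φ.enc.length + φ.vars.card + 1) := by
  rw [satWeight_of_mem (x := φ.encSatsFrom v a) ⟨φ, a.1, a.2.1, rfl⟩, encSatsFrom,
    List.length_append, a.2.1.length_eq]

theorem mem_range_encSatsFrom {φ : Formula} {v : List Bool} {x : {x // φ.enc ++ v <+: x}}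
    (hx : x.1 ∈ satStrings) : x ∈ Set.range (φ.encSatsFrom v) := by
  obtain ⟨x, w, rfl⟩ := x
  obtain ⟨ψ, a, ha, h⟩ := hx
  obtain ⟨rfl, rfl⟩ := enc_append_inj _ _ _ _ ((List.append_assoc ..).symm.trans h)
  exact ⟨⟨v ++ w, ha, List.prefix_append _ _⟩, Subtype.ext (List.append_assoc ..).symm⟩

end Formula

theorem prefixWeight_enc_append (φ : Formula) (v : List Bool) :
    satWeight.prefixWeight (φ.enc ++ v) =
      (φ.satsFrom v).ncard * ((1 / 3 : ℝ≥0) ^ (φ.enc.length + φ.vars.card + 1) : ℝ≥0) := by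
  have support : Function.support (fun x : {x : List Bool // φ.enc ++ v <+: x} =>
      (satWeight x.1 : ℝ≥0∞)) ⊆ Set.range (φ.encSatsFrom v) := by
    refine fun x hx => Formula.mem_range_encSatsFrom ?_
    by_contra h
    exact hx (ENNReal.coe_eq_zero.2 (satWeight_of_notMem h))
  have := (φ.finite_satsFrom v).to_subtype
  have := Fintype.ofFinite (φ.satsFrom v)
  rw [WeightedLanguage.prefixWeight, ← (φ.encSatsFrom_injective v).tsum_eq support]
  simp only [Formula.satWeight_encSatsFrom, tsum_fintype, Finset.sum_const, Finset.card_univ,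
    nsmul_eq_mul, Set.ncard_eq_toFinset_card', Set.toFinset_card]

theorem prefixWeight_enc (φ : Formula) :
    satWeight.prefixWeight φ.enc =
      (φ.satsFrom []).ncard * ((1 / 3 : ℝ≥0) ^ (φ.enc.length + φ.vars.card + 1) : ℝ≥0) := by
  rw [← prefixWeight_enc_append, List.append_nil]

theorem localProb_enc (φ : Formula) (b : Bool) :
    satWeight.localProb φ.enc (some b) = (φ.satsFrom [b]).ncard / (φ.satsFrom []).ncard := by
  rw [WeightedLanguage.localProb, prefixWeight_enc_append, prefixWeight_enc,
    ENNReal.mul_div_mul_right _ _ (by simp) (by simp)]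
  simp

theorem localProb_enc_mem_range (φ : Formula) (b : Bool) :
    satWeight.localProb φ.enc (some b) ∈ Set.range ((↑) : ℚ → ℝ) :=
  ⟨(φ.satsFrom [b]).ncard / (φ.satsFrom []).ncard, by rw [localProb_enc]; push_cast; rfl⟩

section Satisfiable

variable {φ : Formula} {a : List Bool}

theorem Formula.SatisfiedBy.ncard_satsFrom_ne_zero (h : φ.SatisfiedBy a) :
    (φ.satsFrom []).ncard ≠ 0 := by
  rw [Ne, Set.ncard_eq_zero (φ.finite_satsFrom _)]
  exact Set.Nonempty.ne_empty ⟨a, h, List.nil_prefix⟩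

theorem Formula.SatisfiedBy.prefixWeight_pos (h : φ.SatisfiedBy a) :
    0 < satWeight.prefixWeight φ.enc := by
  have := Nat.pos_of_ne_zero h.ncard_satsFrom_ne_zero
  rw [prefixWeight_enc]
  positivity

theorem Formula.SatisfiedBy.localProb_eq_zero_iff (h : φ.SatisfiedBy a) (b : Bool) :
    satWeight.localProb φ.enc (some b) = 0 ↔ φ.satsFrom [b] = ∅ := by
  rw [localProb_enc, div_eq_zero_iff, Nat.cast_eq_zero, Nat.cast_eq_zero,
    or_iff_left h.ncard_satsFrom_ne_zero, Set.ncard_eq_zero (φ.finite_satsFrom _)]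

end Satisfiable

/-! ### Expressing predicates by formulas of bounded length -/

theorem Formula.eval_congr {φ : Formula} {f g : ℕ → Bool} (h : ∀ i ∈ φ.vars, f i = g i) :
    φ.eval f = φ.eval g := by
  induction φ with
  | var i => exact h i (Finset.mem_singleton_self i)
  | neg φ ih => simp only [Formula.eval, ih h]
  | and φ ψ ih₁ ih₂ | or φ ψ ih₁ ih₂ =>
    simp only [Formula.vars, Finset.mem_union] at h
    simp only [Formula.eval, ih₁ fun i hi => h i (.inl hi), ih₂ fun i hi => h i (.inr hi)]

/-- There is a formula of length at most `B` in the variables below `N` that expresses `p`. The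
variable `0` is left free for other purposes: the `k`th argument of `p` is the variable `k + 1`. -/
def Expressible (N B : ℕ) (p : (ℕ → Bool) → Prop) : Prop :=
  ∃ φ : Formula, (∀ ν, φ.eval ν = true ↔ p fun k => ν (k + 1)) ∧ (∀ i ∈ φ.vars, i < N) ∧
    φ.enc.length ≤ B

namespace Expressible

variable {N B B' : ℕ} {p q : (ℕ → Bool) → Prop}

theorem congr (h : Expressible N B p) (hpq : ∀ μ, p μ ↔ q μ) (hB : B ≤ B') :
    Expressible N B' q := by
  obtain ⟨φ, hφ, hvars, hlen⟩ := h
  exact ⟨φ, fun ν => (hφ ν).trans (hpq _), hvars, hlen.trans hB⟩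

theorem mono (h : Expressible N B p) (hB : B ≤ B') : Expressible N B' p :=
  h.congr (fun _ => Iff.rfl) hB

theorem lit {k : ℕ} (h : k + 1 < N) : Expressible N (N + 3) fun μ => μ k = true :=
  ⟨.var (k + 1), fun ν => Iff.rfl, by simpa [Formula.vars] using h,
    by simp [Formula.enc, unary]; omega⟩

theorem not (h : Expressible N B p) : Expressible N (B + 2) fun μ => ¬ p μ := by
  obtain ⟨φ, hφ, hvars, hlen⟩ := h
  exact ⟨.neg φ, fun ν => by simp [Formula.eval, ← hφ], hvars, by simp [Formula.enc]; omega⟩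

theorem and (h : Expressible N B p) (h' : Expressible N B' q) :
    Expressible N (B + B' + 2) fun μ => p μ ∧ q μ := by
  obtain ⟨φ, hφ, hvars, hlen⟩ := h
  obtain ⟨ψ, hψ, hvars', hlen'⟩ := h'
  exact ⟨.and φ ψ, fun ν => by simp [Formula.eval, ← hφ, ← hψ],
    fun i hi => (Finset.mem_union.1 hi).elim (hvars i) (hvars' i), by simp [Formula.enc]; omega⟩

theorem or (h : Expressible N B p) (h' : Expressible N B' q) :
    Expressible N (B + B' + 2) fun μ => p μ ∨ q μ := by
  obtain ⟨φ, hφ, hvars, hlen⟩ := h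
  obtain ⟨ψ, hψ, hvars', hlen'⟩ := h'
  exact ⟨.or φ ψ, fun ν => by simp [Formula.eval, ← hφ, ← hψ],
    fun i hi => (Finset.mem_union.1 hi).elim (hvars i) (hvars' i), by simp [Formula.enc]; omega⟩

theorem iff (h : Expressible N B p) (h' : Expressible N B' q) :
    Expressible N (2 * (B + B') + 10) fun μ => p μ ↔ q μ :=
  ((h.and h').or (h.not.and h'.not)).congr (fun _ => iff_iff_and_or_not_and_not.symm) (by omega)

theorem imp (h : Expressible N B p) (h' : Expressible N B' q) :
    Expressible N (B + B' + 4) fun μ => p μ → q μ :=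
  (h.not.or h').congr (fun _ => imp_iff_not_or.symm) (by omega)

theorem const (h : 0 < N) (c : Prop) : Expressible N 10 fun _ => c := by
  by_cases hc : c
  · exact ⟨.or (.var 0) (.neg (.var 0)), fun ν => by simp [Formula.eval, hc],
      by simpa [Formula.vars] using h, by simp [Formula.enc, unary]⟩
  · exact ⟨.and (.var 0) (.neg (.var 0)), fun ν => by simp [Formula.eval, hc],
      by simpa [Formula.vars] using h, by simp [Formula.enc, unary]⟩

theorem forall_lt {p : ℕ → (ℕ → Bool) → Prop} (hN : 0 < N) (k : ℕ)
    (h : ∀ i < k, Expressible N B (p i)) :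
    Expressible N (k * (B + 2) + 10) fun μ => ∀ i < k, p i μ := by
  induction k with
  | zero => exact (const hN True).congr (fun _ => by simp) (by omega)
  | succ k ih =>
    exact ((ih fun i hi => h i (by omega)).and (h k (by omega))).congr
      (fun _ => Nat.forall_lt_succ_right.symm) (by rw [Nat.succ_mul]; omega)

theorem exists_lt {p : ℕ → (ℕ → Bool) → Prop} (hN : 0 < N) (k : ℕ)
    (h : ∀ i < k, Expressible N B (p i)) :
    Expressible N (k * (B + 2) + 10) fun μ => ∃ i < k, p i μ := by
  induction k with
  | zero => exact (const hN False).congr (fun _ => by simp) (by omega)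
  | succ k ih =>
    exact ((ih fun i hi => h i (by omega)).or (h k (by omega))).congr
      (fun _ => Nat.exists_lt_succ_right.symm) (by rw [Nat.succ_mul]; omega)

end Expressible

/-! ### The tableau of a computation -/

namespace TM

/-- A step of `M`; halting configurations are left unchanged. -/
def next (M : TM) (c : TM0.Cfg ℕ ℕ) : TM0.Cfg ℕ ℕ := (TM0.step M.toMachine c).getD c

/-- The state following `q` on reading `a`. -/
def nextState (M : TM) (q a : ℕ) : ℕ := ((M.toMachine q a).map Prod.fst).getD q

/-- The action in state `q` on reading `a`. -/
def nextAct (M : TM) (q a : ℕ) : Option (TM0.Stmt ℕ) := (M.toMachine q a).map Prod.snd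

variable {M : TM} {D : ℕ} {c c' : TM0.Cfg ℕ ℕ}

theorem next_q (M : TM) (c : TM0.Cfg ℕ ℕ) : (M.next c).q = M.nextState c.q c.Tape.head := by
  obtain ⟨q, T⟩ := c
  rcases h : M.toMachine q T.head with _ | ⟨q', a⟩
  · simp [next, nextState, TM0.step, h]
  · simp [next, nextState, step_eq h, h]

theorem next_tape (M : TM) (c : TM0.Cfg ℕ ℕ) :
    (M.next c).Tape = (M.nextAct c.q c.Tape.head).elim c.Tape (tapeApply c.Tape) := by
  obtain ⟨q, T⟩ := c
  rcases h : M.toMachine q T.head with _ | ⟨q', a⟩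
  · simp [next, nextAct, TM0.step, h]
  · simp [next, nextAct, step_eq h, h]

theorem Steps.iterate_next {n : ℕ} (h : M.Steps c n c') : M.next^[n] c = c' := by
  induction n generalizing c with
  | zero => exact steps_zero.1 h
  | succ n ih =>
    obtain ⟨d, hstep, hd⟩ := steps_succ.1 h
    rw [Function.iterate_succ_apply, next, hstep]
    exact ih hd

theorem Outputs.iterate_next {w v : List ℕ} {t t' : ℕ} (h : M.Outputs w v t) (ht : t ≤ t') :
    (M.next^[t'] (TM0.init w)).Tape = Tape.mk₁ v := by
  obtain ⟨n, hn, q, hsteps, hhalt⟩ := outputs_iff.1 h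
  obtain ⟨k, rfl⟩ := Nat.exists_eq_add_of_le (hn.trans ht)
  rw [Nat.add_comm, Function.iterate_add_apply, hsteps.iterate_next, Function.iterate_fixed]
  simp [next, TM0.step, hhalt]

theorem Answers.iterate_next_head {w : List ℕ} {p : Prop} {t : ℕ} (h : M.Answers w p t) :
    (M.next^[t] (TM0.init w)).Tape.head = 2 ↔ p := by
  by_cases hp : p
  · rw [(h.1 hp).iterate_next le_rfl]
    exact iff_of_true rfl hp
  · rw [(h.2 hp).iterate_next le_rfl]
    exact iff_of_false (by decide) hp

/-- All states that `M` enters and all symbols that it writes are below `D`, and so are the symbols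
of input words. -/
def BoundedBy (M : TM) (D : ℕ) : Prop :=
  4 ≤ D ∧ ∀ r ∈ M, r.next < D ∧ ∀ a, r.act = .write a → a < D

theorem exists_boundedBy (M : TM) : ∃ D, M.BoundedBy D := by
  induction M with
  | nil => exact ⟨4, le_rfl, by simp⟩
  | cons r M ih =>
    obtain ⟨D, hD, hM⟩ := ih
    obtain ⟨b, hb⟩ : ∃ b, ∀ a, r.act = .write a → a < b := by
      rcases r.act with d | b
      · exact ⟨0, by simp⟩
      · exact ⟨b + 1, by rintro _ ⟨⟩; omega⟩
    refine ⟨D + r.next + b + 1, by omega, List.forall_mem_cons.2 ⟨⟨by omega, ?_⟩, ?_⟩⟩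
    · exact fun a ha => (hb a ha).trans_le (by omega)
    · exact fun s hs => ⟨(hM s hs).1.trans_le (by omega),
        fun a ha => ((hM s hs).2 a ha).trans_le (by omega)⟩

/-- The state and the symbols of a configuration are below `D`. -/
def CfgBounded (D : ℕ) (c : TM0.Cfg ℕ ℕ) : Prop := c.q < D ∧ ∀ j, c.Tape.nth j < D

theorem BoundedBy.next (hM : M.BoundedBy D) (h : CfgBounded D c) : CfgBounded D (M.next c) := by
  rw [CfgBounded, next_q, next_tape, nextState, nextAct]
  rcases hx : M.toMachine c.q c.Tape.head with _ | ⟨q', a⟩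
  · exact h
  · obtain ⟨r, hr, -, -, rfl, hact⟩ := exists_mem_of_toMachine hx
    refine ⟨(hM.2 r hr).1, fun j => ?_⟩
    rcases a with (_ | _) | b
    · exact (Tape.move_left_nth ..).trans_lt (h.2 _)
    · exact (Tape.move_right_nth ..).trans_lt (h.2 _)
    · refine (Tape.write_nth ..).trans_lt ?_
      split_ifs
      exacts [(hM.2 r hr).2 b hact, h.2 j]

theorem BoundedBy.iterate_next (hM : M.BoundedBy D) (h : CfgBounded D c) (i : ℕ) :
    CfgBounded D (M.next^[i] c) := by
  induction i generalizing c with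
  | zero => exact h
  | succ _ ih => exact ih (hM.next h)

end TM

theorem nth_mk₁_natCast (w : List ℕ) (j : ℕ) : (Tape.mk₁ w).nth j = w.getD j 0 := by
  rw [HeadTape.rep_ofWord w j]
  simp [HeadTape.ofWord, List.getI, default]

theorem nth_mk₁_of_neg (w : List ℕ) {j : ℤ} (hj : j < 0) : (Tape.mk₁ w).nth j = 0 := by
  rw [HeadTape.rep_ofWord w j]
  simp only [HeadTape.ofWord, zero_add, if_neg hj.not_ge]
  rfl

namespace Tableau

/-- The variable for `at time i, the machine is in state q`. -/
def stateVar (i q : ℕ) : ℕ := Nat.pair 0 (Nat.pair i q)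

/-- The variable for `at time i, the cell p holds the symbol s`, cells being numbered relative to
the head in such a way that the scanned one has the number `t`. -/
def cellVar (i p s : ℕ) : ℕ := Nat.pair 1 (Nat.pair i (Nat.pair p s))

section Bounds

variable {i p q s W : ℕ}

theorem pair_lt_pow {a b k : ℕ} (ha : a < W ^ k) (hb : b < W ^ k) :
    Nat.pair a b < W ^ (2 * k) := by
  refine (Nat.pair_lt_max_add_one_sq a b).trans_le ?_
  rw [mul_comm, pow_mul]
  exact Nat.pow_le_pow_left (by omega) 2

theorem stateVar_lt (hi : i < W) (hq : q < W) : stateVar i q < W ^ 8 := by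
  have hW : 0 < W := by omega
  have h : Nat.pair i q < W ^ (2 * 1) := pair_lt_pow (by simpa) (by simpa)
  exact (pair_lt_pow (Nat.pow_pos hW) h).trans_le (Nat.pow_le_pow_right hW (by omega))

theorem cellVar_lt (hW : 1 < W) (hi : i < W) (hp : p < W) (hs : s < W) :
    cellVar i p s < W ^ 8 := by
  have h₂ : Nat.pair p s < W ^ (2 * 1) := pair_lt_pow (by simpa) (by simpa)
  have h₄ : Nat.pair i (Nat.pair p s) < W ^ (2 * (2 * 1)) :=
    pair_lt_pow (hi.trans_le (Nat.le_self_pow (by omega) W)) h₂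
  exact pair_lt_pow (hW.trans_le (Nat.le_self_pow (by omega) W)) h₄

end Bounds

/-- One step after time `i`, in which the machine does `a`, the cell `p + 1` holds the symbol `s`:
this is a condition on the tape at time `i`. -/
def HoldsAfter (t : ℕ) (μ : ℕ → Bool) (i p s : ℕ) : Option (TM0.Stmt ℕ) → Prop
  | none => μ (cellVar i (p + 1) s) = true
  | some (.move .left) => μ (cellVar i p s) = true
  | some (.move .right) => μ (cellVar i (p + 2) s) = true
  | some (.write b) => if p + 1 = t then s = b else μ (cellVar i (p + 1) s) = true

/-- The step at time `i`, from the state `q` and reading `a`, is correctly described. -/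
def ValidStep (M : TM) (D t : ℕ) (μ : ℕ → Bool) (i q a : ℕ) : Prop :=
  (∀ q' < D, μ (stateVar (i + 1) q') = true ↔ M.nextState q a = q') ∧
  ∀ p < 2 * t, ∀ s < D,
    μ (cellVar (i + 1) (p + 1) s) = true ↔ HoldsAfter t μ i p s (M.nextAct q a)

/-- All steps are correctly described. -/
def ValidSteps (M : TM) (D t : ℕ) (μ : ℕ → Bool) : Prop :=
  ∀ i < t, ∀ q < D, ∀ a < D,
    μ (stateVar i q) = true → μ (cellVar i t a) = true → ValidStep M D t μ i q a

/-- The row `i` of the tableau describes the configuration `c`, in the cells that are close enough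
to the head to matter for the result at time `t`. -/
def RowDescribes (D t : ℕ) (μ : ℕ → Bool) (i : ℕ) (c : TM0.Cfg ℕ ℕ) : Prop :=
  (∀ q < D, μ (stateVar i q) = true ↔ c.q = q) ∧
  ∀ p, i ≤ p → p + i ≤ 2 * t → ∀ s < D, μ (cellVar i p s) = true ↔ c.Tape.nth (p - t) = s

variable {M : TM} {D t : ℕ} {μ : ℕ → Bool} {i : ℕ} {c : TM0.Cfg ℕ ℕ}

theorem holdsAfter_iff {p s : ℕ} {T : Tape ℕ} {a : Option (TM0.Stmt ℕ)}
    (h : ∀ p', p ≤ p' → p' ≤ p + 2 → (μ (cellVar i p' s) = true ↔ T.nth (p' - t) = s)) :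
    HoldsAfter t μ i p s a ↔ (a.elim T (tapeApply T)).nth ((p + 1 : ℕ) - t) = s := by
  rcases a with _ | (_ | _) | b
  · exact h _ (by omega) (by omega)
  · refine (h _ le_rfl (by omega)).trans (Eq.congr_left ?_)
    refine .trans ?_ (Tape.move_left_nth ..).symm
    congr 1
    push_cast
    ring
  · refine (h _ (by omega) le_rfl).trans (Eq.congr_left ?_)
    refine .trans ?_ (Tape.move_right_nth ..).symm
    congr 1
    push_cast
    ring
  · simp only [HoldsAfter, Option.elim_some, tapeApply, Tape.write_nth]
    by_cases hp : p + 1 = t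
    · rw [if_pos hp, if_pos (by omega)]
      exact eq_comm
    · rw [if_neg hp, if_neg (by omega)]
      exact h _ (by omega) (by omega)

theorem RowDescribes.succ (h : RowDescribes D t μ i c) (hc : TM.CfgBounded D c) (hi : i < t)
    (hsteps : ValidSteps M D t μ) : RowDescribes D t μ (i + 1) (M.next c) := by
  have hnth : c.Tape.nth ((t : ℤ) - t) = c.Tape.head := by rw [sub_self, Tape.nth_zero]
  have hhead : c.Tape.head < D := hnth ▸ hc.2 _
  obtain ⟨hstate, hcell⟩ := hsteps i hi c.q hc.1 c.Tape.head hhead ((h.1 _ hc.1).2 rfl)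
    ((h.2 t (by omega) (by omega) _ hhead).2 hnth)
  refine ⟨fun q hq => by rw [M.next_q]; exact hstate q hq, fun p hp hp' s hs => ?_⟩
  obtain ⟨p, rfl⟩ : ∃ k, p = k + 1 := ⟨p - 1, by omega⟩
  rw [hcell p (by omega) s hs, M.next_tape]
  exact holdsAfter_iff fun p' _ _ => h.2 p' (by omega) (by omega) s hs

theorem RowDescribes.iterate (h : RowDescribes D t μ 0 c) (hc : TM.CfgBounded D c)
    (hM : M.BoundedBy D) (hsteps : ValidSteps M D t μ) (hi : i ≤ t) :
    RowDescribes D t μ i (M.next^[i] c) := by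
  induction i with
  | zero => exact h
  | succ i ih =>
    rw [Function.iterate_succ_apply']
    exact (ih (by omega)).succ (hM.iterate_next hc i) (by omega) hsteps

/-- The tableau of the computation of `M` from the configuration `c`. -/
def assignment (M : TM) (t : ℕ) (c : TM0.Cfg ℕ ℕ) (k : ℕ) : Bool :=
  let x := k.unpair
  let y := x.2.unpair
  if x.1 = 0 then decide ((M.next^[y.1] c).q = y.2)
  else decide ((M.next^[y.1] c).Tape.nth ((y.2.unpair.1 : ℤ) - t) = y.2.unpair.2)

theorem assignment_stateVar (i q : ℕ) :
    assignment M t c (stateVar i q) = true ↔ (M.next^[i] c).q = q := by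
  simp [assignment, stateVar]

theorem assignment_cellVar (i p s : ℕ) :
    assignment M t c (cellVar i p s) = true ↔ (M.next^[i] c).Tape.nth (p - t) = s := by
  simp [assignment, cellVar]

theorem validSteps_assignment : ValidSteps M D t (assignment M t c) := by
  intro i _ q _ a _ hq ha
  rw [assignment_stateVar] at hq
  rw [assignment_cellVar, sub_self, Tape.nth_zero] at ha
  subst hq ha
  refine ⟨fun q' _ => ?_, fun p _ s _ => ?_⟩
  · rw [assignment_stateVar, Function.iterate_succ_apply', M.next_q]
  · rw [assignment_cellVar, Function.iterate_succ_apply', M.next_tape]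
    exact (holdsAfter_iff fun p' _ _ => assignment_cellVar i p' s).symm

/-! ### Accepting tableaux -/

/-- At the beginning, the cell `p` holds the symbol `b`. -/
def InitCell (D : ℕ) (μ : ℕ → Bool) (p b : ℕ) : Prop :=
  ∀ s < D, μ (cellVar 0 p s) = true ↔ b = s

/-- At the beginning, the cell `p` holds a bit. -/
def BitCell (D : ℕ) (μ : ℕ → Bool) (p : ℕ) : Prop :=
  InitCell D μ p (bitSym (μ (cellVar 0 p 2)))

/-- At the beginning, the cell `t + j` holds what is to be expected for an input consisting of `n`
bits, a separator and `k` bits. -/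
def InputCell (D t n k : ℕ) (μ : ℕ → Bool) (j : ℕ) : Prop :=
  if j = n then InitCell D μ (t + j) sepSym
  else if j < n + 1 + k then BitCell D μ (t + j) else InitCell D μ (t + j) 0

/-- The tableau describes a computation on an input consisting of `n` bits, a separator and at most
`k` bits, and the computation has the result `1`. -/
def Accepting (M : TM) (D t n k : ℕ) (μ : ℕ → Bool) : Prop :=
  ValidSteps M D t μ ∧ μ (cellVar t t 2) = true ∧
    (∀ q < D, μ (stateVar 0 q) = true ↔ 0 = q) ∧ (∀ p < t, InitCell D μ p 0) ∧
    ∃ l < k + 1, ∀ j < t + 1, InputCell D t n l μ j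

theorem word_append_sepSym_getD (x c : List Bool) (j : ℕ) :
    (word x ++ sepSym :: word c).getD j 0 = if j = x.length then sepSym
      else if j < x.length + 1 + c.length then bitSym ((x ++ false :: c).getD j false) else 0 := by
  have hlen : (word x).length = x.length := List.length_map _
  rcases lt_trichotomy j x.length with h | rfl | h
  · rw [if_neg h.ne, if_pos (by omega), List.getD_append _ _ _ _ (by omega),
      List.getD_append _ _ _ _ h]
    simp [word, h]
  · rw [if_pos rfl, List.getD_append_right _ _ _ _ hlen.le, hlen, Nat.sub_self]
    rfl
  · obtain ⟨i, rfl⟩ : ∃ i, j = x.length + (i + 1) := ⟨j - x.length - 1, by omega⟩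
    rw [if_neg (by omega), List.getD_append_right _ _ _ _ (by omega),
      List.getD_append_right _ _ _ _ (by omega), hlen, Nat.add_sub_cancel_left]
    simp only [List.getD_cons_succ]
    by_cases hi : i < c.length
    · rw [if_pos (by omega)]
      simp [word, hi]
    · rw [if_neg (by omega)]
      exact List.getD_eq_default _ _ (by simpa [word] using hi)

theorem cfgBounded_init (hD : 4 ≤ D) (x c : List Bool) :
    TM.CfgBounded D (TM0.init (word x ++ sepSym :: word c)) := by
  refine ⟨show 0 < D by omega, fun j => ?_⟩
  rw [TM0.init]
  rcases lt_or_ge j 0 with hj | hj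
  · rw [nth_mk₁_of_neg _ hj]
    omega
  · lift j to ℕ using hj
    have hbit : ∀ b, bitSym b < 4 := by decide
    have := hbit ((x ++ false :: c).getD j false)
    rw [nth_mk₁_natCast, word_append_sepSym_getD, sepSym]
    split_ifs <;> omega

theorem InitCell.bit {p : ℕ} {b : Bool} (h : InitCell D μ p (bitSym b)) (hD : 4 ≤ D) :
    μ (cellVar 0 p 2) = b := by
  rw [Bool.eq_iff_iff, h 2 (by omega)]
  cases b <;> decide

theorem inputCell_iff {x b : List Bool} {j : ℕ}
    (hbits : j ≠ x.length → j < x.length + 1 + b.length →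
      μ (cellVar 0 (t + j) 2) = (x ++ false :: b).getD j false) :
    InputCell D t x.length b.length μ j ↔
      InitCell D μ (t + j) ((word x ++ sepSym :: word b).getD j 0) := by
  rw [InputCell, word_append_sepSym_getD]
  split_ifs with hj hj'
  · rfl
  · rw [BitCell, hbits hj hj']
  · rfl

theorem rowDescribes_init {w : List ℕ} (hstate : ∀ q < D, μ (stateVar 0 q) = true ↔ 0 = q)
    (hleft : ∀ p < t, InitCell D μ p 0) (hright : ∀ j < t + 1, InitCell D μ (t + j) (w.getD j 0)) :
    RowDescribes D t μ 0 (TM0.init w) := by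
  refine ⟨hstate, fun p _ hp s hs => ?_⟩
  rw [TM0.init]
  rcases Nat.lt_or_ge p t with hpt | hpt
  · rw [nth_mk₁_of_neg _ (by omega)]
    exact hleft p hpt s hs
  · obtain ⟨j, rfl⟩ := Nat.exists_eq_add_of_le hpt
    rw [Nat.cast_add, add_sub_cancel_left, nth_mk₁_natCast]
    exact hright j (by omega) s hs

theorem initCell_assignment_of_lt {w : List ℕ} {p : ℕ} (hp : p < t) :
    InitCell D (assignment M t (TM0.init w)) p 0 := by
  intro s _
  rw [assignment_cellVar, Function.iterate_zero_apply, TM0.init, nth_mk₁_of_neg _ (by omega)]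

theorem initCell_assignment_add (w : List ℕ) (j : ℕ) :
    InitCell D (assignment M t (TM0.init w)) (t + j) (w.getD j 0) := by
  intro s _
  rw [assignment_cellVar, Function.iterate_zero_apply, TM0.init, Nat.cast_add,
    add_sub_cancel_left, nth_mk₁_natCast]

theorem assignment_input_bit (hD : 4 ≤ D) (x c : List Bool) {j : ℕ} (hj : j ≠ x.length)
    (hj' : j < x.length + 1 + c.length) :
    assignment M t (TM0.init (word x ++ sepSym :: word c)) (cellVar 0 (t + j) 2) =
      (x ++ false :: c).getD j false := by
  have h := initCell_assignment_add (M := M) (D := D) (t := t) (word x ++ sepSym :: word c) j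
  rw [word_append_sepSym_getD, if_neg hj, if_pos hj'] at h
  exact h.bit hD

section Answers

variable {k : ℕ} {x : List Bool} {R : List Bool → Prop}

theorem Accepting.exists_certificate (h : Accepting M D t x.length k μ) (hM : M.BoundedBy D)
    (hR : ∀ c, c.length ≤ k → M.Answers (word x ++ sepSym :: word c) (R c) t)
    (hx : ∀ j < x.length, μ (cellVar 0 (t + j) 2) = x.getD j false) :
    ∃ c, c.length ≤ k ∧ R c := by
  obtain ⟨hsteps, hresult, hstate, hleft, l, hl, hinput⟩ := h
  obtain ⟨c, rfl, hc⟩ : ∃ c : List Bool, c.length = l ∧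
      ∀ i < l, μ (cellVar 0 (t + (x.length + (i + 1))) 2) = c.getD i false :=
    ⟨(List.range l).map fun i => μ (cellVar 0 (t + (x.length + (i + 1))) 2), by simp,
      fun i hi => by simp [hi]⟩
  have hbits (j : ℕ) (hj : j ≠ x.length) (hj' : j < x.length + 1 + c.length) :
      μ (cellVar 0 (t + j) 2) = (x ++ false :: c).getD j false := by
    rcases hj.lt_or_gt with hlt | hgt
    · rw [hx j hlt, List.getD_append _ _ _ _ hlt]
    · obtain ⟨i, rfl⟩ : ∃ i, j = x.length + (i + 1) := ⟨j - x.length - 1, by omega⟩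
      rw [List.getD_append_right _ _ _ _ (by omega), Nat.add_sub_cancel_left, List.getD_cons_succ,
        hc i (by omega)]
  have hrow : RowDescribes D t μ 0 (TM0.init (word x ++ sepSym :: word c)) :=
    rowDescribes_init hstate hleft fun j hj => (inputCell_iff (hbits j)).1 (hinput j hj)
  have hfinal := (hrow.iterate (cfgBounded_init hM.1 x c) hM hsteps le_rfl).2 t le_rfl (by omega)
  have hD := hM.1
  refine ⟨c, by omega, (hR c (by omega)).iterate_next_head.1 ?_⟩
  rw [← Tape.nth_zero, ← sub_self (t : ℤ)]
  exact (hfinal 2 (by omega)).1 hresult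

theorem accepting_assignment {c : List Bool} (hD : 4 ≤ D) (hc : c.length ≤ k)
    (hanswers : M.Answers (word x ++ sepSym :: word c) (R c) t) (hRc : R c) :
    Accepting M D t x.length k
      (assignment M t (TM0.init (word x ++ sepSym :: word c))) := by
  refine ⟨validSteps_assignment, ?_, fun q _ => assignment_stateVar 0 q,
    fun p hp => initCell_assignment_of_lt hp, c.length, by omega, fun j _ => ?_⟩
  · rw [assignment_cellVar, sub_self, Tape.nth_zero]
    exact hanswers.iterate_next_head.2 hRc
  · exact (inputCell_iff (assignment_input_bit hD x c)).2 (initCell_assignment_add _ j)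

theorem exists_accepting_iff (hM : M.BoundedBy D)
    (hR : ∀ c, c.length ≤ k → M.Answers (word x ++ sepSym :: word c) (R c) t) :
    (∃ μ, Accepting M D t x.length k μ ∧
      ∀ j < x.length, μ (cellVar 0 (t + j) 2) = x.getD j false) ↔
      ∃ c, c.length ≤ k ∧ R c := by
  constructor
  · rintro ⟨μ, hμ, hx⟩
    exact hμ.exists_certificate hM hR hx
  · rintro ⟨c, hc, hRc⟩
    refine ⟨_, accepting_assignment hM.1 hc (hR c hc) hRc, fun j hj => ?_⟩
    rw [assignment_input_bit hM.1 x c hj.ne (by omega), List.getD_append _ _ _ _ hj]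

end Answers

/-! ### Accepting tableaux are expressible -/

section Expressible

variable {N W n k p s : ℕ}

theorem expressible_stateVar {q : ℕ} (hN : N = W ^ 8 + 2) (hi : i < W) (hq : q < W) :
    Expressible N (N + 3) fun μ => μ (stateVar i q) = true :=
  .lit (by have := stateVar_lt hi hq; omega)

theorem expressible_cellVar (hN : N = W ^ 8 + 2) (hW : 1 < W) (hi : i < W) (hp : p < W)
    (hs : s < W) : Expressible N (N + 3) fun μ => μ (cellVar i p s) = true :=
  .lit (by have := cellVar_lt hW hi hp hs; omega)

theorem expressible_initCell {b : ℕ} (hN : N = W ^ 8 + 2) (hW : 1 < W) (hp : p < W) (hD : D ≤ W) :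
    Expressible N (D * (6 * N + 100) + 10) fun μ => InitCell D μ p b :=
  .forall_lt (by omega) D fun s hs => ((expressible_cellVar hN hW (by omega) hp (by omega)).iff
    (.const (by omega) (b = s))).mono (by omega)

theorem expressible_bitCell (hN : N = W ^ 8 + 2) (hW : 2 < W) (hp : p < W) (hD : D ≤ W) :
    Expressible N (D * (6 * N + 100) + 10) fun μ => BitCell D μ p := by
  have hbit := expressible_cellVar (i := 0) (s := 2) hN (by omega) (by omega) hp hW
  have hsym (s : ℕ) : Expressible N (2 * N + 40) fun μ => bitSym (μ (cellVar 0 p 2)) = s :=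
    ((hbit.and (.const (by omega) (2 = s))).or (hbit.not.and (.const (by omega) (1 = s)))).congr
      (fun μ => by cases μ (cellVar 0 p 2) <;> simp [bitSym]) (by omega)
  exact .forall_lt (by omega) D fun s hs =>
    ((expressible_cellVar hN (by omega) (by omega) hp (by omega)).iff (hsym s)).mono (by omega)

theorem expressible_inputCell {j : ℕ} (hN : N = W ^ 8 + 2) (hW : 2 < W) (hp : t + j < W)
    (hD : D ≤ W) : Expressible N (D * (6 * N + 100) + 10) fun μ => InputCell D t n k μ j := by
  unfold InputCell
  split_ifs
  · exact expressible_initCell hN (by omega) hp hD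
  · exact expressible_bitCell hN hW hp hD
  · exact expressible_initCell hN (by omega) hp hD

theorem expressible_holdsAfter {a : Option (TM0.Stmt ℕ)} (hN : N = W ^ 8 + 2) (hW : 8 ≤ W)
    (hi : i < W) (hp : p + 2 < W) (hs : s < W) :
    Expressible N (N + 3) fun μ => HoldsAfter t μ i p s a := by
  have hcell {p' : ℕ} (hp' : p' ≤ p + 2) :
      Expressible N (N + 3) fun μ => μ (cellVar i p' s) = true :=
    expressible_cellVar hN (by omega) hi (by omega) hs
  have h8 : 8 ≤ W ^ 8 := hW.trans (Nat.le_self_pow (by omega) W)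
  rcases a with _ | (_ | _) | b <;> simp only [HoldsAfter]
  · exact hcell (by omega)
  · exact hcell (by omega)
  · exact hcell le_rfl
  · split_ifs
    · exact (Expressible.const (by omega) _).mono (by omega)
    · exact hcell (by omega)

theorem expressible_validStep (M : TM) {q a : ℕ} (hN : N = W ^ 8 + 2) (hW : 8 ≤ W) (hD : D ≤ W)
    (hi : i + 1 < W) (ht : 2 * t + 2 < W) :
    Expressible N (D * (2 * N + 40) + 2 * t * (D * (4 * N + 30) + 12) + 22) fun μ =>
      ValidStep M D t μ i q a := by
  have hN0 : 0 < N := by omega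
  refine ((Expressible.forall_lt hN0 D (B := 2 * N + 38) fun q' hq' => ?_).and
    (.forall_lt hN0 (2 * t) fun p hp =>
      .forall_lt hN0 D (B := 4 * N + 28) fun s hs => ?_)).mono (by grind)
  · exact ((expressible_stateVar hN hi (by omega)).iff (.const hN0 _)).mono (by omega)
  · exact ((expressible_cellVar hN (by omega) hi (by omega) (by omega)).iff
      (expressible_holdsAfter hN hW (by omega) (by omega) (by omega))).mono (by omega)

/-- The length of a formula expressing `ValidSteps`. -/
def validStepsBound (D t N : ℕ) : ℕ :=
  t * (D * (D * (D * (2 * N + 40) + 2 * t * (D * (4 * N + 30) + 12) + 2 * N + 40) + 12) + 12) + 10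

theorem expressible_validSteps (M : TM) (hN : N = W ^ 8 + 2) (hW : 8 ≤ W) (hD : D ≤ W)
    (ht : 2 * t + 2 < W) : Expressible N (validStepsBound D t N) fun μ => ValidSteps M D t μ := by
  have hN0 : 0 < N := by omega
  refine .forall_lt hN0 t fun i hi => .forall_lt hN0 D fun q hq => .forall_lt hN0 D fun a ha =>
    ((expressible_stateVar hN ?_ ?_).imp ((expressible_cellVar hN ?_ ?_ ?_ ?_).imp
      (expressible_validStep M hN hW hD ?_ ht))).mono ?_
  all_goals omega

/-- The length of a formula expressing `Accepting`. -/
def acceptingBound (D t k N : ℕ) : ℕ :=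
  validStepsBound D t N + (k + 1) * ((t + 1) * (D * (6 * N + 100) + 12) + 12) +
    t * (D * (6 * N + 100) + 12) + D * (6 * N + 100) + N + 100

theorem expressible_accepting (M : TM) (hN : N = W ^ 8 + 2) (hW : 8 ≤ W) (hD : D ≤ W)
    (ht : 2 * t + 2 < W) :
    Expressible N (acceptingBound D t k N) fun μ => Accepting M D t n k μ := by
  have hN0 : 0 < N := by omega
  have hstate : Expressible N (D * (6 * N + 100) + 10) fun μ =>
      ∀ q < D, μ (stateVar 0 q) = true ↔ 0 = q := .forall_lt hN0 D fun q hq =>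
    ((expressible_stateVar hN (by omega) (by omega)).iff (.const hN0 _)).mono (by omega)
  refine ((expressible_validSteps M hN hW hD ht).and
    ((expressible_cellVar hN (by omega) (by omega) (by omega) (by omega)).and
    (hstate.and
    ((Expressible.forall_lt hN0 t fun p hp =>
      expressible_initCell hN (by omega) (by omega) hD).and
    (.exists_lt hN0 (k + 1) fun l _ => .forall_lt hN0 (t + 1) fun j hj =>
      expressible_inputCell hN (by omega) (by omega) hD))))).mono ?_
  simp only [acceptingBound, Nat.add_assoc, Nat.reduceAdd]
  omega

end Expressible

end Tableau

/-! ### The length of outputs -/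

namespace TM

variable {M : TM}

theorem Steps.exists_support {c c' : TM0.Cfg ℕ ℕ} {n : ℕ} (h : M.Steps c n c') {F : Finset ℤ}
    (hF : ∀ j ∉ F, c.Tape.nth j = 0) :
    ∃ F' : Finset ℤ, F'.card ≤ F.card + n ∧ ∀ j ∉ F', c'.Tape.nth j = 0 := by
  induction n generalizing c F with
  | zero => exact ⟨F, le_rfl, steps_zero.1 h ▸ hF⟩
  | succ n ih =>
    obtain ⟨d, hstep, hsteps⟩ := steps_succ.1 h
    obtain ⟨F₁, hcard, hF₁⟩ : ∃ F₁ : Finset ℤ, F₁.card ≤ F.card + 1 ∧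
        ∀ j ∉ F₁, d.Tape.nth j = 0 := by
      obtain ⟨a, -, htape⟩ := exists_of_step_eq_some hstep
      rw [htape]
      rcases a with (_ | _) | b
      · refine ⟨F.image (· + 1), Finset.card_image_le.trans (by omega), fun j hj => ?_⟩
        refine (Tape.move_left_nth ..).trans (hF _ fun h => hj ?_)
        exact Finset.mem_image.2 ⟨_, h, by omega⟩
      · refine ⟨F.image (· - 1), Finset.card_image_le.trans (by omega), fun j hj => ?_⟩
        refine (Tape.move_right_nth ..).trans (hF _ fun h => hj ?_)
        exact Finset.mem_image.2 ⟨_, h, by omega⟩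
      · refine ⟨insert 0 F, Finset.card_insert_le _ _, fun j hj => ?_⟩
        rw [Finset.mem_insert, not_or] at hj
        exact (Tape.write_nth ..).trans ((if_neg hj.1).trans (hF j hj.2))
    obtain ⟨F', hcard', hF'⟩ := ih hsteps hF₁
    exact ⟨F', by omega, hF'⟩

theorem Outputs.length_le {w v : List ℕ} {t : ℕ} (h : M.Outputs w v t) (hv : 0 ∉ v) :
    v.length ≤ w.length + t := by
  have card_cells (k : ℕ) : ((Finset.range k).image (Nat.cast : ℕ → ℤ)).card = k := by
    rw [Finset.card_image_of_injective _ Nat.cast_injective, Finset.card_range]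
  obtain ⟨n, hn, q, hsteps, -⟩ := outputs_iff.1 h
  obtain ⟨F, hcard, hF⟩ :=
    hsteps.exists_support (F := (Finset.range w.length).image Nat.cast) fun j hj => by
      rcases lt_or_ge j 0 with hneg | hnonneg
      · exact nth_mk₁_of_neg w hneg
      · lift j to ℕ using hnonneg
        have hj' : w.length ≤ j := not_lt.1 fun h => hj (Finset.mem_image.2 ⟨j, by simpa, rfl⟩)
        exact (nth_mk₁_natCast w j).trans (List.getD_eq_default _ _ hj')
  have cells_subset : (Finset.range v.length).image (Nat.cast : ℕ → ℤ) ⊆ F := by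
    intro j hj
    obtain ⟨i, hi, rfl⟩ := Finset.mem_image.1 hj
    rw [Finset.mem_range] at hi
    by_contra hiF
    have hblank := (nth_mk₁_natCast v i).symm.trans (hF _ hiF)
    rw [List.getD_eq_getElem _ _ hi] at hblank
    exact hv (hblank ▸ List.getElem_mem hi)
  have := Finset.card_le_card cells_subset
  rw [card_cells] at this hcard
  omega

end TM

theorem zero_notMem_word (x : List Bool) : 0 ∉ word x := by simp [word, bitSym]

theorem zero_notMem_fracWord (a b : ℕ) : 0 ∉ fracWord a b := by
  simp [fracWord, zero_notMem_word, sepSym]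

/-! ### The length of descriptions -/

theorem length_unary (n : ℕ) : (unary n).length = n + 1 := by simp [unary]

theorem length_actCode_le {a : TM0.Stmt ℕ} {m : ℕ} (h : ∀ b, a = .write b → b < m) :
    (actCode a).length ≤ m + 2 := by
  rcases a with (_ | _) | b
  · simp [actCode]
  · simp [actCode]
  · have := h b rfl
    simp only [actCode, List.length_cons, length_unary]
    omega

namespace TM

/-- The length of the description of a machine, without the final zero. -/
def codeSum (M : TM) : ℕ := (M.map fun r => r.code.length + 1).sum

theorem length_code (M : TM) : M.code.length = M.codeSum + 1 := by
  induction M with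
  | nil => rfl
  | cons r M ih =>
    simp only [code, List.length_cons, List.length_append, ih, codeSum, List.map_cons,
      List.sum_cons]
    omega

theorem codeSum_append (A B : TM) : (A ++ B : TM).codeSum = A.codeSum + B.codeSum := by
  simp [codeSum]

theorem stateBound_le_length_code (M : TM) : M.stateBound ≤ M.code.length := by
  rw [length_code, stateBound, codeSum]
  refine Nat.succ_le_succ (List.sum_le_sum fun r _ => ?_)
  simp only [Quadruple.code, List.length_append, length_unary]
  omega

theorem codeSum_shift_le (e : ℕ) (M : TM) : (M.shift e).codeSum ≤ M.codeSum * (2 * e + 1) := by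
  induction M with
  | nil => exact Nat.zero_le _
  | cons r M ih =>
    simp only [shift, codeSum, List.map_cons, List.sum_cons, Quadruple.code,
      List.length_append, length_unary] at ih ⊢
    nlinarith

theorem codeSum_table_le {m Y : ℕ} {states : List ℕ} {g : ℕ → ℕ × TM0.Stmt ℕ}
    (hs : ∀ s ∈ states, s ≤ Y) (hg : ∀ a < m, (g a).1 ≤ Y ∧ ∀ b, (g a).2 = .write b → b < m) :
    (table m states g).codeSum ≤ states.length * (m * (2 * Y + 2 * m + 6)) := by
  have length_le : ∀ r ∈ table m states g, r.code.length + 1 ≤ 2 * Y + 2 * m + 6 := by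
    intro r hr
    obtain ⟨hstate, hread, hact⟩ := mem_table.1 hr
    obtain ⟨hnext, hwrite⟩ := hg _ hread
    simp only [hact] at hnext hwrite
    have := hs _ hstate
    have := length_actCode_le hwrite
    simp only [Quadruple.code, List.length_append, length_unary]
    omega
  have length_table : (table m states g).length = states.length * m := by simp [table]
  have := List.sum_le_card_nsmul ((table m states g).map fun r => r.code.length + 1)
    (2 * Y + 2 * m + 6) (by simpa using length_le)
  rwa [List.length_map, length_table, smul_eq_mul, mul_assoc] at this

theorem codeSum_table_write_le {m Y : ℕ} {states : List ℕ} {f : ℕ → ℕ}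
    (hs : ∀ s ∈ states, s ≤ Y) (hf : ∀ a, f a ≤ Y) :
    (table m states fun a => (f a, .write a)).codeSum ≤
      states.length * (m * (2 * Y + 2 * m + 6)) :=
  codeSum_table_le hs fun a ha => ⟨hf a, by rintro _ ⟨⟩; exact ha⟩

end TM

namespace Prog

/-- A measure for the length of the description of a compiled program. -/
def weight : Prog → ℕ
  | .act _ => 1
  | .seq p q => p.weight + q.weight
  | .ite _ p q => 1 + (p.weight + q.weight)
  | .loop _ p => 1 + p.weight
  | .call M => 2 * M.code.length

theorem size_le_weight (p : Prog) : p.size ≤ p.weight := by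
  induction p with
  | call M =>
    have := M.stateBound_le_length_code
    simp only [size, weight]
    omega
  | _ => simp only [size, weight]; omega

/-- The program itself, without the machines it calls, only writes symbols below `m`. -/
def WritesBelow (m : ℕ) : Prog → Prop
  | .act g => ∀ a < m, ∀ b, g a = .write b → b < m
  | .seq p q => p.WritesBelow m ∧ q.WritesBelow m
  | .ite _ p q => p.WritesBelow m ∧ q.WritesBelow m
  | .loop _ p => p.WritesBelow m
  | .call _ => True

variable {m : ℕ}

theorem codeSum_compile_call_le {M : TM} {e x Y : ℕ} (he : e + M.stateBound ≤ Y) (hx : x ≤ Y) :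
    ((call M).compile m e x).codeSum ≤
      (call M).weight * ((m + 1) * (2 * Y + 2 * m + 6)) := by
  have shift_le : (M.shift e).codeSum ≤ M.code.length * ((m + 1) * (2 * Y + 2 * m + 6)) := by
    refine (TM.codeSum_shift_le e M).trans (Nat.mul_le_mul (by rw [TM.length_code]; omega) ?_)
    exact le_mul_of_one_le_of_le (by omega) (by omega)
  have table_le := TM.codeSum_table_write_le (m := m) (states := List.range' e M.stateBound)
    (f := fun _ => x) (fun s hs => by rw [List.mem_range'_1] at hs; omega) fun _ => hx
  rw [List.length_range'] at table_le
  rw [compile, TM.codeSum_append, weight, two_mul, Nat.add_mul]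
  exact Nat.add_le_add shift_le (table_le.trans (Nat.mul_le_mul M.stateBound_le_length_code
    (Nat.mul_le_mul_right _ (by omega))))

theorem codeSum_compile_le {p : Prog} (hp : p.WritesBelow m) {e x Y : ℕ} (he : e + p.size ≤ Y)
    (hx : x ≤ Y) : (p.compile m e x).codeSum ≤ p.weight * ((m + 1) * (2 * Y + 2 * m + 6)) := by
  have unit_le : [e].length * (m * (2 * Y + 2 * m + 6)) ≤ 1 * ((m + 1) * (2 * Y + 2 * m + 6)) :=
    Nat.mul_le_mul_left _ (Nat.mul_le_mul_right _ (by omega))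
  induction p generalizing e x with
  | act g =>
    exact (TM.codeSum_table_le (by simp; omega) fun a ha => ⟨hx, hp a ha⟩).trans unit_le
  | seq p q ihp ihq =>
    rw [size] at he
    rw [compile, TM.codeSum_append, weight, Nat.add_mul]
    exact Nat.add_le_add (ihp hp.1 (by omega) (by omega) unit_le)
      (ihq hp.2 (by omega) hx unit_le)
  | ite S p q ihp ihq =>
    rw [size] at he
    rw [compile, TM.codeSum_append, TM.codeSum_append, weight, Nat.add_mul 1, Nat.add_mul p.weight]
    refine Nat.add_le_add ((TM.codeSum_table_write_le (by simp; omega) fun a => ?_).trans unit_le)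
      (Nat.add_le_add (ihp hp.1 (by omega) hx unit_le) (ihq hp.2 (by omega) hx unit_le))
    cases S a <;> simp only [cond_true, cond_false] <;> omega
  | loop S p ihp =>
    rw [size] at he
    rw [compile, TM.codeSum_append, weight, Nat.add_mul]
    refine Nat.add_le_add ((TM.codeSum_table_write_le (by simp; omega) fun a => ?_).trans unit_le)
      (ihp hp (by omega) (by omega) unit_le)
    cases S a <;> simp only [cond_true, cond_false] <;> omega
  | call M => exact codeSum_compile_call_le he hx

theorem length_code_toTM_le {p : Prog} (hp : p.WritesBelow m) :
    (p.toTM m).code.length ≤ p.weight * ((m + 1) * (2 * p.weight + 2 * m + 6)) + 1 := by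
  rw [TM.length_code]
  exact Nat.succ_le_succ
    (codeSum_compile_le hp (by simpa using p.size_le_weight) p.size_le_weight)

theorem writesBelow_skip : skip.WritesBelow m := by
  rintro a ha _ ⟨⟩
  exact ha

theorem writesBelow_move (d : Dir) : (act fun _ => .move d).WritesBelow m := by
  rintro _ _ _ ⟨⟩

theorem writesBelow_home : home.WritesBelow m :=
  ⟨writesBelow_move _, writesBelow_move _, writesBelow_move _⟩

theorem writesBelow_switch {α : Type*} [DecidableEq α] {key : ℕ → Option α} {f : α → Prog}
    (hf : ∀ a, (f a).WritesBelow m) (l : List α) : (switch key f l).WritesBelow m := by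
  induction l with
  | nil => exact writesBelow_skip
  | cons a l ih => exact ⟨hf a, ih⟩

theorem writesBelow_setTrack {K s : ℕ} (k : Fin K) (o : Option (Fin s)) :
    (act fun c => .write (setTrack k o c)).WritesBelow ((s + 1) ^ K) := by
  rintro _ _ _ ⟨⟩
  exact columnSym_lt _

end Prog

theorem Cmd.writesBelow_toProg {K s : ℕ} (c : Cmd K s) :
    c.toProg.WritesBelow ((s + 1) ^ K) := by
  induction c with
  | skip => exact Prog.writesBelow_skip
  | push k a =>
    exact ⟨Prog.writesBelow_move _, Prog.writesBelow_setTrack k _, Prog.writesBelow_home⟩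
  | pop k f ih =>
    refine ⟨⟨Prog.writesBelow_move _, Prog.writesBelow_move _, ?_⟩, ih none⟩
    refine Prog.writesBelow_switch (fun a => ?_) _
    exact ⟨Prog.writesBelow_setTrack k _, Prog.writesBelow_home, ih _⟩
  | seq c d ihc ihd => exact ⟨ihc, ihd⟩
  | loop _ _ ih => exact ih

/-! ### Formulas asking for an accepting tableau -/

theorem forall_lt_length_cons {α : Type*} {p : ℕ → Prop} {j : ℕ} {b : α} {x : List α} :
    (∀ i < (b :: x).length, p (j + i)) ↔ p j ∧ ∀ i < x.length, p (j + 1 + i) := by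
  rw [List.length_cons, Nat.forall_lt_succ_left, Nat.add_zero]
  simp only [Nat.add_assoc, Nat.add_comm 1]

namespace Formula

/-- The formula stating that the variable `i` has the value `b`. -/
def lit (i : ℕ) (b : Bool) : Formula := cond b (.var i) (.neg (.var i))

theorem eval_lit (i : ℕ) (b : Bool) (ν : ℕ → Bool) : (lit i b).eval ν = true ↔ ν i = b := by
  cases b <;> simp [lit, eval]

theorem vars_lit (i : ℕ) (b : Bool) : (lit i b).vars = {i} := by
  cases b <;> rfl

theorem length_enc_lit_le (i : ℕ) (b : Bool) : (lit i b).enc.length ≤ i + 5 := by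
  cases b <;> simp [lit, enc, unary]

/-- A true formula mentioning the first `max 1 k` variables. -/
def mentionAll : ℕ → Formula
  | 0 => .or (.var 0) (.neg (.var 0))
  | k + 1 => .and (mentionAll k) (.or (.var k) (.neg (.var k)))

theorem eval_mentionAll (k : ℕ) (ν : ℕ → Bool) : (mentionAll k).eval ν = true := by
  induction k with
  | zero => simp [mentionAll, eval]
  | succ k ih => simp [mentionAll, eval, ih]

theorem vars_mentionAll (k : ℕ) : (mentionAll k).vars = insert 0 (Finset.range k) := by
  induction k with
  | zero => rfl
  | succ k ih =>
    ext i
    simp only [mentionAll, vars, ih, Finset.mem_union, Finset.mem_insert, Finset.mem_range,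
      Finset.mem_singleton]
    omega

theorem length_enc_mentionAll_le {k N : ℕ} (hk : k ≤ N) :
    (mentionAll k).enc.length ≤ k * (2 * N + 12) + 10 := by
  induction k with
  | zero => simp [mentionAll, enc, unary]
  | succ k ih =>
    have := ih (by omega)
    simp only [mentionAll, enc, List.length_append, List.length_cons, List.length_nil,
      length_unary]
    rw [Nat.add_mul]
    omega

/-- The formula `ρ` with the values `x` of the variables `w j + 1, w (j + 1) + 1, …` prescribed. -/
def fixVars (w : ℕ → ℕ) (ρ : Formula) : ℕ → List Bool → Formula
  | _, [] => ρ
  | j, b :: x => .and (lit (w j + 1) b) (fixVars w ρ (j + 1) x)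

/-- The part of the code of `fixVars w ρ j x` that precedes the code of `ρ`. -/
def fixCode (w : ℕ → ℕ) : ℕ → List Bool → List Bool
  | _, [] => []
  | j, b :: x => [true, false] ++ (lit (w j + 1) b).enc ++ fixCode w (j + 1) x

variable {w : ℕ → ℕ} {ρ : Formula} {N : ℕ} {x : List Bool}

theorem enc_fixVars (j : ℕ) (x : List Bool) :
    (fixVars w ρ j x).enc = fixCode w j x ++ ρ.enc := by
  induction x generalizing j with
  | nil => rfl
  | cons b x ih => simp [fixVars, fixCode, enc, ih]

theorem length_fixCode_le (j : ℕ) (x : List Bool) (hw : ∀ i < x.length, w (j + i) + 1 < N) :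
    (fixCode w j x).length ≤ x.length * (N + 8) := by
  induction x generalizing j with
  | nil => exact Nat.zero_le _
  | cons b x ih =>
    obtain ⟨hb, hx⟩ := (forall_lt_length_cons (p := fun i => w i + 1 < N)).1 hw
    have := ih (j + 1) hx
    have := length_enc_lit_le (w j + 1) b
    simp only [fixCode, List.length_append, List.length_cons, List.length_nil]
    rw [Nat.add_mul x.length]
    omega

theorem eval_fixVars (j : ℕ) (x : List Bool) (ν : ℕ → Bool) :
    (fixVars w ρ j x).eval ν = true ↔
      (∀ i < x.length, ν (w (j + i) + 1) = x.getD i false) ∧ ρ.eval ν = true := by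
  induction x generalizing j with
  | nil => simp [fixVars]
  | cons b x ih =>
    rw [fixVars, eval, Bool.and_eq_true, eval_lit, ih, List.length_cons, Nat.forall_lt_succ_left,
      and_assoc]
    simp only [Nat.add_zero, List.getD_cons_zero, List.getD_cons_succ, Nat.add_assoc,
      Nat.add_comm 1]

theorem mem_vars_fixVars {j i : ℕ} :
    i ∈ (fixVars w ρ j x).vars ↔ (∃ l < x.length, i = w (j + l) + 1) ∨ i ∈ ρ.vars := by
  induction x generalizing j with
  | nil => simp [fixVars]
  | cons b x ih =>
    rw [fixVars, vars, vars_lit, Finset.mem_union, Finset.mem_singleton, ih, List.length_cons,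
      Nat.exists_lt_succ_left, or_assoc]
    simp only [Nat.add_zero, Nat.add_assoc, Nat.add_comm 1]

/-- The formula that is true if `A_1` is, or else if `ρ` is and the variables `w 0 + 1, w 1 + 1, …`
have the values `x`; it mentions the first `N` variables. -/
def query (w : ℕ → ℕ) (ρ : Formula) (N : ℕ) (x : List Bool) : Formula :=
  .or (.var 0) (fixVars w (.and ρ (mentionAll N)) 0 x)

theorem length_enc_query_le (hw : ∀ j < x.length, w j + 1 < N) :
    (query w ρ N x).enc.length ≤
      x.length * (N + 8) + (Formula.and ρ (mentionAll N)).enc.length + 5 := by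
  have := length_fixCode_le (N := N) 0 x (by simpa using hw)
  simp only [query, enc, enc_fixVars, List.length_append, List.length_cons, List.length_nil,
    length_unary]
  omega

theorem vars_query (hN : 0 < N) (hw : ∀ j < x.length, w j + 1 < N) (hρ : ∀ i ∈ ρ.vars, i < N) :
    (query w ρ N x).vars = Finset.range N := by
  ext i
  simp only [query, vars, Finset.mem_union, Finset.mem_singleton, mem_vars_fixVars,
    vars_mentionAll, Finset.mem_insert, Finset.mem_range]
  constructor
  · rintro (rfl | ⟨l, hl, rfl⟩ | h | rfl | h)
    exacts [hN, by simpa using hw l hl, hρ i h, hN, h]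
  · exact fun h => .inr (.inr (.inr (.inr h)))

theorem eval_query {p : (ℕ → Bool) → Prop} (hp : ∀ ν, ρ.eval ν = true ↔ p fun k => ν (k + 1))
    (ν : ℕ → Bool) : (query w ρ N x).eval ν = true ↔ ν 0 = true ∨
      (∀ j < x.length, ν (w j + 1) = x.getD j false) ∧ p fun k => ν (k + 1) := by
  simp only [query, eval, Bool.or_eq_true, eval_fixVars, Bool.and_eq_true, hp, eval_mentionAll,
    and_true, Nat.zero_add]

theorem satisfiedBy_map_range {φ : Formula} (hφ : φ.vars = Finset.range N) {ν : ℕ → Bool}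
    (h : φ.eval ν = true) : φ.SatisfiedBy ((List.range N).map ν) := by
  refine ⟨by simp [hφ], ?_⟩
  rw [eval_congr fun i hi => ?_, h]
  rw [hφ, Finset.mem_range] at hi
  simp [List.getD, hi]

theorem exists_satisfiedBy_query (hN : 0 < N) (hw : ∀ j < x.length, w j + 1 < N)
    (hρ : ∀ i ∈ ρ.vars, i < N) : ∃ a, (query w ρ N x).SatisfiedBy a :=
  ⟨_, satisfiedBy_map_range (vars_query hN hw hρ) (ν := fun _ => true) (by simp [query, eval])⟩

theorem satsFrom_query_eq_empty_iff {p : (ℕ → Bool) → Prop} (hN : 0 < N)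
    (hw : ∀ j < x.length, w j + 1 < N) (hρ : ∀ i ∈ ρ.vars, i < N)
    (hp : ∀ ν, ρ.eval ν = true ↔ p fun k => ν (k + 1)) :
    (query w ρ N x).satsFrom [false] = ∅ ↔
      ¬ ∃ μ, p μ ∧ ∀ j < x.length, μ (w j) = x.getD j false := by
  rw [← Set.not_nonempty_iff_eq_empty, not_iff_not]
  constructor
  · rintro ⟨a, ⟨-, heval⟩, u, rfl⟩
    rcases (eval_query hp _).1 heval with h | ⟨hx, hpμ⟩
    · simp at h
    · exact ⟨_, hpμ, hx⟩
  · rintro ⟨μ, hpμ, hx⟩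
    refine ⟨(List.range N).map fun i => i.casesOn false μ,
      satisfiedBy_map_range (vars_query hN hw hρ) ((eval_query hp _).2 (.inr ⟨hx, hpμ⟩)), ?_⟩
    obtain ⟨k, rfl⟩ : ∃ k, N = k + 1 := ⟨N - 1, by omega⟩
    rw [List.range_succ_eq_map]
    exact ⟨_, rfl⟩

end Formula

/-! ### Programs for queries and answers -/

namespace SatProg

open Cmd

/-- Append a word to the output. -/
def pushWord : List Bool → Cmd 8 5
  | [] => skip
  | b :: u => push io (bsym b) ;; pushWord u

theorem run_pushWord (u : List Bool) (X Y : List (Fin 5)) :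
    Run (pushWord u) (layout X Y [] [] [] [] [] [])
      (layout ((u.map bsym).reverse ++ X) Y [] [] [] [] [] []) (u.length + 1) := by
  induction u generalizing X with
  | nil => exact Run.skip
  | cons b u ih =>
    refine (run_push_seq (t := u.length + 1)).2 ?_
    simpa using ih (bsym b :: X)

/-- Append the code of a conjunction of `A_{i+1}` or its negation with a formula still to come. -/
def pushLit (i : ℕ) (o : Option (Fin 5)) : Cmd 8 5 :=
  pushWord ([true, false] ++ (Formula.lit i (decide (o = some 1))).enc)

/-- Read `k` bits and append the code prescribing the values of some variables accordingly. -/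
def fixCmd (w : ℕ → ℕ) : ℕ → ℕ → Cmd 8 5
  | _, 0 => skip
  | j, k + 1 => pop text (pushLit (w j + 1)) ;; fixCmd w (j + 1) k

theorem run_pushLit {i N : ℕ} (hi : i < N) (b : Bool) (X Y : List (Fin 5)) :
    Run (pushLit i (some (bsym b))) (layout X Y [] [] [] [] [] [])
      (layout ((([true, false] ++ (Formula.lit i b).enc).map bsym).reverse ++ X)
        Y [] [] [] [] [] []) (N + 8) := by
  have hb : decide (some (bsym b) = some 1) = b := by cases b <;> rfl
  have := Formula.length_enc_lit_le i b
  rw [pushLit, hb]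
  exact (run_pushWord _ X Y).mono (by
    simp only [List.length_append, List.length_cons, List.length_nil]
    omega)

theorem run_fixCmd {w : ℕ → ℕ} {N : ℕ} (j : ℕ) (x : List Bool) (X : List (Fin 5))
    (hw : ∀ i < x.length, w (j + i) + 1 < N) :
    Run (fixCmd w j x.length) (layout X (x.map bsym) [] [] [] [] [] [])
      (layout (((Formula.fixCode w j x).map bsym).reverse ++ X) [] [] [] [] [] [] [])
      (x.length * (N + 10) + 1) := by
  induction x generalizing j X with
  | nil => exact Run.skip.mono (by simp)
  | cons b x ih =>
    obtain ⟨hb, hx⟩ := (forall_lt_length_cons (p := fun i => w i + 1 < N)).1 hw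
    have first : Run (pop text (pushLit (w j + 1)))
        (layout X ((b :: x).map bsym) [] [] [] [] [] []) _ (N + 8 + 1) :=
      Run.pop_cons rfl (by simpa only [update_text] using run_pushLit hb b X (x.map bsym))
    have run := first.seq (ih (j + 1) _ hx)
    rw [← List.append_assoc, ← List.reverse_append, ← List.map_append] at run
    exact run.mono (by rw [List.length_cons, Nat.add_mul x.length]; omega)

/-- Given an input of length `n`, output the corresponding query; its code ends in `u`. -/
def queryCmd (w : ℕ → ℕ) (n : ℕ) (u : List Bool) : Cmd 8 5 :=
  transfer io text ;; pushWord [true, true, false, false, false] ;; fixCmd w 0 n ;; pushWord u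

theorem run_queryCmd {w : ℕ → ℕ} {N : ℕ} {x u : List Bool} (hw : ∀ i < x.length, w i + 1 < N) :
    Run (queryCmd w x.length u) (Stacks.single (x.map bsym).reverse)
      (Stacks.single
        (([true, true, false, false, false] ++ (Formula.fixCode w 0 x ++ u)).map bsym).reverse)
      (x.length * (N + 13) + u.length + 9) := by
  have copy := run_transfer (j := io) (k := text) (by decide)
    (layout (x.map bsym).reverse [] [] [] [] [] [] [])
  simp only [layout_io, layout_text, update_text, update_io, List.reverse_reverse,
    List.append_nil, List.length_reverse, List.length_map] at copy
  have run := copy.seq ((run_pushWord [true, true, false, false, false] [] (x.map bsym)).seq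
    ((run_fixCmd (w := w) (N := N) 0 x _ (by simpa using hw)).seq (run_pushWord u _ [])))
  simp only [← List.reverse_append, ← List.map_append, List.append_nil] at run
  rw [single_eq_layout (x.map bsym).reverse, single_eq_layout]
  simp only [List.append_assoc] at run ⊢
  refine run.mono ?_
  simp only [List.length_cons, List.length_nil, Nat.mul_add _ N]
  omega

/-- Given a fraction, decide whether it is nonzero. -/
def answerCmd : Cmd 8 5 :=
  transfer io text ;; pop text fun o => clear text ;; push io (if o = some 2 then 0 else 1)

theorem run_answerCmd (l : List (Fin 5)) : Run answerCmd (Stacks.single l.reverse)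
    (Stacks.single [if l.head? = some 2 then 0 else 1]) (6 * l.length + 10) := by
  have copy := run_transfer (j := io) (k := text) (by decide)
    (layout l.reverse [] [] [] [] [] [] [])
  simp only [layout_io, layout_text, update_text, update_io, List.reverse_reverse,
    List.append_nil, List.length_reverse] at copy
  have write (r : List (Fin 5)) (b : Fin 5) : Run (clear text ;; push io b)
      (layout [] r [] [] [] [] [] []) (layout [b] [] [] [] [] [] [] []) (3 * r.length + 2) := by
    have clear_text := run_clear text (layout [] r [] [] [] [] [] [])
    simp only [layout_text, update_text] at clear_text
    exact clear_text.seq (t' := 1) ((run_push (t := 0)).2 (by simp))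
  rw [single_eq_layout, single_eq_layout]
  refine (copy.seq ((run_pop (t := 3 * l.length + 2)).2 ?_)).mono (by omega)
  rcases l with _ | ⟨a, l⟩
  · exact write _ _
  · simp only [layout_text, update_text, List.head?_cons]
    exact (write _ _).mono (by simp)

/-- The word `fracWord a b` over the alphabet of stack programs. -/
def fracSyms (a b : ℕ) : List (Fin 5) := a.bits.map bsym ++ 2 :: b.bits.map bsym

theorem fracWord_eq (a b : ℕ) :
    fracWord a b = (fracSyms a b).map fun c : Fin 5 => (c : ℕ) + 1 := by
  rw [fracWord, word_eq, word_eq, fracSyms, List.map_append, List.map_cons]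
  rfl

theorem head?_fracSyms_eq_iff (a b : ℕ) : (fracSyms a b).head? = some 2 ↔ a = 0 := by
  refine ⟨fun h => ?_, fun h => by simp [fracSyms, h]⟩
  rcases hbits : a.bits with _ | ⟨d, l⟩
  · rwa [← List.length_eq_zero_iff, Nat.size_eq_bits_len, Nat.size_eq_zero] at hbits
  · simp only [fracSyms, hbits, List.map_cons, List.cons_append, List.head?_cons,
      Option.some.injEq] at h
    cases d <;> cases h

/-! ### Deciding a language by asking queries -/

theorem weight_switch_le {α : Type*} [DecidableEq α] {key : ℕ → Option α} {f : α → Prog} {B : ℕ}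
    (hf : ∀ a, (f a).weight ≤ B) (l : List α) :
    (Prog.switch key f l).weight ≤ l.length * (B + 1) + 1 := by
  induction l with
  | nil => exact le_add_self
  | cons a l ih =>
    have := hf a
    rw [Prog.switch, Prog.weight, List.length_cons, Nat.add_mul]
    omega

theorem weight_pop_le {K s B : ℕ} {k : Fin K} {f : Option (Fin s) → Cmd K s}
    (hf : ∀ o, (f o).toProg.weight ≤ B) : (pop k f).toProg.weight ≤ (s + 1) * (B + 6) := by
  have := weight_switch_le (key := track s k) (f := fun a => .seq
    (.act fun c => .write (setTrack k (none : Option (Fin s)) c))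
    (.seq .home (f (some a)).toProg)) (B := B + 5) (fun a => by
      have := hf (some a)
      simp only [Prog.weight, Prog.home]
      omega) (List.finRange s)
  have := hf none
  simp only [List.length_finRange, toProg, Prog.pop, Prog.walk, Prog.weight, Nat.add_mul s,
    Nat.add_assoc, Nat.reduceAdd] at *
  omega

theorem weight_pushWord (u : List Bool) : (pushWord u).toProg.weight = 7 * u.length + 1 := by
  induction u with
  | nil => rfl
  | cons b u ih =>
    have : (pushWord (b :: u)).toProg.weight = 7 + (pushWord u).toProg.weight := rfl
    rw [this, ih, List.length_cons]
    omega

theorem weight_fixCmd_le {w : ℕ → ℕ} {N : ℕ} (j n : ℕ) (hw : ∀ i < n, w (j + i) + 1 < N) :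
    (fixCmd w j n).toProg.weight ≤ n * (42 * N + 400) + 1 := by
  induction n generalizing j with
  | zero => rw [Nat.zero_mul]; rfl
  | succ n ih =>
    have hj : w j + 1 < N := hw 0 (by omega)
    have rest := ih (j + 1) fun i hi => by
      simpa [Nat.add_assoc, Nat.add_comm 1] using hw (i + 1) (by omega)
    have first := weight_pop_le (k := text) (f := pushLit (w j + 1)) (B := 7 * (N + 8) + 1)
      fun o => by
        have := Formula.length_enc_lit_le (w j + 1) (decide (o = some 1))
        rw [pushLit, weight_pushWord, List.length_append]
        simp only [List.length_cons, List.length_nil]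
        omega
    rw [fixCmd, toProg, Prog.weight, Nat.add_mul]
    omega

end SatProg

/-- Queries of size at most `m` about the membership in `L` of the words of length `n`. -/
structure QueryScheme (L : Language Bool) (n m : ℕ) where
  /-- The variables of `acceptance` that stand for the input. -/
  inputVar : ℕ → ℕ
  /-- The formula that is to be true of the input. -/
  acceptance : Formula
  /-- The number of variables of a query. -/
  numVars : ℕ
  inputVar_lt : ∀ i < n, inputVar i + 1 < numVars
  size_le : n * (numVars + 13) + (acceptance.and (.mentionAll numVars)).enc.length + 10 ≤ m
  exists_satisfiedBy : ∀ x : List Bool, x.length = n →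
    ∃ a, (Formula.query inputVar acceptance numVars x).SatisfiedBy a
  mem_iff : ∀ x : List Bool, x.length = n →
    (x ∈ L ↔ (Formula.query inputVar acceptance numVars x).satsFrom [false] ≠ ∅)

namespace QueryScheme

variable {L : Language Bool} {n m : ℕ} {q : TM}

/-- The query about `x`. -/
def query (Q : QueryScheme L n m) (x : List Bool) : Formula :=
  .query Q.inputVar Q.acceptance Q.numVars x

/-- The common end of all questions, that is, of the codes of the queries followed by `0`. -/
def suffix (Q : QueryScheme L n m) : List Bool :=
  (Q.acceptance.and (.mentionAll Q.numVars)).enc ++ [false]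

/-- Ask a query, run the machine `q` on it, and decide whether the result is nonzero. -/
def decider (Q : QueryScheme L n m) (q : TM) : Prog :=
  .seq (SatProg.queryCmd Q.inputVar n Q.suffix).toProg (.seq (.call q) SatProg.answerCmd.toProg)

theorem length_suffix_le (Q : QueryScheme L n m) :
    n * (Q.numVars + 13) + Q.suffix.length + 9 ≤ m := by
  have := Q.size_le
  rw [suffix, List.length_append, List.length_singleton]
  omega

theorem length_enc_query_le (Q : QueryScheme L n m) {x : List Bool} (hx : x.length = n) :
    (Q.query x).enc.length < m := by
  subst hx
  have := Formula.length_enc_query_le (ρ := Q.acceptance) Q.inputVar_lt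
  have := Q.size_le
  rw [Nat.mul_add] at *
  rw [query]
  omega

theorem enc_query_append (Q : QueryScheme L n m) (x : List Bool) :
    (Q.query x).enc ++ [false] = [true, true, false, false, false] ++
      (Formula.fixCode Q.inputVar 0 x ++ Q.suffix) := by
  simp [query, suffix, Formula.query, Formula.enc, Formula.enc_fixVars, unary]

theorem exists_weight_decider_le : ∃ A, ∀ {L n m} (Q : QueryScheme L n m) (q : TM),
    (Q.decider q).weight ≤ A + 42 * m + 2 * q.code.length := by
  refine ⟨(Cmd.transfer 0 1 : Cmd 8 5).toProg.weight + 38 + SatProg.answerCmd.toProg.weight,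
    fun {L n m} Q q => ?_⟩
  have := SatProg.weight_fixCmd_le 0 n (by simpa using Q.inputVar_lt)
  have := Q.length_suffix_le
  simp only [decider, SatProg.queryCmd, Cmd.toProg, Prog.weight, SatProg.weight_pushWord,
    List.length_cons, List.length_nil]
  grind

theorem writesBelow_decider (Q : QueryScheme L n m) (q : TM) :
    (Q.decider q).WritesBelow ((5 + 1) ^ 8) :=
  ⟨Cmd.writesBelow_toProg _, trivial, Cmd.writesBelow_toProg _⟩

/-- The running time of a decider with queries of size `m` answered in time `T`. -/
def deciderTime (m T : ℕ) : ℕ :=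
  m * (8 * m + 15) + (T + 1) + (6 * (m + T) + 10) * (28 * (m + T) + 55)

theorem decider_outputs (Q : QueryScheme L n m) {x : List Bool} (hx : x.length = n) {a b T : ℕ}
    (hq : q.Outputs (word ((Q.query x).enc ++ [false])) (fracWord a b) T) :
    ((Q.decider q).toTM ((5 + 1) ^ 8)).Outputs (word x) (word [decide (a ≠ 0)])
      (deciderTime m T) := by
  have hsize := Q.length_suffix_le
  have hquery := Q.length_enc_query_le hx
  have hanswer := hq.length_le (zero_notMem_fracWord a b)
  subst hx
  have hn : x.length ≤ x.length * (Q.numVars + 13) := Nat.le_mul_of_pos_right _ (by omega)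
  simp only [SatProg.fracWord_eq, word, List.length_map, List.length_append,
    List.length_singleton] at hanswer
  have ask := (SatProg.run_queryCmd (u := Q.suffix) Q.inputVar_lt).toProg_single
  rw [← Q.enc_query_append, ← SatProg.word_eq, ← SatProg.word_eq, List.length_map] at ask
  have call : Prog.Run ((5 + 1) ^ 8) (.call q) _ _ (T + 1) := .call hq (by
    rw [SatProg.fracWord_eq, ← Stacks.tape_single (K := 7)]
    exact Stacks.head_lt _ _)
  have hbit : [if (SatProg.fracSyms a b).head? = some 2 then 0 else (1 : Fin 5)] =
      [decide (a ≠ 0)].map SatProg.bsym := by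
    simp only [SatProg.head?_fracSyms_eq_iff]
    by_cases ha : a = 0 <;> simp [ha, SatProg.bsym]
  have answer := Cmd.Run.toProg_single (l' := [_]) (SatProg.run_answerCmd (SatProg.fracSyms a b))
  rw [hbit, ← SatProg.word_eq, ← SatProg.fracWord_eq] at answer
  refine ((ask.seq (call.seq answer)).mono ?_).outputs
  rw [deciderTime, Nat.add_assoc (m * _)]
  exact Nat.add_le_add (Nat.mul_le_mul (by omega) (by omega)) (Nat.add_le_add_left
    (Nat.mul_le_mul (by omega) (by omega)) _)

theorem decider_answers (Q : QueryScheme L n m) {x : List Bool} (hx : x.length = n) {T : ℕ}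
    (hq : q.OutputsValue (word ((Q.query x).enc ++ [false]))
      (satWeight.localProb (Q.query x).enc (some false)) T) :
    ((Q.decider q).toTM ((5 + 1) ^ 8)).Answers (word x) (x ∈ L) (deciderTime m T) := by
  obtain ⟨a, b, hb, hab, hout⟩ := hq
  obtain ⟨c, hc⟩ := Q.exists_satisfiedBy x hx
  have mem_iff : x ∈ L ↔ a ≠ 0 := by
    rw [Q.mem_iff x hx, ne_eq, ne_eq, ← hc.localProb_eq_zero_iff, ← query, ← hab]
    simp [hb]
  have outputs := Q.decider_outputs hx hout
  exact ⟨fun h => by simpa [mem_iff.1 h] using outputs,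
    fun h => by simpa [not_not.1 (mt mem_iff.2 h)] using outputs⟩

end QueryScheme

/-! ### Languages in NP -/

/-- `f` is bounded by a polynomial. -/
@[fun_prop]
def PolyBounded (f : ℕ → ℕ) : Prop := ∃ P : Polynomial ℕ, ∀ n, f n ≤ P.eval n

theorem monotone_eval (P : Polynomial ℕ) : Monotone fun n => P.eval n := by
  intro a b h
  simp only [Polynomial.eval_eq_sum_range]
  gcongr

namespace PolyBounded

variable {f g : ℕ → ℕ}

@[fun_prop]
theorem const (c : ℕ) : PolyBounded fun _ => c := ⟨.C c, fun n => by rw [Polynomial.eval_C]⟩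

@[fun_prop]
theorem id : PolyBounded fun n => n := ⟨.X, fun n => by rw [Polynomial.eval_X]⟩

@[fun_prop]
theorem add (hf : PolyBounded f) (hg : PolyBounded g) : PolyBounded fun n => f n + g n := by
  obtain ⟨P, hP⟩ := hf
  obtain ⟨Q, hQ⟩ := hg
  exact ⟨P + Q, fun n => by rw [Polynomial.eval_add]; exact Nat.add_le_add (hP n) (hQ n)⟩

@[fun_prop]
theorem mul (hf : PolyBounded f) (hg : PolyBounded g) : PolyBounded fun n => f n * g n := by
  obtain ⟨P, hP⟩ := hf
  obtain ⟨Q, hQ⟩ := hg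
  exact ⟨P * Q, fun n => by rw [Polynomial.eval_mul]; exact Nat.mul_le_mul (hP n) (hQ n)⟩

@[fun_prop]
theorem pow (hf : PolyBounded f) (k : ℕ) : PolyBounded fun n => f n ^ k := by
  obtain ⟨P, hP⟩ := hf
  exact ⟨P ^ k, fun n => by rw [Polynomial.eval_pow]; exact Nat.pow_le_pow_left (hP n) k⟩

@[fun_prop]
theorem eval (P : Polynomial ℕ) (hf : PolyBounded f) : PolyBounded fun n => P.eval (f n) := by
  obtain ⟨Q, hQ⟩ := hf
  exact ⟨P.comp Q, fun n => by rw [Polynomial.eval_comp]; exact monotone_eval P (hQ n)⟩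

end PolyBounded

namespace QueryScheme

variable {L : Language Bool}

/-- The number of variables of a query about the existence of an accepting tableau. -/
def numVarsFor (D t n : ℕ) : ℕ := (2 * t + D + n + 8) ^ 8 + 2

/-- The size of a query about the existence of an accepting tableau. -/
def sizeFor (D t k n : ℕ) : ℕ :=
  n * (numVarsFor D t n + 13) + (Tableau.acceptingBound D t k (numVarsFor D t n) +
    numVarsFor D t n * (2 * numVarsFor D t n + 12)) + 22

theorem polyBounded_sizeFor (D : ℕ) {t k : ℕ → ℕ} (ht : PolyBounded t) (hk : PolyBounded k) :
    PolyBounded fun n => sizeFor D (t n) (k n) n := by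
  unfold sizeFor Tableau.acceptingBound Tableau.validStepsBound numVarsFor
  fun_prop

theorem nonempty_of_answers {V : TM} {D t k n : ℕ} {R : List Bool → List Bool → Prop}
    (hV : V.BoundedBy D) (hR : ∀ x c : List Bool, x.length = n → c.length ≤ k →
      V.Answers (word x ++ sepSym :: word c) (R x c) t)
    (hL : ∀ x : List Bool, x.length = n → (x ∈ L ↔ ∃ c : List Bool, c.length ≤ k ∧ R x c)) :
    Nonempty (QueryScheme L n (sizeFor D t k n)) := by
  set N := numVarsFor D t n with hN
  obtain ⟨ρ, hρ, hvars, hlen⟩ := Tableau.expressible_accepting (n := n) (k := k) (t := t) (D := D)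
    V (N := N) (W := 2 * t + D + n + 8) rfl (by omega) (by omega) (by omega)
  have hN0 : 0 < N := by rw [hN, numVarsFor]; omega
  have hw : ∀ j < n, Tableau.cellVar 0 (t + j) 2 + 1 < N := fun j hj => by
    have := Tableau.cellVar_lt (W := 2 * t + D + n + 8) (i := 0) (p := t + j) (s := 2)
      (by omega) (by omega) (by omega) (by omega)
    rw [hN, numVarsFor]
    omega
  refine ⟨fun j => Tableau.cellVar 0 (t + j) 2, ρ, N, hw, ?_, ?_, ?_⟩
  · have := Formula.length_enc_mentionAll_le (le_refl N)
    simp only [Formula.enc, List.length_append, List.length_cons, List.length_nil, sizeFor, ← hN]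
    omega
  · rintro x rfl
    exact Formula.exists_satisfiedBy_query hN0 hw hvars
  · rintro x rfl
    rw [ne_eq, Formula.satsFrom_query_eq_empty_iff hN0 hw hvars hρ, not_not, hL x rfl,
      Tableau.exists_accepting_iff hV fun c hc => hR x c rfl hc]

theorem exists_length_code_decider_le : ∃ C : Polynomial ℕ, ∀ {L n m} (Q : QueryScheme L n m)
    (q : TM), ((Q.decider q).toTM ((5 + 1) ^ 8)).code.length ≤ C.eval (m + q.code.length) := by
  obtain ⟨A, hA⟩ := exists_weight_decider_le
  obtain ⟨C, hC⟩ : PolyBounded fun s => (A + 42 * s) * (((5 + 1) ^ 8 + 1) *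
    (2 * (A + 42 * s) + 2 * (5 + 1) ^ 8 + 6)) + 1 := by fun_prop
  refine ⟨C, fun {L n m} Q q => ?_⟩
  have weight_le : (Q.decider q).weight ≤ A + 42 * (m + q.code.length) :=
    (hA Q q).trans (by omega)
  refine (Prog.length_code_toTM_le (Q.writesBelow_decider q)).trans (le_trans ?_ (hC _))
  beta_reduce
  gcongr

theorem exists_of_mem_NP (hL : L ∈ NP) :
    ∃ m, PolyBounded m ∧ ∀ n, Nonempty (QueryScheme L n (m n)) := by
  obtain ⟨R, V, T, P, hV, hL⟩ := hL
  obtain ⟨D, hD⟩ := V.exists_boundedBy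
  let k n := P.eval n
  let t n := T.eval (n + k n)
  refine ⟨fun n => sizeFor D (t n) (k n) n, polyBounded_sizeFor D (.eval T (.add .id (.eval P .id)))
    (.eval P .id), fun n => nonempty_of_answers hD (fun x c hx hc => ?_) fun x hx => hx ▸ hL x⟩
  have time_le : T.eval (x.length + c.length) ≤ t n := monotone_eval T (by omega)
  exact ⟨fun h => ((hV x c).1 h).mono time_le, fun h => ((hV x c).2 h).mono time_le⟩

end QueryScheme

theorem mem_PPoly_of_polyBounded {L : Language Bool} {f : ℕ → ℕ} (hf : PolyBounded f)
    (h : ∀ n, ∃ M : TM, M.code.length ≤ f n ∧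
      ∀ x : List Bool, x.length = n → M.Answers (word x) (x ∈ L) (f n)) : L ∈ PPoly := by
  obtain ⟨P, hP⟩ := hf
  choose M hcode hM using h
  refine ⟨[], fun n => (M n).code, P, fun n => ⟨(hcode n).trans (hP n), M n, ?_, fun x hx => ?_⟩⟩
  · exact TM.outputs_iff.2 ⟨0, Nat.zero_le _, 0, TM.steps_zero.2 rfl, rfl⟩
  · exact ⟨fun hL => ((hM n x hx).1 hL).mono (hP n), fun hL => ((hM n x hx).2 hL).mono (hP n)⟩

theorem mem_PPoly_of_mem_NP {M : TM} {θ : ℕ → List Bool}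
    (h : satWeight.EfficientlyLocallyNormalizedBy M θ) {L : Language Bool} (hL : L ∈ NP) :
    L ∈ PPoly := by
  obtain ⟨-, P, h⟩ := h
  obtain ⟨m, hm, hQ⟩ := QueryScheme.exists_of_mem_NP hL
  obtain ⟨C, hC⟩ := QueryScheme.exists_length_code_decider_le
  have hbound : PolyBounded fun n => C.eval (m n + 2 * P.eval (m n)) +
      QueryScheme.deciderTime (m n) (P.eval (m n)) := by
    unfold QueryScheme.deciderTime
    fun_prop
  refine mem_PPoly_of_polyBounded hbound fun n => ?_
  obtain ⟨Q⟩ := hQ n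
  obtain ⟨hθ, q, hq, hprob⟩ := h (m n)
  refine ⟨(Q.decider q).toTM ((5 + 1) ^ 8), ?_, fun x hx => ?_⟩
  · have code_le : q.code.length ≤ 2 * P.eval (m n) := by
      have := hq.length_le (zero_notMem_word _)
      simp only [word, List.length_map] at this
      omega
    exact (hC Q q).trans (le_add_right (monotone_eval C (by omega)))
  · obtain ⟨c, hc⟩ := Q.exists_satisfiedBy x hx
    have answers := Q.decider_answers hx ((hprob _ (some false) (Q.length_enc_query_le hx).le).2
      hc.prefixWeight_pos (localProb_enc_mem_range _ _))
    exact ⟨fun h => (answers.1 h).mono le_add_self, fun h => (answers.2 h).mono le_add_self⟩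

end SeqModel

theorem theorem1 :
    SeqModel.satWeight.EfficientlyComputable ∧
    SeqModel.satWeight.Normalizable ∧
    (¬ SeqModel.NP ⊆ SeqModel.PPoly →
      ¬ ∃ (M : SeqModel.TM) (θ : ℕ → List Bool),
        SeqModel.satWeight.EfficientlyLocallyNormalizedBy M θ) := by
  refine ⟨SeqModel.satWeight_efficientlyComputable, SeqModel.satWeight_normalizable, ?_⟩
  rintro hNP ⟨M, θ, h⟩
  exact hNP fun L hL => SeqModel.mem_PPoly_of_mem_NP h hL
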